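/- Let $\mathbf K$ be $\mathbf R$, $\mathbf C$ or the quaternions $\mathbf H$, let $p\ge 1$ be an integer and let $\kappa$ be an infinite cardinal. Let $\mathcal H$ be the right $\mathbf K$-Hilbert space with orthonormal basis $(e_i)_{i\in p\sqcup\kappa}$, with the quadratic form $Q(x)=\sum_{i\in p}|x_i|^2-\sum_{i\in\kappa}|x_i|^2$ for $x=\sum e_ix_i$. Let $\mathrm O_{\mathbf K}(p,\kappa)$ be the group of bounded invertible $\mathbf K$-linear operators of $\mathcal H$ preserving $Q$, and let $\mathrm{PO}_{\mathbf K}(p,\kappa)$ be its quotient by its centre. It acts on the symmetric space $\mathcal X_{\mathbf K}(p,\kappa)$ of $p$-dimensional $\mathbf K$-subspaces $V\le\mathcal H$ with $Q|_V>0$ (with its usual topology, as an open subset of the Grassmannian), and is endowed with the topology of pointwise convergence on $\mathcal X_{\mathbf K}(p,\kappa)$. Let $\mathrm O^o_{\mathbf R}(p,\kappa)$ be the orthochronous group, i.e. the group of $g\in\mathrm O_{\mathbf R}(p,\kappa)$ such that $\det\big((\pi_P\circ g)|_P\big)>0$, where $P=\mathrm{span}(e_i)_{i\in p}$ and $\pi_P$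 is the orthogonal projection to $P$, and let $\mathrm{PO}^o_{\mathbf R}(p,\kappa)$ be its image in $\mathrm{PO}_{\mathbf R}(p,\kappa)$, with the induced topology. Then $\mathrm{PO}_{\mathbf C}(p,\kappa)$, $\mathrm{PO}_{\mathbf H}(p,\kappa)$ and $\mathrm{PO}^o_{\mathbf R}(p,\kappa)$ are topological groups, they are Polish if $\kappa=\aleph_0$, and they are topologically simple: every non-trivial normal subgroup is dense. Moreover, let $G$ be one of these three groups and let $N\le G$ be the image in $G$ of the following group of operators $g$ such that $g-\mathrm{Id}$ has finite rank: those in $\mathrm O_{\mathbf C}(p,\kappa)$ of determinant $1$; all those in $\mathrm O_{\mathbf H}(p,\kappa)$; those in $\mathrm O^o_{\mathbf R}(p,\kappa)$ of determinant $1$, respectively. (The determinant of such a $g$ is that of its restriction to any finite-dimensional subspace containing the range of $g-\mathrm{Id}$.) Then $N$ is a simple group and is dense in $G$. -/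

import Mathlib

open scoped Quaternion

namespace IndefiniteUnitary

noncomputable section

/-- The common features of the three scalar rings `ℝ`, `ℂ`, `ℍ` that are used below: a
finite-dimensional real algebra whose real inner product is `⟪a, b⟫ = Re (star a * b)`.
Instances for `ℝ`, `ℂ` and `ℍ` are given below. -/
class HermitianScalars (K : Type) [NormedDivisionRing K] [StarRing K]
    [InnerProductSpace ℝ K] : Prop extends
    IsScalarTower ℝ K K, SMulCommClass ℝ K K, Module.Finite ℝ K where
  star_mul_add_star_mul (a b : K) :
    star a * b + star b * a = (2 * inner ℝ a b) • (1 : K)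

instance : HermitianScalars ℝ where
  star_mul_add_star_mul a b := by simp; ring

instance : HermitianScalars ℂ where
  star_mul_add_star_mul a b := by
    apply Complex.ext <;> simp [Complex.inner] <;> ring

instance : HermitianScalars ℍ[ℝ] where
  star_mul_add_star_mul a b := by
    ext <;> simp [Quaternion.inner_def] <;> ring

universe u

set_option linter.unusedSectionVars false

section Space

variable (K : Type) [NormedDivisionRing K] [StarRing K] [InnerProductSpace ℝ K]
  [HermitianScalars K] (p : ℕ) (I : Type u)

/-- The Hilbert space `ℓ²(p ⊔ I)` over `K`, with orthonormal basis indexed by the disjoint union of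
`{1, …, p}` and `I` (so `κ = #I`). It is a right `K`-space, that is, a `Kᵐᵒᵖ`-module. -/
abbrev Hilb : Type u := lp (fun _ : Fin p ⊕ I => K) 2

variable {p I}

/-- The sign of a basis vector: `+1` on `{1, …, p}` and `-1` on `I`. -/
def sgn : Fin p ⊕ I → ℝ := Sum.elim (fun _ => 1) (fun _ => -1)

variable {K}

/-- The quadratic form `Q(x) = ∑_{i ≤ p} |x i|² - ∑_{i ∈ I} |x i|²`. -/
def Q (x : Hilb K p I) : ℝ := ∑' i, sgn i * ‖x i‖ ^ 2

variable (K p I)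

/-- The orthogonal group `O_K(p, κ)` of `Q`: bounded invertible right `K`-linear operators
preserving `Q`. -/
def O : Subgroup (Hilb K p I ≃L[Kᵐᵒᵖ] Hilb K p I) where
  carrier := {g | ∀ x, Q (g x) = Q x}
  one_mem' _ := rfl
  mul_mem' {a b} ha hb x := (ha (b x)).trans (hb x)
  inv_mem' {a} ha x := by
    have h := ha (a⁻¹ x)
    rw [← h]
    congr 1
    exact (a.apply_symm_apply x)

/-- The symmetric space `X_K(p, κ)`: the `p`-dimensional `K`-subspaces on which `Q` is positive
definite. -/
def X : Type u :=
  {V : Submodule Kᵐᵒᵖ (Hilb K p I) //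
    Module.Finite Kᵐᵒᵖ V ∧ Module.finrank Kᵐᵒᵖ V = p ∧ ∀ x ∈ V, x ≠ 0 → 0 < Q x}

end Space

section Topology

variable {K : Type} [NormedDivisionRing K] [StarRing K] [InnerProductSpace ℝ K]
  [HermitianScalars K] {p : ℕ} {I : Type u}

lemma finiteDimensional_restrictScalars (V : X K p I) :
    FiniteDimensional ℝ (V.1.restrictScalars ℝ) := by
  have := V.2.1
  have : Module.Finite ℝ V.1 := Module.Finite.trans Kᵐᵒᵖ V.1
  exact this

/-- The orthogonal projection of the Hilbert space onto `V ∈ X_K(p, κ)`, for the Hilbert space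
scalar product. -/
def proj (V : X K p I) : Hilb K p I →L[ℝ] Hilb K p I :=
  haveI := finiteDimensional_restrictScalars V
  (V.1.restrictScalars ℝ).starProjection

/-- The topology of `X_K(p, κ)` (the one of its Riemannian distance) is its manifold topology, as
an open subset of the Grassmannian of `p`-dimensional subspaces: `V` is near `W` when the
orthogonal projections onto `V` and `W` are near in operator norm. -/
instance : TopologicalSpace (X K p I) := TopologicalSpace.induced proj inferInstance

instance : MulAction (O K p I) (X K p I) where
  smul g V := ⟨V.1.map ((g : Hilb K p I ≃L[Kᵐᵒᵖ] Hilb K p I) : Hilb K p I →ₗ[Kᵐᵒᵖ] Hilb K p I), by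
    obtain ⟨V, h1, h2, h3⟩ := V
    refine ⟨inferInstance, ?_, ?_⟩
    · exact (LinearEquiv.finrank_map_eq g.1.toLinearEquiv V).trans h2
    · rintro _ ⟨x, hx, rfl⟩ hne
      have := h3 x hx (by rintro rfl; simp at hne)
      rw [← g.2 x] at this
      exact this⟩
  one_smul V := Subtype.ext (Submodule.map_id V.1)
  mul_smul g h V := Subtype.ext (Submodule.map_comp _ _ V.1)

end Topology

section Center

variable {K : Type} [NormedDivisionRing K] [StarRing K] [InnerProductSpace ℝ K]
  [HermitianScalars K] {p : ℕ} {I : Type u}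

lemma star_mul_self_eq (a : K) : star a * a = (‖a‖ ^ 2) • (1 : K) := by
  have h := HermitianScalars.star_mul_add_star_mul a a
  rw [real_inner_self_eq_norm_sq, mul_smul, ← two_smul ℝ] at h
  exact smul_right_injective K (two_ne_zero) h

lemma norm_star_eq (a : K) : ‖star a‖ = ‖a‖ := by
  by_cases ha : a = 0
  · simp [ha]
  have h := congrArg norm (star_mul_self_eq a)
  rw [norm_mul, norm_smul, norm_one, mul_one, Real.norm_of_nonneg (by positivity), pow_two] at h
  exact mul_right_cancel₀ (norm_ne_zero_iff.2 ha) h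

lemma inner_mul_right_eq (a b c : K) : inner ℝ a (b * c) = inner ℝ (star b * a) c := by
  have h1 := HermitianScalars.star_mul_add_star_mul a (b * c)
  have h2 := HermitianScalars.star_mul_add_star_mul (star b * a) c
  simp only [star_mul, star_star, mul_assoc] at h1 h2
  rw [h1] at h2
  have := smul_left_injective ℝ (one_ne_zero (α := K)) h2
  simpa using this

lemma summable_norm_sq (x : Hilb K p I) : Summable fun i => ‖x i‖ ^ 2 := by
  have := (lp.memℓp x).summable (by norm_num)
  simpa using this

lemma norm_sgn (i : Fin p ⊕ I) : ‖(sgn i : ℝ)‖ = 1 := by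
  rcases i with i | i <;> simp [sgn]

lemma summable_Q (x : Hilb K p I) : Summable fun i => sgn i * ‖x i‖ ^ 2 := by
  refine Summable.of_norm ?_
  simpa only [norm_mul, norm_sgn, norm_pow, norm_norm, one_mul] using summable_norm_sq x

/-- The Hermitian form `φ` obtained by polarization of `Q`. -/
def form (x y : Hilb K p I) : K := ∑' i, sgn i • (star (x i) * y i)

lemma summable_form_norm (x y : Hilb K p I) : Summable fun i => ‖x i‖ * ‖y i‖ := by
  refine Summable.of_nonneg_of_le (fun i => by positivity) (fun i => ?_)
    ((summable_norm_sq x).add (summable_norm_sq y))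
  nlinarith [sq_nonneg (‖x i‖ - ‖y i‖), sq_nonneg (‖x i‖ + ‖y i‖)]

lemma summable_form (x y : Hilb K p I) : Summable fun i => sgn i • (star (x i) * y i) := by
  have : CompleteSpace K := FiniteDimensional.complete ℝ K
  refine Summable.of_norm ?_
  simpa only [norm_smul, norm_sgn, norm_star_eq, norm_mul, one_mul] using summable_form_norm x y

lemma norm_form_le (x y : Hilb K p I) : ‖form x y‖ ≤ ‖x‖ * ‖y‖ := by
  have hs : Summable fun i => ‖sgn i • (star (x i) * y i)‖ := by
    simpa only [norm_smul, norm_sgn, norm_star_eq, norm_mul, one_mul] using summable_form_norm x y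
  refine (norm_tsum_le_tsum_norm hs).trans ?_
  simp only [norm_smul, norm_sgn, norm_star_eq, norm_mul, one_mul]
  have h := Real.inner_le_Lp_mul_Lq_tsum_of_nonneg (p := 2) (q := 2)
    (f := fun i => ‖x i‖) (g := fun i => ‖y i‖) (by constructor <;> norm_num)
    (fun i => norm_nonneg _) (fun i => norm_nonneg _)
    (by simpa using summable_norm_sq x) (by simpa using summable_norm_sq y)
  rw [lp.norm_eq_tsum_rpow (by norm_num) x, lp.norm_eq_tsum_rpow (by norm_num) y]
  simpa using h

lemma form_add_right (x y z : Hilb K p I) : form x (y + z) = form x y + form x z := by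
  simp only [form, lp.coeFn_add, Pi.add_apply, mul_add, smul_add]
  exact (summable_form x y).tsum_add (summable_form x z)

lemma form_smul_right (x y : Hilb K p I) (a : K) :
    form x (MulOpposite.op a • y) = form x y * a := by
  simp only [form, lp.coeFn_smul, Pi.smul_apply, MulOpposite.smul_eq_mul_unop,
    MulOpposite.unop_op]
  rw [← (summable_form x y).tsum_mul_right]
  simp [smul_mul_assoc, mul_assoc]

lemma form_self (x : Hilb K p I) : form x x = Q x • (1 : K) := by
  simp only [form, Q, star_mul_self_eq, smul_smul]
  exact ((summable_Q x).tsum_smul_const _)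

/-- Expansion of `Q (x - v a)`. -/
lemma Q_sub_smul (x v : Hilb K p I) (a : K) :
    Q (x - MulOpposite.op a • v) = Q x - 2 * inner ℝ (form v x) a + ‖a‖ ^ 2 * Q v := by
  have h1 : HasSum (fun i => inner ℝ (sgn i • (star (v i) * x i)) a)
      (inner ℝ (form v x) a) := by
    have := (summable_form v x).hasSum.mapL (innerSL ℝ a)
    simp only [innerSL_apply_apply] at this
    simp only [real_inner_comm a]
    exact this
  have h2 := (((summable_Q x).hasSum.sub (h1.mul_left 2)).add
    ((summable_Q v).hasSum.mul_left (‖a‖ ^ 2)))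
  refine Eq.trans (tsum_congr fun i => ?_) h2.tsum_eq
  have h3 := norm_sub_sq_real (x i) (v i * a)
  rw [inner_mul_right_eq, norm_mul] at h3
  simp only [lp.coeFn_sub, Pi.sub_apply, lp.coeFn_smul, Pi.smul_apply,
    MulOpposite.smul_eq_mul_unop, MulOpposite.unop_op, h3, real_inner_smul_left]
  ring

lemma continuous_form_right (v : Hilb K p I) : Continuous (form v) := by
  let f : Hilb K p I →+ K := AddMonoidHom.mk' (form v) (form_add_right v)
  exact AddMonoidHomClass.continuous_of_bound f ‖v‖ (norm_form_le v)

/-- The orthogonal reflection `x ↦ x - v (2 φ(v, x) / Q(v))` in a non-isotropic vector `v`. -/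
def reflFun (v : Hilb K p I) (x : Hilb K p I) : Hilb K p I :=
  x - MulOpposite.op ((2 / Q v) • form v x) • v

lemma form_reflFun (v x : Hilb K p I) (hv : Q v ≠ 0) : form v (reflFun v x) = -form v x := by
  have h : reflFun v x = x + MulOpposite.op (-((2 / Q v) • form v x)) • v := by
    simp [reflFun, sub_eq_add_neg]
  rw [h, form_add_right, form_smul_right, form_self, smul_mul_assoc, one_mul, smul_neg, smul_smul,
    mul_div_cancel₀ _ hv, two_smul]
  abel

/-- The reflection in `v`, as an element of the orthogonal group. -/
def refl (v : Hilb K p I) (hv : Q v ≠ 0) : O K p I :=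
  have hinv : Function.Involutive (reflFun v) := by
    intro x
    conv_lhs => rw [reflFun]
    rw [form_reflFun v x hv]
    simp [reflFun]
  have hcont : Continuous (reflFun v) := by
    unfold reflFun
    have := continuous_form_right v
    fun_prop
  ⟨{ toFun := reflFun v
     invFun := reflFun v
     left_inv := hinv
     right_inv := hinv
     map_add' := by
      intro x y
      simp only [reflFun, form_add_right, smul_add, MulOpposite.op_add, add_smul]
      abel
     map_smul' := by
      intro a x
      induction a using MulOpposite.rec' with
      | _ a =>
      simp only [reflFun, form_smul_right, RingHom.id_apply, smul_sub, smul_smul,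
        ← MulOpposite.op_mul, smul_mul_assoc]
     continuous_toFun := hcont
     continuous_invFun := hcont }, by
    intro x
    change Q (x - _) = _
    rw [Q_sub_smul, real_inner_smul_right, real_inner_self_eq_norm_sq, norm_smul, mul_pow,
      Real.norm_eq_abs, sq_abs]
    field_simp
    ring⟩

lemma refl_apply (v : Hilb K p I) (hv : Q v ≠ 0) (x : Hilb K p I) :
    (refl v hv).1 x = x - MulOpposite.op ((2 / Q v) • form v x) • v := rfl

/-- A central element of the orthogonal group preserves every non-isotropic line. -/
lemma center_apply (z : O K p I) (hz : z ∈ Subgroup.center (O K p I)) (v : Hilb K p I)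
    (hv : Q v ≠ 0) : ∃ a : Kᵐᵒᵖ, z.1 v = a • v := by
  have hcomm : refl v hv * z = z * refl v hv := Subgroup.mem_center_iff.1 hz _
  have h := congrArg (fun g : O K p I => g.1 v) hcomm
  change (refl v hv).1 (z.1 v) = z.1 ((refl v hv).1 v) at h
  have hvv : (refl v hv).1 v = -v := by
    rw [refl_apply, form_self, smul_smul, div_mul_cancel₀ _ hv, two_smul, MulOpposite.op_add,
      MulOpposite.op_one, add_smul, one_smul]
    abel
  rw [hvv, map_neg, refl_apply, sub_eq_iff_eq_add, ← sub_eq_neg_add, eq_comm,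
    sub_eq_iff_eq_add, ← two_smul ℝ] at h
  refine ⟨(2⁻¹ : ℝ) • MulOpposite.op ((2 / Q v) • form v (z.1 v)), ?_⟩
  rw [smul_assoc, h, smul_smul, inv_mul_cancel₀ (two_ne_zero), one_smul]

lemma center_smul (z : O K p I) (hz : z ∈ Subgroup.center (O K p I)) (V : X K p I) :
    z • V = V := by
  have key : ∀ z ∈ Subgroup.center (O K p I), ∀ x ∈ V.1, z.1 x ∈ V.1 := by
    intro z hz x hx
    by_cases h0 : x = 0
    · simp [h0]
    obtain ⟨a, ha⟩ := center_apply z hz x (V.2.2.2 x hx h0).ne'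
    rw [ha]
    exact V.1.smul_mem a hx
  refine Subtype.ext (le_antisymm ?_ ?_)
  · rintro _ ⟨x, hx, rfl⟩
    exact key z hz x hx
  · intro x hx
    exact ⟨z⁻¹.1 x, key z⁻¹ (inv_mem hz) x hx, z.1.apply_symm_apply x⟩

end Center

section ProjectiveGroup

variable (K : Type) [NormedDivisionRing K] [StarRing K] [InnerProductSpace ℝ K]
  [HermitianScalars K] (p : ℕ) (I : Type u)

/-- The projective orthogonal group `PO_K(p, κ)`: the quotient of `O_K(p, κ)` by its centre. -/
def PO : Type u := O K p I ⧸ Subgroup.center (O K p I)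

instance : Group (PO K p I) :=
  inferInstanceAs (Group (O K p I ⧸ Subgroup.center (O K p I)))

/-- The quotient map `O_K(p, κ) → PO_K(p, κ)`. -/
def toPO : O K p I →* PO K p I := QuotientGroup.mk' (Subgroup.center (O K p I))

/-- The action of `PO_K(p, κ)` on `X_K(p, κ)`, as a homomorphism to the permutation group. -/
def toPerm : PO K p I →* Equiv.Perm (X K p I) :=
  QuotientGroup.lift (Subgroup.center (O K p I)) (MulAction.toPermHom (O K p I) (X K p I))
    fun z hz => Equiv.ext fun V => center_smul z hz V

instance : MulAction (PO K p I) (X K p I) := MulAction.compHom _ (toPerm K p I)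

lemma toPO_smul (g : O K p I) (V : X K p I) : toPO K p I g • V = g • V := rfl

/-- The topology of pointwise convergence on `X_K(p, κ)`. -/
instance : TopologicalSpace (PO K p I) :=
  TopologicalSpace.induced (fun g (V : X K p I) => g • V) Pi.topologicalSpace

variable {K p I}

/-- The range of `g - Id`. -/
def moved (g : Hilb K p I ≃L[Kᵐᵒᵖ] Hilb K p I) : Submodule Kᵐᵒᵖ (Hilb K p I) :=
  LinearMap.range ((g : Hilb K p I →ₗ[Kᵐᵒᵖ] Hilb K p I) - LinearMap.id)

lemma sub_mem_moved (g : Hilb K p I ≃L[Kᵐᵒᵖ] Hilb K p I) (x : Hilb K p I) :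
    g x - x ∈ moved g := ⟨x, rfl⟩

lemma moved_le_iff {g : Hilb K p I ≃L[Kᵐᵒᵖ] Hilb K p I} {E : Submodule Kᵐᵒᵖ (Hilb K p I)} :
    moved g ≤ E ↔ ∀ x, g x - x ∈ E := by
  constructor
  · exact fun h x => h (sub_mem_moved g x)
  · rintro h _ ⟨x, rfl⟩
    exact h x

lemma moved_one_le (E : Submodule Kᵐᵒᵖ (Hilb K p I)) :
    moved (1 : Hilb K p I ≃L[Kᵐᵒᵖ] Hilb K p I) ≤ E := by
  rw [moved_le_iff]
  intro x
  change x - x ∈ E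
  simp

lemma moved_mul_le {g h : Hilb K p I ≃L[Kᵐᵒᵖ] Hilb K p I} {E : Submodule Kᵐᵒᵖ (Hilb K p I)}
    (hg : moved g ≤ E) (hh : moved h ≤ E) : moved (g * h) ≤ E := by
  rw [moved_le_iff] at *
  intro x
  change g (h x) - x ∈ E
  have := E.add_mem (hg (h x)) (hh x)
  simpa using this

lemma moved_inv_le {g : Hilb K p I ≃L[Kᵐᵒᵖ] Hilb K p I} {E : Submodule Kᵐᵒᵖ (Hilb K p I)}
    (hg : moved g ≤ E) : moved g⁻¹ ≤ E := by
  rw [moved_le_iff] at *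
  intro x
  have h1 : g (g⁻¹ x) = x := g.apply_symm_apply x
  have := hg (g⁻¹ x)
  rw [h1] at this
  simpa using E.neg_mem this

variable (K p I)

/-- The subgroup of `O_K(p, κ)` of finite rank perturbations of the identity. -/
def Ofr : Subgroup (O K p I) where
  carrier := {g | Module.Finite Kᵐᵒᵖ (moved g.1)}
  one_mem' := by
    have h : moved (1 : O K p I).1 = ⊥ := le_bot_iff.1 (moved_one_le ⊥)
    change Module.Finite Kᵐᵒᵖ (moved (1 : O K p I).1)
    rw [h]
    infer_instance
  mul_mem' {g h} hg hh := by
    have : Module.Finite Kᵐᵒᵖ (moved g.1) := hg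
    have : Module.Finite Kᵐᵒᵖ (moved h.1) := hh
    exact Submodule.finiteDimensional_of_le
      (moved_mul_le (E := moved g.1 ⊔ moved h.1) le_sup_left le_sup_right)
  inv_mem' {g} hg := by
    have : Module.Finite Kᵐᵒᵖ (moved g.1) := hg
    exact Submodule.finiteDimensional_of_le (moved_inv_le (E := moved g.1) le_rfl)

end ProjectiveGroup

section Determinant

variable {K : Type} [NormedField K] [StarRing K] [InnerProductSpace ℝ K]
  [HermitianScalars K] {p : ℕ} {I : Type u}

/-- The restriction of `g` to a subspace that contains the range of `g - Id`. -/
def restr (g : Hilb K p I ≃L[Kᵐᵒᵖ] Hilb K p I) (E : Submodule Kᵐᵒᵖ (Hilb K p I))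
    (hE : moved g ≤ E) : E →ₗ[Kᵐᵒᵖ] E :=
  (g : Hilb K p I →ₗ[Kᵐᵒᵖ] Hilb K p I).restrict fun x hx => by
    have := E.add_mem (moved_le_iff.1 hE x) hx
    simpa using this

/-- The determinant of a finite rank perturbation `g` of the identity (`K` commutative): the
determinant of the restriction of `g` to the range of `g - Id`, or equivalently to any
finite-dimensional subspace that contains this range. -/
def detFr (g : Hilb K p I ≃L[Kᵐᵒᵖ] Hilb K p I) : K :=
  MulOpposite.unop (LinearMap.det (restr g (moved g) le_rfl))

lemma det_restr (g : Hilb K p I ≃L[Kᵐᵒᵖ] Hilb K p I) (E : Submodule Kᵐᵒᵖ (Hilb K p I))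
    [Module.Finite Kᵐᵒᵖ E] (hE : moved g ≤ E) :
    MulOpposite.unop (LinearMap.det (restr g E hE)) = detFr g := by
  have : Module.Finite Kᵐᵒᵖ (moved g) := Submodule.finiteDimensional_of_le hE
  let W : Submodule Kᵐᵒᵖ E := (moved g).comap E.subtype
  let e : W ≃ₗ[Kᵐᵒᵖ] moved g := Submodule.comapSubtypeEquivOfLe hE
  have hW : W ≤ W.comap (restr g E hE) := by
    intro x hx
    change g x.1 ∈ moved g
    have := (moved g).add_mem (sub_mem_moved g x.1) hx
    simpa using this
  have h1 : W.mapQ W (restr g E hE) hW = LinearMap.id := by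
    apply Submodule.linearMap_qext
    ext x
    simp only [LinearMap.comp_apply, Submodule.mkQ_apply, Submodule.mapQ_apply, LinearMap.id_apply]
    rw [Submodule.Quotient.eq]
    exact sub_mem_moved g x.1
  have h2 : (restr g E hE).restrict hW =
      (e.symm : moved g →ₗ[Kᵐᵒᵖ] W) ∘ₗ (restr g (moved g) le_rfl) ∘ₗ
        (e : W →ₗ[Kᵐᵒᵖ] moved g) := by
    ext x
    rfl
  rw [detFr, LinearMap.det_eq_det_mul_det W _ hW, h1, LinearMap.det_id, mul_one, h2]
  congr 1
  exact LinearMap.det_conj (restr g (moved g) le_rfl) e.symm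

lemma detFr_mul (g h : Hilb K p I ≃L[Kᵐᵒᵖ] Hilb K p I) [Module.Finite Kᵐᵒᵖ (moved g)]
    [Module.Finite Kᵐᵒᵖ (moved h)] : detFr (g * h) = detFr g * detFr h := by
  have hg : moved g ≤ moved g ⊔ moved h := le_sup_left
  have hh : moved h ≤ moved g ⊔ moved h := le_sup_right
  rw [← det_restr g _ hg, ← det_restr h _ hh, ← det_restr (g * h) _ (moved_mul_le hg hh),
    ← MulOpposite.unop_mul, mul_comm, ← LinearMap.det_comp]
  rfl

lemma detFr_one : detFr (1 : Hilb K p I ≃L[Kᵐᵒᵖ] Hilb K p I) = 1 := by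
  rw [← det_restr 1 ⊥ (moved_one_le ⊥)]
  simp [LinearMap.det_eq_one_of_subsingleton]

variable (K p I)

/-- The group `SO^fr_K(p, κ)` for commutative `K`: the finite rank perturbations of the identity in
`O_K(p, κ)` of determinant `1`. -/
def SOfr : Subgroup (O K p I) where
  carrier := {g | g ∈ Ofr K p I ∧ detFr g.1 = 1}
  one_mem' := ⟨one_mem _, detFr_one⟩
  mul_mem' {g h} hg hh := by
    have : Module.Finite Kᵐᵒᵖ (moved g.1) := hg.1
    have : Module.Finite Kᵐᵒᵖ (moved h.1) := hh.1
    refine ⟨mul_mem hg.1 hh.1, ?_⟩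
    change detFr (g.1 * h.1) = 1
    rw [detFr_mul, hg.2, hh.2, mul_one]
  inv_mem' {g} hg := by
    have h1 : Module.Finite Kᵐᵒᵖ (moved g.1) := hg.1
    have h2 : Module.Finite Kᵐᵒᵖ (moved g⁻¹.1) := inv_mem (S := Subgroup (O K p I)) hg.1
    refine ⟨inv_mem hg.1, ?_⟩
    have h := detFr_mul g⁻¹.1 g.1
    have h3 : g⁻¹.1 * g.1 = 1 := congrArg Subtype.val (inv_mul_cancel g)
    rw [h3, detFr_one, hg.2, mul_one] at h
    exact h.symm

end Determinant

section Orthochronous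

variable {p : ℕ} {I : Type u}

/-- The basis vectors of the positive subspace `P = span (e_1, …, e_p)`. -/
def posVec (j : Fin p) : Hilb ℝ p I :=
  letI := Classical.decEq (Fin p ⊕ I)
  lp.single 2 (Sum.inl j) 1

/-- The matrix, in the basis `e_1, …, e_p` of `P`, of the compression `(π_P ∘ g)|_P`. -/
def compression (g : Hilb ℝ p I ≃L[ℝᵐᵒᵖ] Hilb ℝ p I) : Matrix (Fin p) (Fin p) ℝ :=
  Matrix.of fun i j => g (posVec j) (Sum.inl i)

lemma posVec_inl (i j : Fin p) : (posVec (I := I) j) (Sum.inl i) = if i = j then 1 else 0 := by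
  let _ := Classical.decEq (Fin p ⊕ I)
  by_cases h : i = j
  · subst h
    rw [if_pos rfl]
    exact lp.single_apply_self _ _ _
  · rw [if_neg h]
    exact lp.single_apply_ne _ _ _ (by simpa using h)

lemma posVec_inr (k : I) (j : Fin p) : (posVec (I := I) j) (Sum.inr k) = 0 := by
  let _ := Classical.decEq (Fin p ⊕ I)
  exact lp.single_apply_ne _ _ _ (by simp)

lemma coord_add (x y : Hilb ℝ p I) (i : Fin p ⊕ I) : (x + y) i = x i + y i := rfl

lemma coord_smul (a : ℝ) (x : Hilb ℝ p I) (i : Fin p ⊕ I) : (a • x) i = a * x i := rfl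

lemma coord_sum (f : Fin p → Hilb ℝ p I) (i : Fin p ⊕ I) : (∑ j, f j) i = ∑ j, f j i :=
  map_sum (AddMonoidHom.mk' (fun x : Hilb ℝ p I => x i) fun x y => coord_add x y i) f _

/-- The vector of `P` with coordinates `c`. -/
def posComb (c : Fin p → ℝ) : Hilb ℝ p I := ∑ j, c j • posVec j

lemma posComb_inl (c : Fin p → ℝ) (i : Fin p) : (posComb (I := I) c) (Sum.inl i) = c i := by
  simp only [posComb, coord_sum, coord_smul, posVec_inl]
  simp

lemma posComb_inr (c : Fin p → ℝ) (k : I) : (posComb (I := I) c) (Sum.inr k) = 0 := by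
  simp only [posComb, coord_sum, coord_smul, posVec_inr]
  simp

lemma map_posComb (g : Hilb ℝ p I ≃L[ℝᵐᵒᵖ] Hilb ℝ p I) (c : Fin p → ℝ) (i : Fin p) :
    g (posComb c) (Sum.inl i) = (compression g).mulVec c i := by
  have h : ∀ (a : ℝ) (x : Hilb ℝ p I), g (a • x) = a • g x := by
    intro a x
    rw [← op_smul_eq_smul, map_smul, op_smul_eq_smul]
  simp only [posComb, map_sum, h, coord_sum, coord_smul]
  simp [Matrix.mulVec, dotProduct, compression, mul_comm]

lemma Q_posComb_pos (c : Fin p → ℝ) (hc : c ≠ 0) : 0 < Q (posComb (I := I) c) := by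
  obtain ⟨j, hj⟩ := Function.ne_iff.1 hc
  refine (summable_Q (posComb (I := I) c)).tsum_pos (fun i => ?_) (Sum.inl j) ?_
  · rcases i with i | k
    · simp [sgn]; positivity
    · simp [posComb_inr]
  · have : c j ≠ 0 := hj
    simp only [posComb_inl, sgn, Sum.elim_inl, one_mul, Real.norm_eq_abs, sq_abs]
    positivity

lemma exists_inl_ne_zero (x : Hilb ℝ p I) (hx : 0 < Q x) : ∃ i : Fin p, x (Sum.inl i) ≠ 0 := by
  by_contra! h
  refine hx.not_ge (tsum_nonpos fun i => ?_)
  rcases i with i | k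
  · simp [h]
  · simp only [sgn, Sum.elim_inr, neg_mul, one_mul, Left.neg_nonpos_iff]
    positivity

/-- The vector obtained from `x` by scaling its negative part by `t`. -/
def squeeze (t : ℝ) (x : Hilb ℝ p I) : Hilb ℝ p I :=
  (1 - t) • posComb (fun i => x (Sum.inl i)) + t • x

lemma squeeze_inl (t : ℝ) (x : Hilb ℝ p I) (i : Fin p) :
    squeeze t x (Sum.inl i) = x (Sum.inl i) := by
  simp only [squeeze, coord_add, coord_smul, posComb_inl]; ring

lemma squeeze_inr (t : ℝ) (x : Hilb ℝ p I) (k : I) :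
    squeeze t x (Sum.inr k) = t * x (Sum.inr k) := by
  simp [squeeze, coord_add, coord_smul, posComb_inr]

lemma Q_le_squeeze (t : ℝ) (ht : t ∈ Set.Icc (0 : ℝ) 1) (x : Hilb ℝ p I) :
    Q x ≤ Q (squeeze t x) := by
  refine (summable_Q x).tsum_le_tsum (fun i => ?_) (summable_Q _)
  rcases i with i | k
  · rw [squeeze_inl]
  · rw [squeeze_inr]
    simp only [sgn, Sum.elim_inr, norm_mul, mul_pow, Real.norm_eq_abs, sq_abs]
    have : t ^ 2 ≤ 1 := pow_le_one₀ ht.1 ht.2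
    nlinarith [sq_nonneg (x (Sum.inr k))]

/-- The matrices that join `compression g * compression h` to `compression (g * h)`. -/
lemma compression_interp (g h : O ℝ p I) (t : ℝ) (ht : t ∈ Set.Icc (0 : ℝ) 1) :
    ((1 - t) • (compression g.1 * compression h.1) + t • compression (g * h).1).det ≠ 0 := by
  intro h0
  obtain ⟨c, hc, hc0⟩ := Matrix.exists_mulVec_eq_zero_iff.2 h0
  have h1 : 0 < Q (g.1 (squeeze t (h.1 (posComb c)))) := by
    rw [g.2]
    refine lt_of_lt_of_le ?_ (Q_le_squeeze t ht _)
    rw [h.2]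
    exact Q_posComb_pos c hc
  obtain ⟨i, hi⟩ := exists_inl_ne_zero _ h1
  apply hi
  have hl : ∀ (a : ℝ) (x : Hilb ℝ p I), g.1 (a • x) = a • g.1 x := by
    intro a x
    rw [← op_smul_eq_smul, map_smul, op_smul_eq_smul]
  have hcol : (fun i => h.1 (posComb c) (Sum.inl i)) = (compression h.1).mulVec c :=
    funext fun i => map_posComb h.1 c i
  have h2 := congrFun hc0 i
  rw [Matrix.add_mulVec, Matrix.smul_mulVec, Matrix.smul_mulVec, ← Matrix.mulVec_mulVec] at h2
  rw [squeeze, map_add, hl, hl, hcol]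
  have h3 := map_posComb (g * h).1 c i
  have h4 := map_posComb g.1 ((compression h.1).mulVec c) i
  change g.1 (h.1 (posComb c)) (Sum.inl i) = _ at h3
  simp only [coord_add, coord_smul]
  rw [h3, h4]
  exact h2

lemma det_compression_ne_zero (g : O ℝ p I) : (compression g.1).det ≠ 0 := by
  have h := compression_interp g 1 1 (by simp)
  simpa using h

lemma det_compression_mul_pos (g h : O ℝ p I) :
    0 < (compression g.1).det * (compression h.1).det * (compression (g * h).1).det := by
  rw [← Matrix.det_mul]
  let f : ℝ → ℝ := fun t =>
    ((1 - t) • (compression g.1 * compression h.1) + t • compression (g * h).1).det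
  have hf : ContinuousOn f (Set.Icc 0 1) := by
    apply Continuous.continuousOn
    apply Continuous.matrix_det
    fun_prop
  have hconn := isPreconnected_Icc.image f hf
  have hne : (0 : ℝ) ∉ f '' Set.Icc 0 1 := by
    rintro ⟨t, ht, h0⟩
    exact compression_interp g h t ht h0
  have h0 : f 0 = (compression g.1 * compression h.1).det := by simp [f]
  have h1 : f 1 = (compression (g * h).1).det := by simp [f]
  rw [← h0, ← h1]
  have m0 : f 0 ∈ f '' Set.Icc (0 : ℝ) 1 := ⟨0, by simp, rfl⟩
  have m1 : f 1 ∈ f '' Set.Icc (0 : ℝ) 1 := ⟨1, by simp, rfl⟩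
  have n0 : f 0 ≠ 0 := fun h => hne ⟨0, by simp, h⟩
  have n1 : f 1 ≠ 0 := fun h => hne ⟨1, by simp, h⟩
  by_contra hcon
  rcases lt_or_gt_of_ne n0 with a | a <;> rcases lt_or_gt_of_ne n1 with b | b
  · exact hcon (mul_pos_of_neg_of_neg a b)
  · exact hne (hconn.ordConnected.out m0 m1 ⟨a.le, b.le⟩)
  · exact hne (hconn.ordConnected.out m1 m0 ⟨b.le, a.le⟩)
  · exact hcon (mul_pos a b)

variable (p I)

/-- The orientation map `O_ℝ(p, κ) → {±1}`: the sign of the determinant of the compression of `g`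
to `P`. -/
def orientation : O ℝ p I →* SignType where
  toFun g := SignType.sign (compression g.1).det
  map_one' := by
    have h : compression (1 : O ℝ p I).1 = 1 := by
      ext i j
      change (posVec (I := I) j) (Sum.inl i) = _
      rw [posVec_inl, Matrix.one_apply]
    rw [h, Matrix.det_one, sign_one]
  map_mul' g h := by
    have hpos := sign_pos (det_compression_mul_pos g h)
    rw [sign_mul, sign_mul] at hpos
    have hg := sign_ne_zero.2 (det_compression_ne_zero g)
    have hh := sign_ne_zero.2 (det_compression_ne_zero h)
    revert hpos hg hh
    generalize SignType.sign (compression g.1).det = a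
    generalize SignType.sign (compression h.1).det = b
    generalize SignType.sign (compression (g * h).1).det = c
    revert a b c
    decide

/-- The orthochronous group `O^o_ℝ(p, κ)`. -/
def OOrtho : Subgroup (O ℝ p I) := (orientation p I).ker

/-- The group `PO^o_ℝ(p, κ)`, the image of the orthochronous group in `PO_ℝ(p, κ)`, with the
topology induced by the one of `PO_ℝ(p, κ)`. -/
def POOrtho : Subgroup (PO ℝ p I) := (OOrtho p I).map (toPO ℝ p I)

end Orthochronous

/-- The image of `SO^fr_ℂ(p, κ)` in `PO_ℂ(p, κ)`. -/
def PSOfrComplex (p : ℕ) (I : Type u) : Subgroup (PO ℂ p I) := (SOfr ℂ p I).map (toPO ℂ p I)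

/-- The image in `PO_ℍ(p, κ)` of `SO^fr_ℍ(p, κ)`, which is the group of all finite rank
perturbations of the identity in `O_ℍ(p, κ)`. -/
def PSOfrQuaternion (p : ℕ) (I : Type u) : Subgroup (PO ℍ[ℝ] p I) :=
  (Ofr ℍ[ℝ] p I).map (toPO ℍ[ℝ] p I)

/-- The image of `SO^fr_ℝ(p, κ) ∩ O^o_ℝ(p, κ)` in `PO_ℝ(p, κ)`, as a subgroup of
`PO^o_ℝ(p, κ)`. -/
def PSOfrOrtho (p : ℕ) (I : Type u) : Subgroup (POOrtho p I) :=
  ((SOfr ℝ p I ⊓ OOrtho p I).map (toPO ℝ p I)).subgroupOf (POOrtho p I)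

/-- A topological group is topologically simple if every non-trivial normal subgroup is dense. -/
def IsTopologicallySimple (G : Type*) [Group G] [TopologicalSpace G] : Prop :=
  ∀ N : Subgroup G, N.Normal → N ≠ ⊥ → Dense (N : Set G)

end

end IndefiniteUnitary

/-!
# Topological simplicity of the projective groups `PO_K(p, κ)`

Everything is reduced to the group `pairGroup` generated by the quotients `r_u r_w⁻¹` of two unitary
quasi-reflections in negative vectors with the same multiplier. The Hilbert space contains negative
unit vectors orthogonal to any finite set of vectors (`exists_neg_unit_of_finite`); this is where
the infinite cardinal is used, and it is used all the time, to correct elements of the orthogonal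
group without changing them on a given finite set.

*Simplicity.* A subgroup normalised by `pairGroup` that contains a finite rank perturbation `m ≠ 1`
of the identity contains `pairGroup` (`pairGroup_le_of_normal`). Indeed `m` moves a negative line,
so that a commutator of `m` with a product of two reflections is a product of the reflections in two
distinct negative lines. Conjugation produces the same with orthogonal lines. Since `pairGroup` is
transitive on pairs of orthogonal negative lines, all such products are obtained, and commutators
with them give the generators of `pairGroup`. A non-central `g` has a non-trivial
commutator with some `n ∈ pairGroup` (`exists_commutator_ne_one`), which is of finite rank. Hence
every non-trivial normal subgroup contains the image of `pairGroup`.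

*Identification and density.* The group `negGroup` generated by all quasi-reflections in negative
vectors moves the images of the first `p` basis vectors under `g` back to their place: two positive
unit vectors `x`, `y` with `-1 < Re φ(x, y)` are related by two such reflections, and when
`Re φ(x, y)` is too negative an intermediate vector is used. Over `ℂ` and `ℍ` an imaginary multiple
of `y` is available; over `ℝ` another positive basis vector serves for all but the last one, where
the orthochronous condition is precisely what is needed. What remains is a Gram-Schmidt procedure in
the negative definite space. So a finite rank `g` is in `negGroup`, and any `g` agrees with elements
of `pairGroup` on each finite set of vectors. The determinant (over `ℝ`, `ℂ`), or the fact that unit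
quaternions are commutators, identifies `pairGroup` with the groups of the statement, and the
agreement on finite sets gives density in the topology of pointwise convergence.

*Topology.* The image of the base point bounds the norm of an operator (`bddBy_of_baseSpan`), so the
group is locally uniformly Lipschitz on the symmetric space and hence a topological group. Bounded
operators whose projections to the images `g V` converge along an ultrafilter have a limit in the
orthogonal group (`exists_limit`): the limit of the projections is a compact operator, which gives
convergence on each `V`, and the `V` span the Hilbert space. Consequently `PO_K(p, ℵ₀)` embeds as a
closed subspace in a countable product of Polish spaces (`polishSpace_PO`), and the orthochronous
group is closed in it.
-/

open scoped Quaternion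

namespace IndefiniteUnitary

noncomputable section

universe u

set_option linter.unusedSectionVars false

/-! ### Real parts, the Hermitian form and quasi-reflections -/

section FormAlgebra

variable {K : Type} [NormedDivisionRing K] [StarRing K] [InnerProductSpace ℝ K]
  [HermitianScalars K] {p : ℕ} {I : Type u}

lemma star_real_smul_one (t : ℝ) : star (t • (1 : K)) = t • 1 := by
  have h := HermitianScalars.star_mul_add_star_mul (t • (1 : K)) 1
  rw [mul_one, star_one, one_mul, real_inner_smul_left, real_inner_self_eq_norm_sq, norm_one,
    one_pow, mul_one, two_mul, add_smul] at h
  exact add_right_cancel h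

lemma star_real_smul (t : ℝ) (a : K) : star (t • a) = t • star a := by
  rw [← mul_one a, ← mul_smul_comm, star_mul, star_real_smul_one, smul_mul_assoc, one_mul, mul_one]

/-- The real part of a scalar. -/
def re (a : K) : ℝ := inner ℝ (1 : K) a

lemma star_add_self (a : K) : star a + a = (2 * re a) • (1 : K) := by
  have h := HermitianScalars.star_mul_add_star_mul (1 : K) a
  simpa [add_comm, re] using h

lemma re_add (a b : K) : re (a + b) = re a + re b := inner_add_right _ _ _

lemma re_neg (a : K) : re (-a) = -re a := inner_neg_right _ _

lemma re_sub (a b : K) : re (a - b) = re a - re b := inner_sub_right _ _ _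

lemma re_smul (t : ℝ) (a : K) : re (t • a) = t * re a := real_inner_smul_right _ _ _

lemma re_one : re (1 : K) = 1 := by simp [re]

lemma re_zero : re (0 : K) = 0 := inner_zero_right _

lemma re_star (a : K) : re (star a) = re a := by
  have h := congrArg re (star_add_self a)
  rw [re_add, re_smul, re_one] at h
  linarith

lemma inner_eq_re (a b : K) : inner ℝ a b = re (star a * b) := by
  rw [re, inner_mul_right_eq, star_star, mul_one]

lemma abs_re_le (a : K) : |re a| ≤ ‖a‖ := by
  have h := abs_real_inner_le_norm (1 : K) a
  rwa [norm_one, one_mul] at h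

lemma re_mul_comm (a b : K) : re (a * b) = re (b * a) := by
  have h : inner ℝ (star (star a)) (star b) = inner ℝ (star a) b := by
    rw [real_inner_eq_norm_add_mul_self_sub_norm_mul_self_sub_norm_mul_self_div_two,
      real_inner_eq_norm_add_mul_self_sub_norm_mul_self_sub_norm_mul_self_div_two, ← star_add,
      norm_star_eq, norm_star_eq (star a), norm_star_eq b]
  rw [inner_eq_re, star_star, ← re_star, star_mul, star_star, star_star, inner_eq_re,
    star_star] at h
  exact h.symm

lemma ext_re {a b : K} (h : ∀ c : K, re (c * a) = re (c * b)) : a = b := by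
  refine ext_inner_left ℝ fun c => ?_
  rw [inner_eq_re, inner_eq_re, h]

lemma form_star (x y : Hilb K p I) : star (form x y) = form y x := by
  let s : K →+ K := (starAddEquiv : K ≃+ K).toAddMonoidHom
  have hc : Continuous s :=
    AddMonoidHomClass.continuous_of_bound s 1 fun a => by simp [s, norm_star_eq]
  have h := (summable_form x y).hasSum.map s hc
  refine h.unique ?_
  have he : (s ∘ fun i => sgn i • (star (x i) * y i)) = fun i => sgn i • (star (y i) * x i) := by
    funext i
    simp [s, star_real_smul]
  rw [he]
  exact (summable_form y x).hasSum

lemma form_add_left (x y z : Hilb K p I) : form (x + y) z = form x z + form y z := by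
  rw [← form_star, form_add_right, star_add, form_star, form_star]

lemma form_smul_left (x y : Hilb K p I) (a : K) :
    form (MulOpposite.op a • x) y = star a * form x y := by
  rw [← form_star, form_smul_right, star_mul, form_star]

lemma op_real_smul (t : ℝ) (x : Hilb K p I) : MulOpposite.op (t • (1 : K)) • x = t • x := by
  rw [MulOpposite.op_smul, MulOpposite.op_one, smul_assoc, one_smul]

lemma form_real_smul_right (x y : Hilb K p I) (t : ℝ) : form x (t • y) = t • form x y := by
  rw [← op_real_smul, form_smul_right, mul_smul_comm, mul_one]

lemma form_real_smul_left (x y : Hilb K p I) (t : ℝ) : form (t • x) y = t • form x y := by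
  rw [← op_real_smul, form_smul_left, star_real_smul_one, smul_mul_assoc, one_mul]

lemma form_zero_right (x : Hilb K p I) : form x 0 = 0 := by
  simpa using form_real_smul_right x 0 0

lemma form_zero_left (x : Hilb K p I) : form 0 x = 0 := by
  simpa using form_real_smul_left 0 x 0

lemma form_neg_right (x y : Hilb K p I) : form x (-y) = -form x y := by
  simpa using form_real_smul_right x y (-1)

lemma form_neg_left (x y : Hilb K p I) : form (-x) y = -form x y := by
  simpa using form_real_smul_left x y (-1)

lemma form_sub_right (x y z : Hilb K p I) : form x (y - z) = form x y - form x z := by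
  rw [sub_eq_add_neg, form_add_right, form_neg_right, sub_eq_add_neg]

lemma form_sub_left (x y z : Hilb K p I) : form (x - y) z = form x z - form y z := by
  rw [sub_eq_add_neg, form_add_left, form_neg_left, sub_eq_add_neg]

lemma form_eq_zero_symm {x y : Hilb K p I} (h : form x y = 0) : form y x = 0 := by
  rw [← form_star, h, star_zero]

lemma re_form_self (x : Hilb K p I) : re (form x x) = Q x := by
  rw [form_self, re_smul, re_one, mul_one]

lemma re_form_comm (x y : Hilb K p I) : re (form x y) = re (form y x) := by
  rw [← form_star, re_star]

lemma Q_add (x y : Hilb K p I) : Q (x + y) = Q x + Q y + 2 * re (form x y) := by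
  rw [← re_form_self, ← re_form_self, ← re_form_self, form_add_right, form_add_left, form_add_left,
    re_add, re_add, re_add, re_form_comm y x]
  ring

lemma Q_sub (x y : Hilb K p I) : Q (x - y) = Q x + Q y - 2 * re (form x y) := by
  rw [← re_form_self, ← re_form_self, ← re_form_self, form_sub_right, form_sub_left, form_sub_left,
    re_sub, re_sub, re_sub, re_form_comm y x]
  ring

lemma Q_smul (x : Hilb K p I) (a : K) : Q (MulOpposite.op a • x) = ‖a‖ ^ 2 * Q x := by
  rw [← re_form_self, form_smul_right, form_smul_left, re_mul_comm, form_self, mul_smul_comm,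
    mul_smul_comm, re_smul, mul_one, ← star_star a, ← inner_eq_re, star_star,
    real_inner_self_eq_norm_sq]
  simp only [norm_star_eq]
  ring

lemma Q_real_smul (x : Hilb K p I) (t : ℝ) : Q (t • x) = t ^ 2 * Q x := by
  rw [← op_real_smul, Q_smul, norm_smul, norm_one, mul_one, Real.norm_eq_abs, sq_abs]

lemma Q_zero : Q (0 : Hilb K p I) = 0 := by
  simpa using Q_real_smul (0 : Hilb K p I) 0

lemma ne_zero_of_Q_ne_zero {x : Hilb K p I} (h : Q x ≠ 0) : x ≠ 0 := by
  rintro rfl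
  exact h Q_zero

/-- Elements of the orthogonal group preserve the Hermitian form, by polarization. -/
lemma form_map (g : O K p I) (x y : Hilb K p I) : form (g.1 x) (g.1 y) = form x y := by
  have hre : ∀ x y : Hilb K p I, re (form (g.1 x) (g.1 y)) = re (form x y) := by
    intro x y
    have h := g.2 (x + y)
    rw [map_add, Q_add, Q_add, g.2, g.2] at h
    linarith
  refine ext_re fun c => ?_
  have h := hre (MulOpposite.op (star c) • x) y
  rwa [map_smul, form_smul_left, form_smul_left, star_star] at h

lemma O_ext {g h : O K p I} (H : ∀ x, g.1 x = h.1 x) : g = h :=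
  Subtype.ext (ContinuousLinearEquiv.ext (funext H))

lemma mul_apply' (g h : O K p I) (x : Hilb K p I) : (g * h).1 x = g.1 (h.1 x) := rfl

lemma one_apply' (x : Hilb K p I) : (1 : O K p I).1 x = x := rfl

lemma inv_apply_self' (g : O K p I) (x : Hilb K p I) : (g⁻¹).1 (g.1 x) = x :=
  g.1.symm_apply_apply x

lemma apply_inv_self' (g : O K p I) (x : Hilb K p I) : g.1 ((g⁻¹).1 x) = x :=
  g.1.apply_symm_apply x

lemma inv_apply_eq {g : O K p I} {x y : Hilb K p I} : (g⁻¹).1 x = y ↔ g.1 y = x :=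
  ⟨fun h => by rw [← h, apply_inv_self'], fun h => by rw [← h, inv_apply_self']⟩

lemma form_map_left (g : O K p I) (x y : Hilb K p I) : form (g.1 x) y = form x ((g⁻¹).1 y) := by
  rw [← form_map g x, apply_inv_self']

/-- The value of the quasi-reflection `qrefl`. -/
def qreflFun (v : Hilb K p I) (a : K) (x : Hilb K p I) : Hilb K p I :=
  x + MulOpposite.op ((a - 1) * ((Q v)⁻¹ • form v x)) • v

lemma form_qreflFun (v : Hilb K p I) (hv : Q v ≠ 0) (a : K) (x : Hilb K p I) :
    form v (qreflFun v a x) = a * form v x := by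
  rw [qreflFun, form_add_right, form_smul_right, form_self, smul_mul_assoc, one_mul,
    mul_smul_comm, smul_smul, mul_inv_cancel₀ hv, one_smul, sub_mul, one_mul]
  abel

lemma qreflFun_qreflFun (v : Hilb K p I) (hv : Q v ≠ 0) (a b : K) (x : Hilb K p I) :
    qreflFun v a (qreflFun v b x) = qreflFun v (a * b) x := by
  conv_lhs => rw [qreflFun]
  rw [form_qreflFun v hv, qreflFun, qreflFun, add_assoc, ← add_smul, ← MulOpposite.op_add]
  congr 3
  simp only [mul_smul_comm, ← smul_add, sub_mul, one_mul, mul_assoc]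
  congr 1
  abel

lemma Q_qreflFun (v : Hilb K p I) (hv : Q v ≠ 0) (a : K) (ha : ‖a‖ = 1) (x : Hilb K p I) :
    Q (qreflFun v a x) = Q x := by
  have h : qreflFun v a x = x - MulOpposite.op (-((a - 1) * ((Q v)⁻¹ • form v x))) • v := by
    simp [qreflFun]
  rw [h, Q_sub_smul, inner_neg_right, norm_neg, mul_smul_comm, real_inner_smul_right, norm_smul,
    mul_pow, Real.norm_eq_abs, sq_abs, sub_mul, one_mul, inner_sub_right,
    norm_sub_sq_real, real_inner_self_eq_norm_sq, norm_mul, ha, one_mul,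
    real_inner_comm (form v x)]
  field_simp
  ring

/-- The unitary quasi-reflection in a non-isotropic vector `v` with multiplier `a`, `|a| = 1`:
it fixes the orthogonal complement of `v` and sends `v` to `v a`. -/
def qrefl (v : Hilb K p I) (hv : Q v ≠ 0) (a : K) (ha : ‖a‖ = 1) : O K p I :=
  have ha0 : a ≠ 0 := fun h => by simp [h] at ha
  have hcont : ∀ a, Continuous (qreflFun v a) := by
    intro a
    unfold qreflFun
    have := continuous_form_right v
    fun_prop
  have hone : ∀ x, qreflFun v 1 x = x := by
    intro x
    simp [qreflFun]
  ⟨{ toFun := qreflFun v a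
     invFun := qreflFun v a⁻¹
     left_inv := fun x => by rw [qreflFun_qreflFun v hv, inv_mul_cancel₀ ha0, hone]
     right_inv := fun x => by rw [qreflFun_qreflFun v hv, mul_inv_cancel₀ ha0, hone]
     map_add' := by
      intro x y
      simp only [qreflFun, form_add_right, smul_add, mul_add, MulOpposite.op_add, add_smul]
      abel
     map_smul' := by
      intro b x
      induction b using MulOpposite.rec' with
      | _ b =>
      simp only [qreflFun, form_smul_right, RingHom.id_apply, smul_add, smul_smul,
        ← MulOpposite.op_mul, ← smul_mul_assoc, mul_assoc]
     continuous_toFun := hcont a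
     continuous_invFun := hcont a⁻¹ }, Q_qreflFun v hv a ha⟩

lemma qrefl_apply (v : Hilb K p I) (hv : Q v ≠ 0) (a : K) (ha : ‖a‖ = 1) (x : Hilb K p I) :
    (qrefl v hv a ha).1 x = x + MulOpposite.op ((a - 1) * ((Q v)⁻¹ • form v x)) • v := rfl

lemma qrefl_apply_of_form_eq_zero (v : Hilb K p I) (hv : Q v ≠ 0) (a : K) (ha : ‖a‖ = 1)
    {x : Hilb K p I} (h : form v x = 0) : (qrefl v hv a ha).1 x = x := by
  simp [qrefl_apply, h]

lemma qrefl_apply_self (v : Hilb K p I) (hv : Q v ≠ 0) (a : K) (ha : ‖a‖ = 1) :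
    (qrefl v hv a ha).1 v = MulOpposite.op a • v := by
  rw [qrefl_apply, form_self, smul_smul, inv_mul_cancel₀ hv, one_smul, mul_one]
  simp [sub_smul]

lemma qrefl_mul_qrefl (v : Hilb K p I) (hv : Q v ≠ 0) (a b : K) (ha : ‖a‖ = 1) (hb : ‖b‖ = 1) :
    qrefl v hv a ha * qrefl v hv b hb = qrefl v hv (a * b) (by simp [ha, hb]) :=
  O_ext fun x => qreflFun_qreflFun v hv a b x

lemma qrefl_one (v : Hilb K p I) (hv : Q v ≠ 0) : qrefl v hv 1 norm_one = 1 :=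
  O_ext fun x => by rw [qrefl_apply, one_apply']; simp

lemma qrefl_inv (v : Hilb K p I) (hv : Q v ≠ 0) (a : K) (ha : ‖a‖ = 1) :
    (qrefl v hv a ha)⁻¹ = qrefl v hv a⁻¹ (by simp [ha]) := by
  have ha0 : a ≠ 0 := fun h => by simp [h] at ha
  rw [inv_eq_iff_mul_eq_one, qrefl_mul_qrefl]
  simp only [mul_inv_cancel₀ ha0]
  exact qrefl_one v hv

lemma qrefl_congr {v w : Hilb K p I} (hvw : v = w) (hv : Q v ≠ 0) {a b : K} (hab : a = b)
    (ha : ‖a‖ = 1) : qrefl v hv a ha = qrefl w (hvw ▸ hv) b (hab ▸ ha) := by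
  subst hvw hab
  rfl

lemma conj_qrefl (g : O K p I) (v : Hilb K p I) (hv : Q v ≠ 0) (a : K) (ha : ‖a‖ = 1) :
    g * qrefl v hv a ha * g⁻¹ = qrefl (g.1 v) (by rwa [g.2]) a ha := by
  refine O_ext fun x => ?_
  rw [mul_apply', mul_apply', qrefl_apply, qrefl_apply, map_add, map_smul, apply_inv_self',
    form_map_left, g.2]

lemma qrefl_smul (v : Hilb K p I) (hv : Q v ≠ 0) (c : K) (hc : c ≠ 0) (a : K) (ha : ‖a‖ = 1)
    (hv' : Q (MulOpposite.op c • v) ≠ 0) :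
    qrefl (MulOpposite.op c • v) hv' a ha =
      qrefl v hv (c * a * c⁻¹) (by simp [ha, hc]) := by
  refine O_ext fun x => ?_
  have h : star c = (‖c‖ ^ 2) • c⁻¹ := by
    have := star_mul_self_eq c
    rw [← mul_inv_cancel_right₀ hc (star c), this, smul_mul_assoc, one_mul]
  have hn : ‖c‖ ≠ 0 := norm_ne_zero_iff.2 hc
  rw [qrefl_apply, qrefl_apply, form_smul_left, Q_smul, smul_smul, ← MulOpposite.op_mul]
  congr 3
  rw [h, smul_mul_assoc, smul_smul, mul_inv, mul_right_comm,
    inv_mul_cancel₀ (pow_ne_zero 2 hn), one_mul]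
  simp only [mul_smul_comm]
  congr 1
  simp only [mul_sub, sub_mul, mul_assoc, one_mul]
  rw [mul_inv_cancel_left₀ hc]

lemma qrefl_smul_neg_one (v : Hilb K p I) (hv : Q v ≠ 0) (c : K) (hc : c ≠ 0)
    (hv' : Q (MulOpposite.op c • v) ≠ 0) :
    qrefl (MulOpposite.op c • v) hv' (-1) (by simp) = qrefl v hv (-1) (by simp) := by
  rw [qrefl_smul v hv c hc]
  exact qrefl_congr rfl hv (by simp [hc]) _

/-- The quasi-reflection in `v - w` that maps `v` to `w`. -/
lemma exists_qrefl_sub_apply {v w : Hilb K p I} (h : Q v = Q w) (hvw : Q (v - w) ≠ 0) :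
    ∃ (a : K) (ha : ‖a‖ = 1), (qrefl (v - w) hvw a ha).1 v = w := by
  set b := form (v - w) v with hb
  have hbb : star b + b = Q (v - w) • (1 : K) := by
    rw [star_add_self, hb, form_sub_left, re_sub, re_form_self, Q_sub, ← h, re_form_comm w v]
    congr 1
    ring
  have hb0 : b ≠ 0 := by
    rintro h0
    rw [h0, star_zero, add_zero] at hbb
    exact smul_ne_zero hvw one_ne_zero hbb.symm
  refine ⟨-(star b * b⁻¹), ?_, ?_⟩
  · rw [norm_neg, norm_mul, norm_star_eq, norm_inv, mul_inv_cancel₀ (norm_ne_zero_iff.2 hb0)]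
  · rw [qrefl_apply, ← hb]
    have : (-(star b * b⁻¹) - 1) * ((Q (v - w))⁻¹ • b) = -1 := by
      rw [mul_smul_comm, sub_mul, neg_mul, inv_mul_cancel_right₀ hb0, one_mul, ← neg_add', hbb,
        smul_neg, smul_smul, inv_mul_cancel₀ hvw, one_smul]
    rw [this]
    simp

end FormAlgebra

/-! ### The scalar product and negative vectors -/

section Coordinates

variable {K : Type} [NormedDivisionRing K] [StarRing K] [InnerProductSpace ℝ K]
  [HermitianScalars K] {p : ℕ} {I : Type u}

lemma sgn_mul_self (i : Fin p ⊕ I) : sgn i * sgn i = 1 := by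
  rcases i with i | i <;> simp [sgn]

lemma re_form_hasSum (x y : Hilb K p I) :
    HasSum (fun i => sgn i * inner ℝ (x i) (y i)) (re (form x y)) := by
  have : CompleteSpace K := FiniteDimensional.complete ℝ K
  have h := (summable_form x y).hasSum.mapL (innerSL ℝ (1 : K))
  simp only [innerSL_apply_apply] at h
  have he : (fun i => sgn i * inner ℝ (x i) (y i)) =
      fun i => inner ℝ (1 : K) (sgn i • (star (x i) * y i)) := by
    funext i
    rw [real_inner_smul_right, inner_eq_re, re]
  rw [he]
  exact h

/-- The fundamental symmetry of the Hilbert space: the sign of the coordinates in `I` is changed. -/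
def flip (x : Hilb K p I) : Hilb K p I :=
  ⟨fun i => sgn i • x i, by
    refine memℓp_gen ?_
    have h := summable_norm_sq x
    have hs : ∀ i : Fin p ⊕ I, |(sgn i : ℝ)| = 1 := norm_sgn
    simpa [norm_smul, hs] using h⟩

lemma flip_apply (x : Hilb K p I) (i : Fin p ⊕ I) : flip x i = sgn i • x i := rfl

lemma flip_flip (x : Hilb K p I) : flip (flip x) = x := by
  ext i
  rw [flip_apply, flip_apply, smul_smul, sgn_mul_self, one_smul]

lemma re_form_eq_inner (x y : Hilb K p I) : re (form x y) = inner ℝ (flip x) y := by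
  rw [lp.inner_eq_tsum, ← (re_form_hasSum x y).tsum_eq]
  refine tsum_congr fun i => ?_
  rw [flip_apply, real_inner_smul_left]

lemma inner_eq_re_form (x y : Hilb K p I) : inner ℝ x y = re (form (flip x) y) := by
  rw [re_form_eq_inner, flip_flip]

lemma norm_flip (x : Hilb K p I) : ‖flip x‖ = ‖x‖ := by
  have h : ‖flip x‖ ^ 2 = ‖x‖ ^ 2 := by
    rw [← real_inner_self_eq_norm_sq, ← real_inner_self_eq_norm_sq, ← re_form_eq_inner,
      re_form_comm, re_form_eq_inner, flip_flip]
  exact (sq_eq_sq₀ (norm_nonneg _) (norm_nonneg _)).1 h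

/-- The standard orthonormal basis of the Hilbert space. -/
def bvec (i : Fin p ⊕ I) : Hilb K p I :=
  letI := Classical.decEq (Fin p ⊕ I)
  lp.single 2 i 1

lemma bvec_self (i : Fin p ⊕ I) : (bvec (K := K) i) i = 1 := by
  let _ := Classical.decEq (Fin p ⊕ I)
  exact lp.single_apply_self _ _ _

lemma bvec_ne {i j : Fin p ⊕ I} (h : j ≠ i) : (bvec (K := K) i) j = 0 := by
  let _ := Classical.decEq (Fin p ⊕ I)
  exact lp.single_apply_ne _ _ _ h

lemma form_bvec (i : Fin p ⊕ I) (x : Hilb K p I) : form (bvec i) x = sgn i • x i := by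
  rw [form, tsum_eq_single i, bvec_self, star_one, one_mul]
  intro j hj
  rw [bvec_ne hj, star_zero, zero_mul, smul_zero]

lemma flip_bvec_inl (i : Fin p) : flip (bvec (K := K) (I := I) (Sum.inl i)) = bvec (Sum.inl i) := by
  ext j
  rw [flip_apply]
  by_cases h : j = Sum.inl i
  · subst h
    simp [sgn]
  · simp [bvec_ne h]

lemma Q_bvec (i : Fin p ⊕ I) : Q (bvec (K := K) i) = sgn i := by
  rw [← re_form_self, form_bvec, bvec_self, re_smul, re_one, mul_one]

/-- The base point of the symmetric space, spanned by the first `p` basis vectors, is described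
by its orthogonal complement `{y | ∀ i, y (Sum.inl i) = 0}`, on which `-Q` is the square norm. -/
lemma flip_eq_neg {y : Hilb K p I} (hy : ∀ i, y (Sum.inl i) = 0) : flip y = -y := by
  ext i
  rw [flip_apply]
  rcases i with i | i
  · simp [hy]
  · simp [sgn]

lemma Q_eq_neg_norm_sq {y : Hilb K p I} (hy : ∀ i, y (Sum.inl i) = 0) : Q y = -‖y‖ ^ 2 := by
  rw [← re_form_self, re_form_eq_inner, flip_eq_neg hy, inner_neg_left, real_inner_self_eq_norm_sq]

lemma form_inl_eq_zero_iff {y : Hilb K p I} :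
    (∀ i, form (bvec (Sum.inl i)) y = 0) ↔ ∀ i, y (Sum.inl i) = 0 := by
  refine forall_congr' fun i => ?_
  rw [form_bvec]
  simp [sgn]

/-- A vector that is orthogonal to a `K`-subspace for the real part of the form is orthogonal to it
for the form. -/
lemma form_eq_zero_of_re (F : Submodule Kᵐᵒᵖ (Hilb K p I)) (y : Hilb K p I)
    (h : ∀ v ∈ F, re (form v y) = 0) (v : Hilb K p I) (hv : v ∈ F) : form v y = 0 := by
  refine ext_re fun c => ?_
  rw [mul_zero, re_zero]
  have := h _ (F.smul_mem (MulOpposite.op (star c)) hv)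
  rwa [form_smul_left, star_star] at this

lemma exists_form_ne_zero {x : Hilb K p I} (hx : x ≠ 0) : ∃ y, form y x ≠ 0 := by
  refine ⟨flip x, fun h => hx ?_⟩
  have := congrArg re h
  rw [re_form_eq_inner, flip_flip, real_inner_self_eq_norm_sq, re_zero] at this
  simpa using this

lemma finiteDimensional_real_of_finite (F : Submodule Kᵐᵒᵖ (Hilb K p I)) [Module.Finite Kᵐᵒᵖ F] :
    FiniteDimensional ℝ (F.restrictScalars ℝ) :=
  Module.Finite.trans (R := ℝ) Kᵐᵒᵖ F

lemma orthonormal_bvec : Orthonormal ℝ (bvec : Fin p ⊕ I → Hilb K p I) := by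
  classical
  rw [orthonormal_iff_ite]
  intro i j
  rw [inner_eq_re_form, re_form_comm, form_bvec, flip_apply, smul_smul, sgn_mul_self, one_smul]
  split_ifs with h
  · rw [h, bvec_self, re_one]
  · rw [bvec_ne (Ne.symm h), re_zero]

lemma not_finiteDimensional [Infinite I] : ¬ FiniteDimensional ℝ (Hilb K p I) := by
  intro h
  have := (orthonormal_bvec (K := K) (p := p) (I := I)).linearIndependent.finite
  exact not_finite (Fin p ⊕ I)

/-- The negative part of the form has infinite rank, so it contains unit vectors that are orthogonal
to any given finite-dimensional subspace: the argument takes the orthogonal complement, for the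
scalar product of the Hilbert space, of this subspace and the first `p` basis vectors. -/
lemma exists_neg_unit [Infinite I] (F : Submodule Kᵐᵒᵖ (Hilb K p I)) [Module.Finite Kᵐᵒᵖ F] :
    ∃ y : Hilb K p I, Q y = -1 ∧ ∀ v ∈ F, form v y = 0 := by
  have hs : (Set.range fun i : Fin p => (bvec (Sum.inl i) : Hilb K p I)).Finite :=
    Set.finite_range _
  have := FiniteDimensional.span_of_finite Kᵐᵒᵖ hs
  set F' := F ⊔ Submodule.span Kᵐᵒᵖ (Set.range fun i : Fin p => (bvec (Sum.inl i) : Hilb K p I))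
  have hF' := finiteDimensional_real_of_finite F'
  have hne : (F'.restrictScalars ℝ)ᗮ ≠ ⊥ := by
    intro h
    rw [Submodule.orthogonal_eq_bot_iff] at h
    rw [h] at hF'
    exact not_finiteDimensional (K := K) (p := p) (I := I)
      (Module.Finite.equiv (Submodule.topEquiv (R := ℝ) (M := Hilb K p I)))
  obtain ⟨y, hy, hy0⟩ := Submodule.exists_mem_ne_zero_of_ne_bot hne
  have hyF : ∀ v ∈ F', inner ℝ v y = 0 := fun v hv => (Submodule.mem_orthogonal _ _).1 hy v hv
  have hinl : ∀ i, y (Sum.inl i) = 0 := by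
    rw [← form_inl_eq_zero_iff]
    intro i
    refine form_eq_zero_of_re (Submodule.span Kᵐᵒᵖ {bvec (Sum.inl i)}) y (fun v hv => ?_) _
      (Submodule.mem_span_singleton_self _)
    obtain ⟨a, rfl⟩ := Submodule.mem_span_singleton.1 hv
    induction a using MulOpposite.rec' with
    | _ a =>
    have hm : MulOpposite.op a • (bvec (Sum.inl i) : Hilb K p I) ∈ F' :=
      F'.smul_mem _ ((le_sup_right : _ ≤ F') (Submodule.subset_span ⟨i, rfl⟩))
    rw [re_form_eq_inner]
    convert hyF _ hm using 2
    ext j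
    have := congrArg (fun f : Hilb K p I => f j * a) (flip_bvec_inl (K := K) (I := I) i)
    change sgn j • ((bvec (Sum.inl i) : Hilb K p I) j * a) = (bvec (Sum.inl i) : Hilb K p I) j * a
    rw [← smul_mul_assoc]
    exact this
  have hQ := Q_eq_neg_norm_sq hinl
  have hn : ‖y‖ ≠ 0 := norm_ne_zero_iff.2 hy0
  refine ⟨‖y‖⁻¹ • y, ?_, fun v hv => ?_⟩
  · rw [Q_real_smul, hQ]
    field_simp
  · rw [form_real_smul_right, form_eq_zero_of_re F y _ v hv, smul_zero]
    intro v hv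
    rw [re_form_comm, re_form_eq_inner, flip_eq_neg hinl, inner_neg_left, real_inner_comm,
      hyF v ((le_sup_left : _ ≤ F') hv), neg_zero]

/-- A negative unit vector orthogonal to finitely many vectors. -/
lemma exists_neg_unit_of_finite [Infinite I] {s : Set (Hilb K p I)} (hs : s.Finite) :
    ∃ y : Hilb K p I, Q y = -1 ∧ ∀ v ∈ s, form v y = 0 := by
  have := FiniteDimensional.span_of_finite Kᵐᵒᵖ hs
  obtain ⟨y, hy, h⟩ := exists_neg_unit (Submodule.span Kᵐᵒᵖ s)
  exact ⟨y, hy, fun v hv => h v (Submodule.subset_span hv)⟩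

/-- A scalar of absolute value one that rotates `a` to the non-negative reals. -/
lemma exists_unit_mul_eq_norm (a : K) : ∃ c : K, ‖c‖ = 1 ∧ a * c = ‖a‖ • (1 : K) := by
  by_cases ha : a = 0
  · exact ⟨1, norm_one, by simp [ha]⟩
  · have hn : ‖a‖ ≠ 0 := norm_ne_zero_iff.2 ha
    refine ⟨‖a‖ • a⁻¹, ?_, ?_⟩
    · rw [norm_smul, norm_norm, norm_inv, mul_inv_cancel₀ hn]
    · rw [mul_smul_comm, mul_inv_cancel₀ ha]

/-- Two negative vectors of the same length are exchanged, up to a scalar, by the reflection in a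
negative vector. -/
lemma exists_neg_refl {x y : Hilb K p I} (hx : Q x < 0) (hxy : Q x = Q y) :
    ∃ (c : K) (_ : ‖c‖ = 1) (h : Q (x - MulOpposite.op c • y) < 0),
      (qrefl (x - MulOpposite.op c • y) h.ne (-1) (by simp)).1 x = MulOpposite.op c • y := by
  obtain ⟨c, hc, hc'⟩ := exists_unit_mul_eq_norm (form x y)
  have h1 : Q (MulOpposite.op c • y) = Q x := by rw [Q_smul, hc, hxy]; ring
  have h2 : form x (MulOpposite.op c • y) = ‖form x y‖ • (1 : K) := by
    rw [form_smul_right, hc']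
  have h3 : Q (x - MulOpposite.op c • y) = 2 * (Q x - ‖form x y‖) := by
    rw [Q_sub, h1, h2, re_smul, re_one]
    ring
  have h4 : Q (x - MulOpposite.op c • y) < 0 := by
    rw [h3]
    have := norm_nonneg (form x y)
    linarith
  refine ⟨c, hc, h4, ?_⟩
  rw [qrefl_apply]
  have h5 : form (x - MulOpposite.op c • y) x = (Q x - ‖form x y‖) • (1 : K) := by
    rw [form_sub_left, form_self, ← form_star x, h2, star_real_smul_one, sub_smul]
  rw [h5, h3, smul_smul, mul_inv, mul_assoc, inv_mul_cancel₀, mul_one]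
  · have : ((-1 : K) - 1) * ((2 : ℝ)⁻¹ • 1) = -1 := by
      have h2 : ((-1 : K) - 1) = (-2 : ℝ) • (1 : K) := by
        rw [neg_smul, two_smul]; abel
      rw [h2, smul_mul_smul_comm]
      norm_num
    rw [this]
    simp
  · intro h
    rw [h3, h] at h4
    simp at h4

end Coordinates

/-! ### Groups generated by reflections in negative vectors, and scalar operators -/

section NormalSubgroups

variable {K : Type} [NormedDivisionRing K] [StarRing K] [InnerProductSpace ℝ K]
  [HermitianScalars K] {p : ℕ} {I : Type u}

variable (K p I) in
/-- The group generated by the quasi-reflections in negative vectors. -/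
def negGroup : Subgroup (O K p I) :=
  Subgroup.closure {g | ∃ (u : Hilb K p I) (hu : Q u < 0) (a : K) (ha : ‖a‖ = 1),
    g = qrefl u hu.ne a ha}

variable (K p I) in
/-- The group generated by the quotients of two quasi-reflections in negative vectors that have
the same multiplier. -/
def pairGroup : Subgroup (O K p I) :=
  Subgroup.closure {g | ∃ (u : Hilb K p I) (hu : Q u < 0) (w : Hilb K p I) (hw : Q w < 0) (a : K)
    (ha : ‖a‖ = 1), g = qrefl u hu.ne a ha * (qrefl w hw.ne a ha)⁻¹}

lemma qrefl_mem_negGroup {u : Hilb K p I} (hu : Q u < 0) {a : K} (ha : ‖a‖ = 1) :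
    qrefl u hu.ne a ha ∈ negGroup K p I :=
  Subgroup.subset_closure ⟨u, hu, a, ha, rfl⟩

lemma qrefl_mul_inv_mem_pairGroup {u w : Hilb K p I} (hu : Q u < 0) (hw : Q w < 0) {a : K}
    (ha : ‖a‖ = 1) : qrefl u hu.ne a ha * (qrefl w hw.ne a ha)⁻¹ ∈ pairGroup K p I :=
  Subgroup.subset_closure ⟨u, hu, w, hw, a, ha, rfl⟩

lemma pairGroup_le_negGroup : pairGroup K p I ≤ negGroup K p I := by
  rw [pairGroup, Subgroup.closure_le]
  rintro _ ⟨u, hu, w, hw, a, ha, rfl⟩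
  exact mul_mem (qrefl_mem_negGroup hu ha) (inv_mem (qrefl_mem_negGroup hw ha))

lemma conj_mem_pairGroup (g : O K p I) {n : O K p I} (hn : n ∈ pairGroup K p I) :
    g * n * g⁻¹ ∈ pairGroup K p I := by
  have h : pairGroup K p I ≤ (pairGroup K p I).comap (MulAut.conj g).toMonoidHom := by
    conv_lhs => rw [pairGroup]
    rw [Subgroup.closure_le]
    rintro _ ⟨u, hu, w, hw, a, ha, rfl⟩
    change g * (qrefl u hu.ne a ha * (qrefl w hw.ne a ha)⁻¹) * g⁻¹ ∈ pairGroup K p I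
    have he : g * (qrefl u hu.ne a ha * (qrefl w hw.ne a ha)⁻¹) * g⁻¹ =
        (g * qrefl u hu.ne a ha * g⁻¹) * (g * qrefl w hw.ne a ha * g⁻¹)⁻¹ := by group
    rw [he, conj_qrefl, conj_qrefl]
    exact qrefl_mul_inv_mem_pairGroup (by rwa [g.2]) (by rwa [g.2]) ha
  exact h hn

/-- The orthogonal reflection in a negative vector. -/
def nrefl (u : Hilb K p I) (hu : Q u < 0) : O K p I := qrefl u hu.ne (-1) (by simp)

lemma nrefl_inv (u : Hilb K p I) (hu : Q u < 0) : (nrefl u hu)⁻¹ = nrefl u hu := by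
  rw [nrefl, qrefl_inv]
  exact qrefl_congr rfl _ (by simp) _

lemma nrefl_mul_self (u : Hilb K p I) (hu : Q u < 0) : nrefl u hu * nrefl u hu = 1 := by
  rw [mul_eq_one_iff_eq_inv, nrefl_inv]

lemma nrefl_mul_mem_pairGroup {u w : Hilb K p I} (hu : Q u < 0) (hw : Q w < 0) :
    nrefl u hu * nrefl w hw ∈ pairGroup K p I := by
  conv => rw [← nrefl_inv w]
  exact qrefl_mul_inv_mem_pairGroup hu hw _

lemma conj_nrefl (g : O K p I) (u : Hilb K p I) (hu : Q u < 0) :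
    g * nrefl u hu * g⁻¹ = nrefl (g.1 u) (by rwa [g.2]) :=
  conj_qrefl g u hu.ne _ _

lemma nrefl_apply (u : Hilb K p I) (hu : Q u < 0) (x : Hilb K p I) :
    (nrefl u hu).1 x = x - (2 * (Q u)⁻¹) • MulOpposite.op (form u x) • u := by
  rw [nrefl, qrefl_apply, sub_eq_add_neg x]
  congr 1
  have : (-1 - 1 : K) * ((Q u)⁻¹ • form u x) = -((2 * (Q u)⁻¹) • form u x) := by
    rw [mul_smul, two_smul, ← neg_add', neg_mul, add_mul, one_mul]
  rw [this, MulOpposite.op_neg, neg_smul, MulOpposite.op_smul, smul_assoc]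

lemma nrefl_apply_of_form_eq_zero {u : Hilb K p I} (hu : Q u < 0) {x : Hilb K p I}
    (h : form u x = 0) : (nrefl u hu).1 x = x :=
  qrefl_apply_of_form_eq_zero _ _ _ _ h

lemma nrefl_congr {u w : Hilb K p I} (h : u = w) (hu : Q u < 0) :
    nrefl u hu = nrefl w (h ▸ hu) := by
  subst h
  rfl

lemma nrefl_smul {u : Hilb K p I} (hu : Q u < 0) {c : K} (hc : c ≠ 0)
    (h : Q (MulOpposite.op c • u) < 0) : nrefl (MulOpposite.op c • u) h = nrefl u hu :=
  qrefl_smul_neg_one u hu.ne c hc h.ne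

lemma ne_zero_of_norm_eq_one {c : K} (hc : ‖c‖ = 1) : c ≠ 0 := fun h => by simp [h] at hc

lemma op_smul_injective {x : Hilb K p I} (hx : Q x ≠ 0) {a b : K}
    (h : MulOpposite.op a • x = MulOpposite.op b • x) : a = b := by
  have h1 := congrArg (form x) h
  rw [form_smul_right, form_smul_right, form_self, smul_mul_assoc, smul_mul_assoc, one_mul,
    one_mul] at h1
  exact smul_right_injective K hx h1

/-- The group `pairGroup` is transitive on negative lines, with control on the fixed vectors. -/
lemma exists_pairGroup_map [Infinite I] {x y : Hilb K p I} (hx : Q x < 0) (hxy : Q x = Q y)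
    (s : Set (Hilb K p I)) (hs : s.Finite) :
    ∃ n ∈ pairGroup K p I, (∃ c : K, ‖c‖ = 1 ∧ n.1 x = MulOpposite.op c • y) ∧
      ∀ z ∈ s, form x z = 0 → form y z = 0 → n.1 z = z := by
  obtain ⟨c, hc, h1, h2⟩ := exists_neg_refl hx hxy
  obtain ⟨v, hv, hvs⟩ := exists_neg_unit_of_finite (hs.insert x)
  have hv0 : Q v < 0 := by rw [hv]; norm_num
  refine ⟨nrefl _ h1 * nrefl v hv0, nrefl_mul_mem_pairGroup _ _, ⟨c, hc, ?_⟩, fun z hz hxz hyz => ?_⟩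
  · rw [mul_apply', nrefl_apply_of_form_eq_zero hv0 (form_eq_zero_symm (hvs x (by simp)))]
    exact h2
  · rw [mul_apply', nrefl_apply_of_form_eq_zero hv0 (form_eq_zero_symm (hvs z (by simp [hz])))]
    refine nrefl_apply_of_form_eq_zero _ ?_
    rw [form_sub_left, form_smul_left, hxz, hyz, mul_zero, sub_zero]

lemma apply_eq_self_of_orthogonal_moved (g : O K p I) (y : Hilb K p I)
    (hy : ∀ v ∈ moved g.1, form v y = 0) : g.1 y = y := by
  by_contra hne
  obtain ⟨z, hz⟩ := exists_form_ne_zero (sub_ne_zero.2 hne)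
  apply hz
  have h := hy _ (sub_mem_moved g.1 ((g⁻¹).1 z))
  rw [apply_inv_self', form_sub_left] at h
  rw [form_sub_right, sub_eq_zero.1 h, ← form_map g ((g⁻¹).1 z), apply_inv_self', sub_self]

/-- An element of the orthogonal group that preserves all negative lines is a scalar of the centre
of `K`. -/
lemma exists_central_scalar [Infinite I] (g : O K p I)
    (h : ∀ x, Q x < 0 → ∃ a : K, g.1 x = MulOpposite.op a • x) :
    ∃ a : K, (∀ c, c * a = a * c) ∧ ∀ x, g.1 x = MulOpposite.op a • x := by
  choose! a ha using h
  have horth : ∀ x y, Q x < 0 → Q y < 0 → form x y = 0 → a x = a y := by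
    intro x y hx hy hxy
    have hxy' := form_eq_zero_symm hxy
    have hQ : Q (x + y) < 0 := by
      rw [Q_add, hxy, re_zero]
      linarith
    have h1 := ha _ hQ
    rw [map_add, ha x hx, ha y hy, smul_add] at h1
    have hx1 := congrArg (form x) h1
    have hy1 := congrArg (form y) h1
    simp only [form_add_right, form_smul_right, hxy, hxy', zero_mul, add_zero, zero_add, form_self,
      smul_mul_assoc, one_mul] at hx1 hy1
    exact (smul_right_injective K hx.ne hx1).trans (smul_right_injective K hy.ne hy1).symm
  have hall : ∀ x y, Q x < 0 → Q y < 0 → a x = a y := by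
    intro x y hx hy
    obtain ⟨v, hv, hvs⟩ := exists_neg_unit_of_finite (Set.toFinite {x, y})
    have hv0 : Q v < 0 := by rw [hv]; norm_num
    exact (horth x v hx hv0 (hvs x (by simp))).trans (horth y v hy hv0 (hvs y (by simp))).symm
  obtain ⟨x0, hx0, -⟩ := exists_neg_unit_of_finite (Set.finite_empty (α := Hilb K p I))
  have hx0' : Q x0 < 0 := by rw [hx0]; norm_num
  refine ⟨a x0, fun c => ?_, fun z => ?_⟩
  · by_cases hc : c = 0
    · simp [hc]
    have hQ : Q (MulOpposite.op c • x0) < 0 := by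
      rw [Q_smul, hx0]
      have := norm_pos_iff.2 hc
      nlinarith
    have h1 := ha _ hQ
    rw [map_smul, ha _ hx0', hall _ x0 hQ hx0', smul_smul, smul_smul, ← MulOpposite.op_mul,
      ← MulOpposite.op_mul] at h1
    exact (op_smul_injective hx0'.ne h1).symm
  · obtain ⟨f, hf, hfs⟩ := exists_neg_unit_of_finite (Set.toFinite {z})
    have hzf : form z f = 0 := hfs z rfl
    set t : ℝ := |Q z| + 1 with ht
    have ht1 : 1 ≤ t := by rw [ht]; linarith [abs_nonneg (Q z)]
    have h1 : Q (t • f) < 0 := by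
      rw [Q_real_smul, hf]
      nlinarith
    have h2 : Q (z + t • f) < 0 := by
      rw [Q_add, form_real_smul_right, hzf, smul_zero, re_zero, Q_real_smul, hf]
      nlinarith [le_abs_self (Q z)]
    have h3 := ha _ h2
    rw [map_add, ha _ h1, hall _ x0 h1 hx0', hall _ x0 h2 hx0', smul_add] at h3
    exact add_right_cancel h3

lemma exists_negative_line_moved [Infinite I] (g : O K p I) (hg : g ∉ Subgroup.center (O K p I)) :
    ∃ x, Q x < 0 ∧ ∀ a : K, g.1 x ≠ MulOpposite.op a • x := by
  by_contra! h
  obtain ⟨a, hac, ha⟩ := exists_central_scalar g h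
  refine hg (Subgroup.mem_center_iff.2 fun k => O_ext fun x => ?_)
  rw [mul_apply', mul_apply', ha, ha, map_smul]

/-- A central element acts by a scalar, which is `1` if the element fixes some non-zero vector. -/
lemma not_mem_center_of_finite_rank [Infinite I] (g : O K p I) (hg : g ∈ Ofr K p I) (h1 : g ≠ 1) :
    g ∉ Subgroup.center (O K p I) := by
  intro hc
  have : Module.Finite Kᵐᵒᵖ (moved g.1) := hg
  obtain ⟨y, hy, hys⟩ := exists_neg_unit (moved g.1)
  have hfix := apply_eq_self_of_orthogonal_moved g y hys
  obtain ⟨a, -, ha⟩ := exists_central_scalar g fun x hx => by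
    obtain ⟨b, hb⟩ := center_apply g hc x hx.ne
    exact ⟨b.unop, hb⟩
  have hy0 : Q y ≠ 0 := by rw [hy]; norm_num
  have h2 : MulOpposite.op a • y = MulOpposite.op (1 : K) • y := by
    rw [← ha, hfix, MulOpposite.op_one, one_smul]
  refine h1 (O_ext fun x => ?_)
  rw [ha, op_smul_injective hy0 h2, MulOpposite.op_one, one_smul, one_apply']

/-- If `x'` is a negative vector and `x` is not a multiple of it, there is a negative vector `u`
orthogonal to `x'` such that the reflection in `u` sends `x` to a vector orthogonal to `x`. -/
lemma exists_neg_refl_orthogonal [Infinite I] (hp : 1 ≤ p) {x x' : Hilb K p I} (hx : Q x < 0)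
    (hx' : Q x' < 0) (hne : ∀ a : K, x ≠ MulOpposite.op a • x') :
    ∃ (u : Hilb K p I) (hu : Q u < 0), form u x' = 0 ∧ form x ((nrefl u hu).1 x) = 0 := by
  -- the projection to the orthogonal complement of `x'`
  set P : Hilb K p I → Hilb K p I := fun y => y - MulOpposite.op ((Q x')⁻¹ • form x' y) • x' with hP
  have hPx' : ∀ y, form x' (P y) = 0 := by
    intro y
    simp only [hP]
    rw [form_sub_right, form_smul_right, form_self, smul_mul_smul_comm, mul_inv_cancel₀ hx'.ne,
      one_smul, one_mul, sub_self]
  have hPform : ∀ w y, form x' w = 0 → form w (P y) = form w y := by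
    intro w y hw
    simp only [hP]
    rw [form_sub_right, form_smul_right, form_eq_zero_symm hw, zero_mul, sub_zero]
  have hPx : P x ≠ 0 := fun h => hne _ (sub_eq_zero.1 h)
  -- a positive vector `e` orthogonal to `x'`
  set e := P (bvec (Sum.inl ⟨0, hp⟩)) with he
  have heQ : 0 < Q e := by
    rw [he]
    simp only [hP]
    rw [Q_sub_smul, real_inner_smul_right, real_inner_self_eq_norm_sq, norm_smul, mul_pow,
      Real.norm_eq_abs, sq_abs, Q_bvec]
    simp only [sgn, Sum.elim_inl]
    have h1 : (Q x')⁻¹ < 0 := inv_lt_zero.2 hx'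
    have h2 : (Q x')⁻¹ ^ 2 * ‖form x' (bvec (Sum.inl ⟨0, hp⟩))‖ ^ 2 * Q x' =
        (Q x')⁻¹ * ‖form x' (bvec (Sum.inl ⟨0, hp⟩))‖ ^ 2 := by
      field_simp [hx'.ne]
    rw [h2]
    nlinarith [sq_nonneg ‖form x' (bvec (Sum.inl ⟨0, hp⟩))‖]
  -- a positive vector `w` orthogonal to `x'` and not orthogonal to `x`
  obtain ⟨w, hw0, hwQ, hwx⟩ : ∃ w, form x' w = 0 ∧ 0 < Q w ∧ form w x ≠ 0 := by
    by_cases hex : form e x = 0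
    · obtain ⟨y, hy⟩ := exists_form_ne_zero hPx
      have hPy : form (P y) x ≠ 0 := by
        rw [← hPform _ _ (hPx' y)]
        intro h0
        apply hy
        have h1 := hPform (P x) y (hPx' x)
        rw [← form_star, ← h1, form_star, h0]
      refine ⟨e + (Q e / (1 + 2 * |re (form e (P y))| + |Q (P y)| + Q e)) • P y, ?_, ?_, ?_⟩
      · rw [form_add_right, form_real_smul_right, hPx', hPx', smul_zero, add_zero]
      · rw [Q_add, form_real_smul_right, Q_real_smul, re_smul]
        set b := re (form e (P y))
        set q := Q (P y)
        set s := Q e / (1 + 2 * |b| + |q| + Q e) with hs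
        have hD : 0 < 1 + 2 * |b| + |q| + Q e := by positivity
        have hs0 : 0 < s := div_pos heQ hD
        have hs1 : s * (1 + 2 * |b| + |q| + Q e) = Q e := div_mul_cancel₀ _ hD.ne'
        have hs2 : s ≤ 1 := (div_le_one hD).2 (by linarith [abs_nonneg b, abs_nonneg q])
        have h1 : -(s * |q|) ≤ s ^ 2 * q := by
          have h3 : s ^ 2 * |q| ≤ s * |q| := by
            have := mul_nonneg hs0.le (abs_nonneg q)
            nlinarith
          have h4 := mul_le_mul_of_nonneg_left (neg_abs_le q) (sq_nonneg s)
          linarith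
        have h2 : -(s * |b|) ≤ s * b := by
          have h4 := mul_le_mul_of_nonneg_left (neg_abs_le b) hs0.le
          linarith
        have h5 : 0 < s * Q e := mul_pos hs0 heQ
        linarith
      · rw [form_add_left, hex, form_real_smul_left, zero_add]
        refine smul_ne_zero ?_ hPy
        positivity
    · exact ⟨e, hPx' _, heQ, hex⟩
  set r := ‖form w x‖ with hr
  have hr0 : 0 < r := norm_pos_iff.2 hwx
  obtain ⟨v, hv, hvs⟩ := exists_neg_unit_of_finite (Set.toFinite {x, x', w})
  have hvx := hvs x (by simp)
  have hvx' := hvs x' (by simp)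
  have hvw := hvs w (by simp)
  set t := Real.sqrt (Q w + 2 * r ^ 2 / (-Q x)) with ht
  have hxx : 0 < -Q x := by linarith
  have ht2 : t ^ 2 = Q w + 2 * r ^ 2 / (-Q x) := Real.sq_sqrt (by positivity)
  have huQ : Q (w + t • v) = -(2 * r ^ 2 / (-Q x)) := by
    rw [Q_add, form_real_smul_right, hvw, smul_zero, re_zero, Q_real_smul, hv, ht2]
    ring
  have huneg : Q (w + t • v) < 0 := by
    rw [huQ]
    have : 0 < 2 * r ^ 2 / (-Q x) := by positivity
    linarith
  refine ⟨w + t • v, huneg, ?_, ?_⟩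
  · rw [form_add_left, form_real_smul_left, form_eq_zero_symm hw0, form_eq_zero_symm hvx', smul_zero,
      add_zero]
  · have hux : form (w + t • v) x = form w x := by
      rw [form_add_left, form_real_smul_left, form_eq_zero_symm hvx, smul_zero, add_zero]
    rw [nrefl_apply, form_sub_right, form_real_smul_right, form_smul_right,
      ← form_star (w + t • v) x, hux, star_mul_self_eq, form_self, smul_smul, ← sub_smul, huQ, ← hr]
    have : Q x - 2 * (-(2 * r ^ 2 / -Q x))⁻¹ * r ^ 2 = 0 := by
      field_simp
      ring
    rw [this, zero_smul]

end NormalSubgroups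

/-! ### Subgroups normalised by the pair group -/

section Core

variable {K : Type} [NormedDivisionRing K] [StarRing K] [InnerProductSpace ℝ K]
  [HermitianScalars K] {p : ℕ} {I : Type u}

lemma moved_qrefl_le (u : Hilb K p I) (hu : Q u ≠ 0) (a : K) (ha : ‖a‖ = 1) :
    moved (qrefl u hu a ha).1 ≤ Submodule.span Kᵐᵒᵖ {u} := by
  rw [moved_le_iff]
  intro x
  rw [qrefl_apply, add_sub_cancel_left]
  exact Submodule.smul_mem _ _ (Submodule.mem_span_singleton_self u)

lemma qrefl_mem_Ofr (u : Hilb K p I) (hu : Q u ≠ 0) (a : K) (ha : ‖a‖ = 1) :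
    qrefl u hu a ha ∈ Ofr K p I := by
  have := FiniteDimensional.span_of_finite Kᵐᵒᵖ (Set.finite_singleton u)
  exact Submodule.finiteDimensional_of_le (moved_qrefl_le u hu a ha)

lemma negGroup_le_Ofr : negGroup K p I ≤ Ofr K p I := by
  rw [negGroup, Subgroup.closure_le]
  rintro _ ⟨u, hu, a, ha, rfl⟩
  exact qrefl_mem_Ofr u hu.ne a ha

lemma neg_of_eq_neg_one {v : Hilb K p I} (hv : Q v = -1) : Q v < 0 := by
  rw [hv]; norm_num

lemma nrefl_swap {v w : Hilb K p I} (hvw : Q v = Q w) (h0 : form v w = 0) (h : Q (v - w) < 0) :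
    (nrefl (v - w) h).1 v = w := by
  have h1 : Q (v - w) = 2 * Q v := by rw [Q_sub, h0, re_zero, ← hvw]; ring
  have h2 : Q v ≠ 0 := by
    intro h2
    rw [h1, h2] at h
    simp at h
  rw [nrefl_apply, form_sub_left, form_eq_zero_symm h0, sub_zero, form_self, op_real_smul,
    smul_smul, h1]
  have : 2 * (2 * Q v)⁻¹ * Q v = 1 := by field_simp
  rw [this, one_smul, sub_sub_cancel]

/-- If a subgroup contains the product of the reflections in two distinct negative lines, and is
normalised by `pairGroup`, then it contains the product of the reflections in two orthogonal
negative lines. -/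
lemma exists_orthogonal_nrefl_mul_mem [Infinite I] (hp : 1 ≤ p) (M : Subgroup (O K p I))
    (hM : ∀ n ∈ pairGroup K p I, ∀ m ∈ M, n * m * n⁻¹ ∈ M) {x x' : Hilb K p I} (hx : Q x < 0)
    (hx' : Q x' < 0) (hne : ∀ a : K, x ≠ MulOpposite.op a • x')
    (h : nrefl x' hx' * nrefl x hx ∈ M) :
    ∃ (y : Hilb K p I) (hy : Q y < 0), Q y = Q x ∧ form x y = 0 ∧ nrefl y hy * nrefl x hx ∈ M := by
  obtain ⟨u, hu, hux', hux⟩ := exists_neg_refl_orthogonal hp hx hx' hne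
  obtain ⟨v, hv, hvs⟩ := exists_neg_unit_of_finite (Set.toFinite {x, x', u})
  have hv0 := neg_of_eq_neg_one hv
  have hvx := form_eq_zero_symm (hvs x (by simp))
  have hvx' := form_eq_zero_symm (hvs x' (by simp))
  set n := nrefl u hu * nrefl v hv0 with hn
  have hnx : n.1 x = (nrefl u hu).1 x := by
    rw [hn, mul_apply', nrefl_apply_of_form_eq_zero hv0 hvx]
  have hnx' : n.1 x' = x' := by
    rw [hn, mul_apply', nrefl_apply_of_form_eq_zero hv0 hvx', nrefl_apply_of_form_eq_zero hu hux']
  have h1 := hM n (nrefl_mul_mem_pairGroup hu hv0) _ h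
  have h2 : n * (nrefl x' hx' * nrefl x hx) * n⁻¹ =
      nrefl x' hx' * nrefl ((nrefl u hu).1 x) (by rwa [(nrefl u hu).2]) := by
    have : n * (nrefl x' hx' * nrefl x hx) * n⁻¹ =
      (n * nrefl x' hx' * n⁻¹) * (n * nrefl x hx * n⁻¹) := by group
    rw [this, conj_nrefl, conj_nrefl, nrefl_congr hnx, nrefl_congr hnx']
  rw [h2] at h1
  refine ⟨_, by rwa [(nrefl u hu).2], (nrefl u hu).2 x, hux, ?_⟩
  have h3 := mul_mem (inv_mem h1) h
  rwa [mul_inv_rev, nrefl_inv, nrefl_inv, mul_assoc, ← mul_assoc (nrefl x' hx'), nrefl_mul_self,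
    one_mul] at h3

/-- By transitivity of `pairGroup` on pairs of orthogonal negative lines, one product of two
reflections gives all of them. -/
lemma nrefl_mul_mem_of_orthogonal [Infinite I] (M : Subgroup (O K p I))
    (hM : ∀ n ∈ pairGroup K p I, ∀ m ∈ M, n * m * n⁻¹ ∈ M) {x y : Hilb K p I} (hx : Q x < 0)
    (hy : Q y < 0) (hxy : form x y = 0) (h : nrefl x hx * nrefl y hy ∈ M)
    {x2 y2 : Hilb K p I} (hx2 : Q x2 = Q x) (hy2 : Q y2 = Q y)
    (hxy2 : form x2 y2 = 0) : nrefl x2 (hx2 ▸ hx) * nrefl y2 (hy2 ▸ hy) ∈ M := by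
  have hx2' : Q x2 < 0 := hx2 ▸ hx
  have hy2' : Q y2 < 0 := hy2 ▸ hy
  obtain ⟨n, hn, ⟨c, hc, hnx⟩, -⟩ := exists_pairGroup_map hx hx2.symm ∅ Set.finite_empty
  have hc0 := ne_zero_of_norm_eq_one hc
  have hny : Q (n.1 y) = Q y2 := by rw [n.2, hy2]
  have hny' : Q (n.1 y) < 0 := by rwa [n.2]
  obtain ⟨m, hm, ⟨d, hd, hmy⟩, hm'⟩ := exists_pairGroup_map hny' hny {x2} (Set.finite_singleton _)
  have hd0 := ne_zero_of_norm_eq_one hd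
  have hmx : m.1 x2 = x2 := by
    refine hm' x2 rfl ?_ (form_eq_zero_symm hxy2)
    have h1 := form_map n y x
    rw [hnx, form_smul_right, form_eq_zero_symm hxy] at h1
    exact (mul_eq_zero.1 h1).resolve_right hc0
  have h2 := hM (m * n) (mul_mem hm hn) _ h
  have h3 : m * n * (nrefl x hx * nrefl y hy) * (m * n)⁻¹ =
      (m * n * nrefl x hx * (m * n)⁻¹) * (m * n * nrefl y hy * (m * n)⁻¹) := by group
  have h4 : (m * n).1 x = MulOpposite.op c • x2 := by rw [mul_apply', hnx, map_smul, hmx]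
  have h5 : (m * n).1 y = MulOpposite.op d • y2 := by rw [mul_apply', hmy]
  have h6 : Q (MulOpposite.op c • x2) < 0 := by rwa [Q_smul, hc, one_pow, one_mul]
  have h7 : Q (MulOpposite.op d • y2) < 0 := by rwa [Q_smul, hd, one_pow, one_mul]
  rwa [h3, conj_nrefl, conj_nrefl, nrefl_congr h4, nrefl_congr h5, nrefl_smul hx2' hc0 h6,
    nrefl_smul hy2' hd0 h7] at h2

lemma exists_scale {x : Hilb K p I} (hx : Q x < 0) {t : ℝ} (ht : t < 0) :
    ∃ r : ℝ, r ≠ 0 ∧ Q (r • x) = t := by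
  refine ⟨Real.sqrt (t / Q x), ?_, ?_⟩
  · exact (Real.sqrt_pos.2 (div_pos_of_neg_of_neg ht hx)).ne'
  · rw [Q_real_smul, Real.sq_sqrt (div_pos_of_neg_of_neg ht hx).le, div_mul_cancel₀ _ hx.ne]

lemma qrefl_real_smul {v : Hilb K p I} (hv : Q v ≠ 0) {r : ℝ} (hr : r ≠ 0) {a : K} (ha : ‖a‖ = 1)
    (h : Q (r • v) ≠ 0) : qrefl (r • v) h a ha = qrefl v hv a ha := by
  have hr1 : (r • (1 : K)) ≠ 0 := smul_ne_zero hr one_ne_zero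
  have h' : Q (MulOpposite.op (r • (1 : K)) • v) ≠ 0 := by rwa [op_real_smul]
  rw [qrefl_congr (op_real_smul r v).symm h rfl ha, qrefl_smul v hv _ hr1]
  refine qrefl_congr rfl hv ?_ _
  rw [smul_mul_assoc, one_mul, ← mul_one a, ← mul_smul_comm, mul_assoc, mul_inv_cancel₀ hr1, mul_one]

/-- A subgroup normalised by `pairGroup` that contains a non-trivial finite rank perturbation of the
identity contains `pairGroup`. -/
theorem pairGroup_le_of_normal [Infinite I] (hp : 1 ≤ p) (M : Subgroup (O K p I))
    (hM : ∀ n ∈ pairGroup K p I, ∀ m ∈ M, n * m * n⁻¹ ∈ M) {m : O K p I} (hm : m ∈ M)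
    (hfr : m ∈ Ofr K p I) (h1 : m ≠ 1) : pairGroup K p I ≤ M := by
  obtain ⟨x, hx, hxm⟩ := exists_negative_line_moved m (not_mem_center_of_finite_rank m hfr h1)
  -- the commutator of `m` with `r_x r_y`, where `m y = y`, is `r_{m x} r_x`
  have hmx : Q (m.1 x) < 0 := by rwa [m.2]
  have hmem : nrefl (m.1 x) hmx * nrefl x hx ∈ M := by
    have : Module.Finite Kᵐᵒᵖ (moved m.1) := hfr
    have := FiniteDimensional.span_of_finite Kᵐᵒᵖ (Set.finite_singleton x)
    obtain ⟨y, hy, hys⟩ := exists_neg_unit (moved m.1 ⊔ Submodule.span Kᵐᵒᵖ {x})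
    have hy0 := neg_of_eq_neg_one hy
    have hmy : m.1 y = y := apply_eq_self_of_orthogonal_moved m y fun v hv =>
      hys v ((le_sup_left : _ ≤ moved m.1 ⊔ Submodule.span Kᵐᵒᵖ {x}) hv)
    have h2 := mul_mem hm (hM _ (nrefl_mul_mem_pairGroup hx hy0) _ (inv_mem hm))
    have h3 : m * (nrefl x hx * nrefl y hy0 * m⁻¹ * (nrefl x hx * nrefl y hy0)⁻¹) =
        (m * nrefl x hx * m⁻¹) * (m * nrefl y hy0 * m⁻¹) * ((nrefl y hy0)⁻¹ * (nrefl x hx)⁻¹) := by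
      group
    rwa [h3, conj_nrefl, conj_nrefl, nrefl_congr hmy, mul_assoc, mul_inv_cancel_left,
      nrefl_inv] at h2
  have hne : ∀ a : K, x ≠ MulOpposite.op a • m.1 x := by
    intro a ha
    have ha0 : a ≠ 0 := by
      rintro rfl
      rw [MulOpposite.op_zero, zero_smul] at ha
      exact ne_zero_of_Q_ne_zero hx.ne ha
    apply hxm a⁻¹
    conv_rhs => rw [ha]
    rw [smul_smul, ← MulOpposite.op_mul, mul_inv_cancel₀ ha0, MulOpposite.op_one, one_smul]
  obtain ⟨y, hy, hyQ, hxy, hyx⟩ := exists_orthogonal_nrefl_mul_mem hp M hM hx hmx hne hmem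
  -- all products of reflections in orthogonal negative vectors
  have key : ∀ (v w : Hilb K p I) (hv : Q v < 0) (hw : Q w < 0), form v w = 0 →
      nrefl v hv * nrefl w hw ∈ M := by
    intro v w hv hw hvw
    obtain ⟨r, hr0, hr⟩ := exists_scale hv hy
    obtain ⟨s, hs0, hs⟩ := exists_scale hw hx
    have := nrefl_mul_mem_of_orthogonal M hM hy hx (form_eq_zero_symm hxy) hyx hr hs (by
      rw [form_real_smul_left, form_real_smul_right, hvw, smul_zero, smul_zero])
    simp only [nrefl] at this ⊢
    rwa [qrefl_real_smul hv.ne hr0, qrefl_real_smul hw.ne hs0] at this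
  -- quotients of quasi-reflections in orthogonal negative vectors, as commutators
  have key2 : ∀ (v w : Hilb K p I) (hv : Q v < 0) (hw : Q w < 0) (a : K) (ha : ‖a‖ = 1),
      form v w = 0 → Q v = Q w → qrefl v hv.ne a ha * (qrefl w hw.ne a ha)⁻¹ ∈ M := by
    intro v w hv hw a ha hvw hQ
    obtain ⟨q, hq, hqs⟩ := exists_neg_unit_of_finite (Set.toFinite {v, w})
    have hq0 := neg_of_eq_neg_one hq
    obtain ⟨q', hq', hqs'⟩ := exists_neg_unit_of_finite (Set.toFinite {v, w, q})
    have hq0' := neg_of_eq_neg_one hq'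
    have hvw' : Q (v - w) < 0 := by
      rw [Q_sub, hvw, re_zero]
      linarith
    set h := nrefl (v - w) hvw' * nrefl q hq0 with hh
    have hhM : h ∈ M := key _ _ _ _ (by
      rw [form_sub_left, hqs v (by simp), hqs w (by simp), sub_zero])
    have hhv : h.1 v = w := by
      rw [hh, mul_apply', nrefl_apply_of_form_eq_zero hq0 (form_eq_zero_symm (hqs v (by simp))),
        nrefl_swap hQ hvw]
    have hhq : h.1 q' = q' := by
      rw [hh, mul_apply', nrefl_apply_of_form_eq_zero hq0 (hqs' q (by simp)),
        nrefl_apply_of_form_eq_zero]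
      rw [form_sub_left, hqs' v (by simp), hqs' w (by simp), sub_zero]
    set d := qrefl v hv.ne a ha * (qrefl q' hq0'.ne a ha)⁻¹ with hd
    have h2 := mul_mem (hM d (qrefl_mul_inv_mem_pairGroup hv hq0' ha) h hhM) (inv_mem hhM)
    have h3 : d * h * d⁻¹ * h⁻¹ = qrefl v hv.ne a ha * (qrefl q' hq0'.ne a ha)⁻¹ *
        (h * qrefl q' hq0'.ne a ha * h⁻¹) * (h * qrefl v hv.ne a ha * h⁻¹)⁻¹ := by
      rw [hd]; group
    rwa [h3, conj_qrefl, conj_qrefl, qrefl_congr hhq _ rfl, qrefl_congr hhv _ rfl,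
      inv_mul_cancel_right] at h2
  rw [pairGroup, Subgroup.closure_le]
  rintro _ ⟨u, hu, w, hw, a, ha, rfl⟩
  obtain ⟨q, hq, hqs⟩ := exists_neg_unit_of_finite (Set.toFinite {u, w})
  have hq0 := neg_of_eq_neg_one hq
  obtain ⟨r, hr0, hr⟩ := exists_scale hq0 hu
  obtain ⟨s, hs0, hs⟩ := exists_scale hq0 hw
  have h2 := key2 u (r • q) hu (by rwa [hr]) a ha
    (by rw [form_real_smul_right, hqs u (by simp), smul_zero]) hr.symm
  have h3 := key2 w (s • q) hw (by rwa [hs]) a ha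
    (by rw [form_real_smul_right, hqs w (by simp), smul_zero]) hs.symm
  rw [qrefl_real_smul hq0.ne hr0] at h2
  rw [qrefl_real_smul hq0.ne hs0] at h3
  have h4 := mul_mem h2 (inv_mem h3)
  rwa [mul_inv_rev, inv_inv, mul_assoc, inv_mul_cancel_left] at h4

/-- An element of the orthogonal group that is not central has a non-trivial commutator with
`pairGroup`. -/
lemma exists_commutator_ne_one [Infinite I] (g : O K p I) (hg : g ∉ Subgroup.center (O K p I)) :
    ∃ n ∈ pairGroup K p I, g * n * g⁻¹ * n⁻¹ ≠ 1 := by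
  obtain ⟨x, hx, hgx⟩ := exists_negative_line_moved g hg
  -- if `g` commutes with `r_x r_y` then `g x` is in the plane of `x` and `y`
  have key : ∀ (y z : Hilb K p I) (hy : Q y < 0), form x y = 0 → form y z = 0 →
      g * (nrefl x hx * nrefl y hy) * g⁻¹ * (nrefl x hx * nrefl y hy)⁻¹ = 1 → form x z = 0 →
      form z (g.1 x) = 0 := by
    intro y z hy hxy hyz h hxz
    rw [mul_inv_eq_one, mul_inv_eq_iff_eq_mul] at h
    have h1 := congrArg (fun k : O K p I => form z (k.1 x)) h
    have hnx : (nrefl x hx).1 x = -x := by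
      have := qrefl_apply_self x hx.ne (-1 : K) (by simp)
      simpa [nrefl] using this
    simp only [mul_apply'] at h1
    rw [nrefl_apply_of_form_eq_zero hy (form_eq_zero_symm hxy), hnx, map_neg, form_neg_right,
      nrefl_apply x, nrefl_apply y, form_sub_right, form_sub_right, form_real_smul_right,
      form_real_smul_right, form_smul_right, form_smul_right, form_eq_zero_symm hxz,
      form_eq_zero_symm hyz] at h1
    simp only [zero_mul, smul_zero, sub_zero] at h1
    have h2 := congrArg (fun k => (2 : ℝ)⁻¹ • (k + form z (g.1 x))) h1
    simp only [neg_add_cancel, smul_zero, ← two_smul ℝ (form z (g.1 x)), smul_smul] at h2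
    norm_num at h2
    exact h2.symm
  by_contra! hcon
  obtain ⟨y, hy, hys⟩ := exists_neg_unit_of_finite (Set.toFinite {x})
  have hy0 := neg_of_eq_neg_one hy
  have hxy := hys x rfl
  obtain ⟨y', hy', hys'⟩ := exists_neg_unit_of_finite (Set.toFinite {x, y})
  have hy0' := neg_of_eq_neg_one hy'
  have hxy' := hys' x (by simp)
  have hyy' := hys' y (by simp)
  have h := hcon _ (nrefl_mul_mem_pairGroup hx hy0)
  have h' := hcon _ (nrefl_mul_mem_pairGroup hx hy0')
  -- subtracting its component on `x` from `g x` leaves zero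
  set c := (Q x)⁻¹ • form x (g.1 x) with hc
  apply hgx c
  by_contra hne
  obtain ⟨z, hz⟩ := exists_form_ne_zero (sub_ne_zero.2 hne)
  have hy1 : form y (g.1 x) = 0 := key y' y hy0' hxy' (form_eq_zero_symm hyy') h' hxy
  apply hz
  set z' := z - MulOpposite.op ((Q x)⁻¹ • form x z) • x - MulOpposite.op ((Q y)⁻¹ • form y z) • y
    with hz'
  have hcancel : ∀ (t : ℝ) (b : K), t ≠ 0 → t • (1 : K) * (t⁻¹ • b) = b := by
    intro t b ht
    rw [smul_mul_smul_comm, mul_inv_cancel₀ ht, one_mul, one_smul]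
  have e1 : form x z' = 0 := by
    rw [hz', form_sub_right, form_sub_right, form_smul_right, form_smul_right, hxy, form_self,
      zero_mul, hcancel _ _ hx.ne]
    simp
  have e2 : form y z' = 0 := by
    rw [hz', form_sub_right, form_sub_right, form_smul_right, form_smul_right, form_eq_zero_symm hxy,
      form_self, zero_mul, hcancel _ _ hy0.ne]
    simp
  have e3 := key y z' hy0 hxy e2 h e1
  have hw1 : form x (g.1 x - MulOpposite.op c • x) = 0 := by
    rw [form_sub_right, form_smul_right, form_self, hc, hcancel _ _ hx.ne, sub_self]
  have hw2 : form y (g.1 x - MulOpposite.op c • x) = 0 := by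
    rw [form_sub_right, form_smul_right, form_eq_zero_symm hxy, zero_mul, hy1, sub_self]
  have hw3 : form z' (g.1 x - MulOpposite.op c • x) = 0 := by
    rw [form_sub_right, form_smul_right, form_eq_zero_symm e1, zero_mul, e3, sub_self]
  rwa [hz', form_sub_left, form_sub_left, form_smul_left, form_smul_left, hw1, hw2, mul_zero,
    mul_zero, sub_zero, sub_zero] at hw3

end Core

/-! ### Transitivity of the group generated by negative quasi-reflections -/

section Transitivity

variable {K : Type} [NormedDivisionRing K] [StarRing K] [InnerProductSpace ℝ K]
  [HermitianScalars K] {p : ℕ} {I : Type u}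

/-- `negGroup` is transitive on negative vectors of given length. -/
lemma exists_negGroup_map_neg {x y : Hilb K p I} (hx : Q x < 0) (hxy : Q x = Q y) :
    ∃ γ ∈ negGroup K p I, γ.1 x = y ∧ ∀ z, form x z = 0 → form y z = 0 → γ.1 z = z := by
  obtain ⟨c, hc, h1, h2⟩ := exists_neg_refl hx hxy
  have hy : Q y < 0 := hxy ▸ hx
  have hc0 := ne_zero_of_norm_eq_one hc
  have hc' : ‖c⁻¹‖ = 1 := by rw [norm_inv, hc, inv_one]
  refine ⟨qrefl y hy.ne c⁻¹ hc' * qrefl _ h1.ne (-1) (by simp),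
    mul_mem (qrefl_mem_negGroup hy hc') (qrefl_mem_negGroup h1 _), ?_, fun z hxz hyz => ?_⟩
  · rw [mul_apply', h2, map_smul, qrefl_apply_self, smul_smul, ← MulOpposite.op_mul,
      inv_mul_cancel₀ hc0, MulOpposite.op_one, one_smul]
  · have h3 : form (x - MulOpposite.op c • y) z = 0 := by
      rw [form_sub_left, form_smul_left, hxz, hyz, mul_zero, sub_zero]
    rw [mul_apply', qrefl_apply_of_form_eq_zero _ _ _ _ h3, qrefl_apply_of_form_eq_zero _ _ _ _ hyz]

/-- Two positive unit vectors whose difference is negative are related by a single quasi-reflection,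
in this difference. -/
lemma exists_negGroup_map_pos_of_one_lt {x y : Hilb K p I} (hx : Q x = 1) (hy : Q y = 1)
    (h : 1 < re (form x y)) :
    ∃ γ ∈ negGroup K p I, γ.1 x = y ∧ ∀ z, form x z = 0 → form y z = 0 → γ.1 z = z := by
  have h1 : Q (x - y) < 0 := by
    rw [Q_sub, hx, hy]
    linarith
  obtain ⟨a, ha, hax⟩ := exists_qrefl_sub_apply (hx.trans hy.symm) h1.ne
  refine ⟨_, qrefl_mem_negGroup h1 ha, hax, fun z hxz hyz => qrefl_apply_of_form_eq_zero _ _ _ _ ?_⟩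
  rw [form_sub_left, hxz, hyz, sub_zero]

/-- `negGroup` relates two positive unit vectors that are not too far from each other, via a third
one that is far from both. -/
lemma exists_negGroup_map_pos [Infinite I] {x y : Hilb K p I} (hx : Q x = 1) (hy : Q y = 1)
    (h : -1 < re (form x y)) {s : Set (Hilb K p I)} (hs : s.Finite) :
    ∃ γ ∈ negGroup K p I, γ.1 x = y ∧ ∀ z ∈ s, form x z = 0 → form y z = 0 → γ.1 z = z := by
  obtain ⟨f, hf, hfs⟩ := exists_neg_unit_of_finite ((hs.insert y).insert x)
  have hxf := hfs x (by simp)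
  have hyf := hfs y (by simp)
  -- the intermediate vector `t (x + y) + r f`, where `t` is chosen such that the real part of its
  -- form with `x` and with `y` is `3 + c > 1`, and `r` such that it has length one
  set c := re (form x y) with hc
  have hc1 : 0 < 1 + c := by linarith
  set t : ℝ := 1 + 2 / (1 + c) with ht
  have ht1 : 1 < t := by
    rw [ht]
    have : 0 < 2 / (1 + c) := by positivity
    linarith
  have ht2 : t * (1 + c) = 3 + c := by
    rw [ht]
    field_simp
    ring
  set r := Real.sqrt (2 * t * (3 + c) - 1) with hr
  have hr2 : r ^ 2 = 2 * t * (3 + c) - 1 := Real.sq_sqrt (by nlinarith)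
  set w := t • (x + y) + r • f with hw
  have hwQ : Q w = 1 := by
    rw [hw, Q_add, form_real_smul_left, form_real_smul_right, form_add_left, hxf, hyf, Q_real_smul,
      Q_add, Q_real_smul, hx, hy, hf, hr2, ← hc, ← ht2]
    simp only [add_zero, smul_zero, re_zero]
    ring
  have hxw : form x w = t • (1 + form x y) := by
    rw [hw, form_add_right, form_real_smul_right, form_real_smul_right, hxf, smul_zero, add_zero,
      form_add_right, form_self, hx, one_smul]
  have hwy : form w y = t • (form x y + 1) := by
    rw [hw, form_add_left, form_real_smul_left, form_real_smul_left, form_eq_zero_symm hyf,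
      smul_zero, add_zero, form_add_left, form_self, hy, one_smul]
  obtain ⟨γ, hγ, hγ1, hγ2⟩ := exists_negGroup_map_pos_of_one_lt hx hwQ (by
    rw [hxw, re_smul, re_add, re_one, ht2]
    linarith)
  obtain ⟨δ, hδ, hδ1, hδ2⟩ := exists_negGroup_map_pos_of_one_lt hwQ hy (by
    rw [hwy, re_smul, re_add, re_one, add_comm, ht2]
    linarith)
  refine ⟨δ * γ, mul_mem hδ hγ, by rw [mul_apply', hγ1, hδ1], fun z hz hxz hyz => ?_⟩
  have hwz : form w z = 0 := by
    rw [hw, form_add_left, form_real_smul_left, form_real_smul_left, form_add_left, hxz, hyz,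
      form_eq_zero_symm (hfs z (by simp [hz]))]
    simp
  rw [mul_apply', hγ2 z hxz hwz, hδ2 z hwz hyz]

/-- `negGroup` relates two positive unit vectors as soon as there is an intermediate vector `w`. -/
lemma exists_negGroup_map_pos_of_exists [Infinite I] {x y w : Hilb K p I} (hx : Q x = 1)
    (hy : Q y = 1) (hw : Q w = 1) (hyw : re (form y w) = 0) {s : Set (Hilb K p I)}
    (hs : s.Finite) :
    ∃ γ ∈ negGroup K p I, γ.1 x = y ∧
      ∀ z ∈ s, form x z = 0 → form y z = 0 → form w z = 0 → γ.1 z = z := by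
  -- replace `w` by `-w` if necessary
  obtain ⟨w', hw', hyw', hxw', hz'⟩ : ∃ w', Q w' = 1 ∧ re (form y w') = 0 ∧ 0 ≤ re (form x w') ∧
      ∀ z, form w z = 0 → form w' z = 0 := by
    rcases le_total 0 (re (form x w)) with h | h
    · exact ⟨w, hw, hyw, h, fun z hz => hz⟩
    · refine ⟨-w, ?_, ?_, ?_, fun z hz => ?_⟩
      · have := Q_real_smul w (-1)
        simpa [hw] using this
      · rw [form_neg_right, re_neg, hyw, neg_zero]
      · rw [form_neg_right, re_neg]
        linarith
      · rw [form_neg_left, hz, neg_zero]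
  obtain ⟨γ, hγ, hγ1, hγ2⟩ := exists_negGroup_map_pos hx hw' (by linarith) hs
  obtain ⟨δ, hδ, hδ1, hδ2⟩ := exists_negGroup_map_pos hw' hy (by
    rw [re_form_comm, hyw']
    norm_num) hs
  refine ⟨δ * γ, mul_mem hδ hγ, by rw [mul_apply', hγ1, hδ1], fun z hz hxz hyz hwz => ?_⟩
  rw [mul_apply', hγ2 z hz hxz (hz' z hwz), hδ2 z hz (hz' z hwz) hyz]

/-- Given an intermediate vector for each of the first `k` positive basis vectors, `negGroup`
moves the images of these basis vectors back to their place. -/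
lemma exists_negGroup_fix_bvec [Infinite I] (g : O K p I) (k : ℕ)
    (hw : ∀ j : Fin p, (j : ℕ) < k → ∃ w : Hilb K p I, Q w = 1 ∧
      re (form (bvec (Sum.inl j)) w) = 0 ∧ ∀ i < j, form w (bvec (Sum.inl i)) = 0) :
    ∃ γ ∈ negGroup K p I, ∀ i : Fin p, (i : ℕ) < k →
      (γ * g).1 (bvec (Sum.inl i)) = bvec (Sum.inl i) := by
  induction k with
  | zero => exact ⟨1, one_mem _, fun i hi => absurd hi (Nat.not_lt_zero _)⟩
  | succ k ih =>
    obtain ⟨γ, hγ, h⟩ := ih fun j hj => hw j (hj.trans (Nat.lt_succ_self k))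
    by_cases hk : k < p
    · obtain ⟨w, hw1, hw2, hw3⟩ := hw ⟨k, hk⟩ (Nat.lt_succ_self k)
      have hQ : Q (bvec (Sum.inl ⟨k, hk⟩) : Hilb K p I) = 1 := Q_bvec _
      have hs : (Set.range fun i : Fin p => (bvec (Sum.inl i) : Hilb K p I)).Finite :=
        Set.finite_range _
      obtain ⟨δ, hδ, hδ1, hδ2⟩ := exists_negGroup_map_pos_of_exists
        (x := (γ * g).1 (bvec (Sum.inl ⟨k, hk⟩))) (by rw [(γ * g).2, hQ]) hQ hw1 hw2 hs
      refine ⟨δ * γ, mul_mem hδ hγ, fun i hi => ?_⟩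
      rw [mul_assoc, mul_apply']
      rcases (Nat.lt_succ_iff_lt_or_eq.1 hi) with hi | hi
      · have hne : (Sum.inl i : Fin p ⊕ I) ≠ Sum.inl ⟨k, hk⟩ := by
          intro h
          have := congrArg Fin.val (Sum.inl.inj h)
          simp at this
          omega
        have h0 : form (bvec (Sum.inl ⟨k, hk⟩) : Hilb K p I) (bvec (Sum.inl i)) = 0 := by
          rw [form_bvec, bvec_ne hne.symm, smul_zero]
        rw [h i hi]
        refine hδ2 _ ⟨i, rfl⟩ ?_ h0 (hw3 i hi)
        conv_lhs => rw [← h i hi]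
        rw [form_map, h0]
      · have : i = ⟨k, hk⟩ := Fin.ext hi
        rw [this, hδ1]
    · refine ⟨γ, hγ, fun i hi => h i ?_⟩
      have := i.2
      omega

/-- The component of `x` orthogonal to a finite-dimensional `K`-subspace of the negative definite
subspace spanned by the basis vectors indexed by `I`. -/
lemma exists_orthogonal_component (W : Submodule Kᵐᵒᵖ (Hilb K p I)) [Module.Finite Kᵐᵒᵖ W]
    (hW : ∀ w ∈ W, ∀ i, w (Sum.inl i) = 0) (x : Hilb K p I) :
    ∃ w ∈ W, ∀ v ∈ W, form v (x - w) = 0 := by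
  have := finiteDimensional_real_of_finite W
  refine ⟨(W.restrictScalars ℝ).starProjection x,
    (W.restrictScalars ℝ).starProjection_apply_mem x, ?_⟩
  refine form_eq_zero_of_re W _ fun v hv => ?_
  rw [re_form_eq_inner, flip_eq_neg (hW v hv), inner_neg_left, neg_eq_zero]
  exact (Submodule.mem_orthogonal _ _).1 ((W.restrictScalars ℝ).sub_starProjection_mem_orthogonal x)
    v hv

lemma apply_eq_self_of_mem_span {g : O K p I} {s : Set (Hilb K p I)} (h : ∀ x ∈ s, g.1 x = x)
    {x : Hilb K p I} (hx : x ∈ Submodule.span Kᵐᵒᵖ s) : g.1 x = x := by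
  induction hx using Submodule.span_induction with
  | mem x hx => exact h x hx
  | zero => exact map_zero _
  | add x y _ _ hx hy => rw [map_add, hx, hy]
  | smul a x _ hx => rw [map_smul, hx]

lemma form_eq_zero_of_mem_span (g : O K p I) {s : Set (Hilb K p I)} {y : Hilb K p I}
    (h : ∀ x ∈ s, form (g.1 x) y = 0) {x : Hilb K p I} (hx : x ∈ Submodule.span Kᵐᵒᵖ s) :
    form (g.1 x) y = 0 := by
  induction hx using Submodule.span_induction with
  | mem x hx => exact h x hx
  | zero => rw [map_zero, form_zero_left]
  | add x y _ _ hx hy => rw [map_add, form_add_left, hx, hy, add_zero]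
  | smul a x _ hx =>
    induction a using MulOpposite.rec' with
    | _ a => rw [map_smul, form_smul_left, hx, mul_zero]

/-- On a finite set of vectors of the negative definite subspace spanned by the basis vectors
indexed by `I`, every element `g` of the orthogonal group agrees with an element `γ⁻¹` of `negGroup`,
which can be chosen with small support: the induction follows the Gram-Schmidt procedure. -/
lemma exists_negGroup_fix_neg (g : O K p I) (s : Finset (Hilb K p I)) :
    (∀ w ∈ s, ∀ i, w (Sum.inl i) = 0) →
    ∃ γ ∈ negGroup K p I, (∀ x ∈ s, (γ * g).1 x = x) ∧
      ∀ y, (∀ x ∈ s, form x y = 0 ∧ form (g.1 x) y = 0) → γ.1 y = y := by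
  classical
  induction s using Finset.induction_on with
  | empty => exact fun _ => ⟨1, one_mem _, by simp, fun y _ => rfl⟩
  | insert x s _ ih =>
    intro hs
    have hsn : ∀ w ∈ s, ∀ i, w (Sum.inl i) = 0 := fun w hw => hs w (Finset.mem_insert_of_mem hw)
    obtain ⟨γ, hγ, h1, h2⟩ := ih hsn
    set W := Submodule.span Kᵐᵒᵖ (s : Set (Hilb K p I)) with hWdef
    have := FiniteDimensional.span_of_finite Kᵐᵒᵖ s.finite_toSet
    have hW : ∀ w ∈ W, ∀ i, w (Sum.inl i) = 0 := by
      intro w hw i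
      induction hw using Submodule.span_induction with
      | mem x hx => exact hsn x hx i
      | zero => rfl
      | add x y _ _ hx hy =>
        change x (Sum.inl i) + y (Sum.inl i) = 0
        rw [hx, hy, add_zero]
      | smul a x _ hx =>
        change a • x (Sum.inl i) = 0
        rw [hx, smul_zero]
    obtain ⟨w, hwW, hw⟩ := exists_orthogonal_component W hW x
    have h1' : ∀ z ∈ W, (γ * g).1 z = z := fun z hz => apply_eq_self_of_mem_span h1 hz
    by_cases hx0 : x - w = 0
    · refine ⟨γ, hγ, fun z hz => ?_, fun y hy => h2 y fun z hz => hy z (Finset.mem_insert_of_mem hz)⟩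
      rcases Finset.mem_insert.1 hz with rfl | hz
      · rw [sub_eq_zero.1 hx0]
        exact h1' w hwW
      · exact h1 z hz
    have hinl : ∀ i, (x - w) (Sum.inl i) = 0 := by
      intro i
      change x (Sum.inl i) - w (Sum.inl i) = 0
      rw [hs x (Finset.mem_insert_self _ _), hW w hwW, sub_zero]
    have hneg : Q (x - w) < 0 := by
      rw [Q_eq_neg_norm_sq hinl, neg_lt_zero]
      have := norm_pos_iff.2 hx0
      positivity
    obtain ⟨δ, hδ, h3, h4⟩ := exists_negGroup_map_neg (x := (γ * g).1 (x - w)) (y := x - w)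
      (by rwa [(γ * g).2]) ((γ * g).2 _)
    have hδs : ∀ z ∈ s, (δ * γ * g).1 z = z := by
      intro z hz
      have hzx : form (x - w) z = 0 := form_eq_zero_symm (hw z (Submodule.subset_span hz))
      rw [mul_assoc, mul_apply', h1 z hz]
      refine h4 z ?_ hzx
      conv_lhs => rw [← h1 z hz]
      rw [form_map, hzx]
    refine ⟨δ * γ, mul_mem hδ hγ, fun z hz => ?_, fun y hy => ?_⟩
    · rcases Finset.mem_insert.1 hz with rfl | hz
      · have hw' : (δ * γ * g).1 w = w := apply_eq_self_of_mem_span hδs hwW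
        have hz' : (δ * γ * g).1 (z - w) = z - w := by
          rw [mul_assoc]
          exact h3
        rw [← sub_add_cancel z w, map_add, hw', hz']
      · exact hδs z hz
    · have hys : ∀ z ∈ s, form z y = 0 ∧ form (g.1 z) y = 0 :=
        fun z hz => hy z (Finset.mem_insert_of_mem hz)
      have hyx := hy x (Finset.mem_insert_self _ _)
      have hγy := h2 y hys
      have e1 : form w y = 0 := form_eq_zero_of_mem_span 1 (fun z hz => (hys z hz).1) hwW
      have e2 : form (g.1 w) y = 0 := form_eq_zero_of_mem_span g (fun z hz => (hys z hz).2) hwW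
      rw [mul_apply', hγy]
      refine h4 y ?_ ?_
      · conv_lhs => rw [← hγy]
        rw [mul_apply', form_map, map_sub, form_sub_left, hyx.2, e2, sub_zero]
      · rw [form_sub_left, hyx.1, e1, sub_zero]

/-- An element of the orthogonal group that fixes the base point pointwise agrees with an element of
`negGroup` on every finite-dimensional subspace. -/
lemma exists_negGroup_eqOn (g : O K p I)
    (hg : ∀ i, g.1 (bvec (Sum.inl i)) = bvec (Sum.inl i)) (s : Finset (Hilb K p I)) :
    ∃ γ ∈ negGroup K p I, ∀ x ∈ s, γ.1 x = g.1 x := by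
  classical
  -- project the vectors of `s` to the orthogonal complement of the base point
  set P : Hilb K p I → Hilb K p I := fun x =>
    x - ∑ i : Fin p, MulOpposite.op (x (Sum.inl i)) • bvec (Sum.inl i) with hP
  have hPi : ∀ x, ∀ i, (P x) (Sum.inl i) = 0 := by
    intro x
    rw [← form_inl_eq_zero_iff]
    intro i
    let φ : Hilb K p I →+ K := AddMonoidHom.mk' (form (bvec (Sum.inl i))) (form_add_right _)
    have hφ : form (bvec (Sum.inl i)) (P x) = φ (P x) := rfl
    rw [hφ, hP, map_sub, map_sum, Finset.sum_eq_single i]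
    · simp only [φ, AddMonoidHom.mk'_apply]
      rw [form_smul_right, form_bvec, form_bvec, bvec_self, smul_mul_assoc, one_mul, sub_self]
    · intro j _ hj
      simp only [φ, AddMonoidHom.mk'_apply]
      rw [form_smul_right, form_bvec, bvec_ne (by simpa using hj.symm), smul_zero, zero_mul]
    · simp
  obtain ⟨γ, hγ, h1, h2⟩ := exists_negGroup_fix_neg g (s.image P) (by
    intro w hw
    obtain ⟨x, -, rfl⟩ := Finset.mem_image.1 hw
    exact hPi x)
  have h3 : ∀ i, (γ * g).1 (bvec (Sum.inl i)) = bvec (Sum.inl i) := by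
    intro i
    rw [mul_apply', hg]
    refine h2 _ fun w hw => ?_
    obtain ⟨x, -, rfl⟩ := Finset.mem_image.1 hw
    have h4 : form (P x) (bvec (Sum.inl i)) = 0 :=
      form_eq_zero_symm (form_inl_eq_zero_iff.2 (hPi x) i)
    refine ⟨h4, ?_⟩
    rw [← hg i, form_map, h4]
  refine ⟨γ⁻¹, inv_mem hγ, fun x hx => ?_⟩
  rw [inv_apply_eq, ← mul_apply']
  have h5 : x = P x + ∑ i : Fin p, MulOpposite.op (x (Sum.inl i)) • bvec (Sum.inl i) :=
    (sub_add_cancel _ _).symm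
  conv_lhs => rw [h5]
  conv_rhs => rw [h5]
  rw [map_add, h1 _ (Finset.mem_image_of_mem P hx), map_sum]
  congr 1
  refine Finset.sum_congr rfl fun i _ => ?_
  rw [map_smul, h3]

/-- An element of finite rank that fixes the base point pointwise is in `negGroup`. -/
lemma mem_negGroup_of_fix (g : O K p I) (hfr : g ∈ Ofr K p I)
    (hg : ∀ i, g.1 (bvec (Sum.inl i)) = bvec (Sum.inl i)) : g ∈ negGroup K p I := by
  have hfin : Module.Finite Kᵐᵒᵖ (moved g.1) := hfr
  obtain ⟨s, hs⟩ := (Module.Finite.iff_fg (N := moved g.1)).1 hfin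
  have hmoved : ∀ w ∈ moved g.1, ∀ i, w (Sum.inl i) = 0 := by
    rintro _ ⟨x, rfl⟩
    rw [← form_inl_eq_zero_iff]
    intro i
    change form (bvec (Sum.inl i)) (g.1 x - x) = 0
    conv_lhs => rw [form_sub_right, ← hg i]
    rw [form_map, hg, sub_self]
  obtain ⟨γ, hγ, h1, h2⟩ := exists_negGroup_fix_neg g s fun w hw =>
    hmoved w (hs ▸ Submodule.subset_span hw)
  have h3 : γ * g = 1 := by
    refine O_ext fun x => ?_
    obtain ⟨w, hw, hwx⟩ := exists_orthogonal_component (moved g.1) hmoved x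
    have hgx := apply_eq_self_of_orthogonal_moved g _ hwx
    have e1 : (γ * g).1 w = w := apply_eq_self_of_mem_span h1 (by rwa [hs])
    have e2 : (γ * g).1 (x - w) = x - w := by
      rw [mul_apply', hgx]
      refine h2 _ fun z hz => ?_
      have hz' : form z (x - w) = 0 := hwx z (hs ▸ Submodule.subset_span hz)
      refine ⟨hz', ?_⟩
      conv_lhs => rw [← hgx]
      rw [form_map, hz']
    rw [← sub_add_cancel x w, map_add, e1, e2, one_apply']
  rw [← inv_eq_of_mul_eq_one_right h3]
  exact inv_mem hγ

/-- Modulo `pairGroup`, an element of `negGroup` is a single quasi-reflection. -/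
lemma exists_pairGroup_mul_qrefl {v : Hilb K p I} (hv : Q v < 0) {g : O K p I}
    (hg : g ∈ negGroup K p I) :
    ∃ n ∈ pairGroup K p I, ∃ (a : K) (ha : ‖a‖ = 1), g = n * qrefl v hv.ne a ha := by
  induction hg using Subgroup.closure_induction with
  | mem g hg =>
    obtain ⟨u, hu, a, ha, rfl⟩ := hg
    exact ⟨_, qrefl_mul_inv_mem_pairGroup hu hv ha, a, ha, by group⟩
  | one => exact ⟨1, one_mem _, 1, norm_one, by rw [qrefl_one, one_mul]⟩
  | mul g h _ _ ihg ihh =>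
    obtain ⟨n, hn, a, ha, rfl⟩ := ihg
    obtain ⟨m, hm, b, hb, rfl⟩ := ihh
    refine ⟨n * (qrefl v hv.ne a ha * m * (qrefl v hv.ne a ha)⁻¹),
      mul_mem hn (conj_mem_pairGroup _ hm), a * b, by simp [ha, hb], ?_⟩
    rw [← qrefl_mul_qrefl v hv.ne a b ha hb]
    group
  | inv g _ ih =>
    obtain ⟨n, hn, a, ha, rfl⟩ := ih
    refine ⟨(qrefl v hv.ne a ha)⁻¹ * n⁻¹ * ((qrefl v hv.ne a ha)⁻¹)⁻¹,
      conj_mem_pairGroup _ (inv_mem hn), a⁻¹, by simp [ha], ?_⟩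
    rw [← qrefl_inv v hv.ne a ha]
    group

/-- An element of `negGroup` can be corrected to an element of `pairGroup` by a quasi-reflection in
a vector that is orthogonal to given ones. -/
lemma exists_pairGroup_eqOn [Infinite I] {g : O K p I} (hg : g ∈ negGroup K p I)
    (s : Finset (Hilb K p I)) : ∃ n ∈ pairGroup K p I, ∀ x ∈ s, n.1 x = g.1 x := by
  obtain ⟨v, hv, hvs⟩ := exists_neg_unit_of_finite s.finite_toSet
  have hv0 := neg_of_eq_neg_one hv
  obtain ⟨n, hn, a, ha, rfl⟩ := exists_pairGroup_mul_qrefl hv0 hg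
  refine ⟨n, hn, fun x hx => ?_⟩
  rw [mul_apply', qrefl_apply_of_form_eq_zero _ _ _ _ (form_eq_zero_symm (hvs x hx))]

end Transitivity

/-! ### Finite rank perturbations of the identity are products of quasi-reflections -/

section Generation

variable {K : Type} [NormedDivisionRing K] [StarRing K] [InnerProductSpace ℝ K]
  [HermitianScalars K] {p : ℕ} {I : Type u}

/-- Over scalars with an imaginary unit, every element of the orthogonal group can be multiplied by
an element of `negGroup` to fix the base point pointwise. -/
lemma exists_negGroup_fix_of_imaginary [Infinite I] {q : K} (hq : ‖q‖ = 1) (hq0 : re q = 0)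
    (g : O K p I) : ∃ γ ∈ negGroup K p I, ∀ i : Fin p,
      (γ * g).1 (bvec (Sum.inl i)) = bvec (Sum.inl i) := by
  obtain ⟨γ, hγ, h⟩ := exists_negGroup_fix_bvec g p fun j _ =>
    ⟨MulOpposite.op q • bvec (Sum.inl j), by rw [Q_smul, Q_bvec, hq]; simp [sgn], by
      rw [form_smul_right, form_self, Q_bvec, smul_mul_assoc, one_mul, re_smul, hq0, mul_zero],
      fun i hi => by
        rw [form_smul_left, form_bvec, bvec_ne (by simpa using hi.ne'), smul_zero, mul_zero]⟩
  exact ⟨γ, hγ, fun i => h i i.2⟩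

lemma exists_pairGroup_eqOn_of_fix [Infinite I] {g : O K p I}
    (hg : ∃ γ ∈ negGroup K p I, ∀ i : Fin p, (γ * g).1 (bvec (Sum.inl i)) = bvec (Sum.inl i))
    (s : Finset (Hilb K p I)) : ∃ n ∈ pairGroup K p I, ∀ x ∈ s, n.1 x = g.1 x := by
  obtain ⟨γ, hγ, h⟩ := hg
  obtain ⟨δ, hδ, hδs⟩ := exists_negGroup_eqOn (γ * g) h s
  obtain ⟨n, hn, hns⟩ := exists_pairGroup_eqOn (mul_mem (inv_mem hγ) hδ) s
  refine ⟨n, hn, fun x hx => ?_⟩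
  rw [hns x hx, mul_apply', hδs x hx, mul_apply', inv_apply_self']

lemma mem_negGroup_of_exists_fix {g : O K p I} (hfr : g ∈ Ofr K p I)
    (hg : ∃ γ ∈ negGroup K p I, ∀ i : Fin p, (γ * g).1 (bvec (Sum.inl i)) = bvec (Sum.inl i)) :
    g ∈ negGroup K p I := by
  obtain ⟨γ, hγ, h⟩ := hg
  have h1 := mem_negGroup_of_fix (γ * g) (mul_mem (negGroup_le_Ofr hγ) hfr) h
  have h2 := mul_mem (inv_mem hγ) h1
  rwa [inv_mul_cancel_left] at h2

/-- If every unit scalar is a commutator of unit scalars, `pairGroup` is all of `negGroup`: the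
quasi-reflections in `v` and in `v c` have conjugate multipliers. -/
lemma negGroup_le_pairGroup [Infinite I]
    (hK : ∀ b : K, ‖b‖ = 1 → ∃ a c : K, ‖a‖ = 1 ∧ ‖c‖ = 1 ∧ b = a * (c * a⁻¹ * c⁻¹)) :
    negGroup K p I ≤ pairGroup K p I := by
  rw [negGroup, Subgroup.closure_le]
  rintro _ ⟨v, hv, b, hb, rfl⟩
  obtain ⟨a, c, ha, hc, hbac⟩ := hK b hb
  have hc0 := ne_zero_of_norm_eq_one hc
  have ha' : ‖a⁻¹‖ = 1 := by rw [norm_inv, ha, inv_one]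
  have hv' : Q (MulOpposite.op c • v) < 0 := by rwa [Q_smul, hc, one_pow, one_mul]
  have h := qrefl_mul_inv_mem_pairGroup hv hv' ha
  rw [qrefl_inv, qrefl_smul v hv.ne c hc0, qrefl_mul_qrefl] at h
  rw [qrefl_congr rfl hv.ne hbac hb]
  exact h

end Generation

section Commutative

variable {K : Type} [NormedField K] [StarRing K] [InnerProductSpace ℝ K]
  [HermitianScalars K] {p : ℕ} {I : Type u}

/-- The quasi-reflection is a homothety of ratio `a` on the line of `v`, which contains the range of
its difference with the identity. -/
lemma detFr_qrefl (v : Hilb K p I) (hv : Q v ≠ 0) (a : K) (ha : ‖a‖ = 1) :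
    detFr (qrefl v hv a ha).1 = a := by
  have := FiniteDimensional.span_of_finite Kᵐᵒᵖ (Set.finite_singleton v)
  rw [← det_restr _ _ (moved_qrefl_le v hv a ha)]
  have h : restr (qrefl v hv a ha).1 _ (moved_qrefl_le v hv a ha) =
      MulOpposite.op a • LinearMap.id := by
    refine LinearMap.ext fun x => Subtype.ext ?_
    obtain ⟨b, hb⟩ := Submodule.mem_span_singleton.1 x.2
    change (qrefl v hv a ha).1 x.1 = MulOpposite.op a • x.1
    rw [← hb, map_smul, qrefl_apply_self, smul_smul, smul_smul, mul_comm]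
  rw [h, LinearMap.det_smul, LinearMap.det_id, finrank_span_singleton (ne_zero_of_Q_ne_zero hv)]
  simp

lemma pairGroup_le_SOfr : pairGroup K p I ≤ SOfr K p I := by
  rw [pairGroup, Subgroup.closure_le]
  rintro _ ⟨u, hu, w, hw, a, ha, rfl⟩
  have ha0 := ne_zero_of_norm_eq_one ha
  have h1 : Module.Finite Kᵐᵒᵖ (moved (qrefl u hu.ne a ha).1) := qrefl_mem_Ofr u hu.ne a ha
  have ha' : ‖a⁻¹‖ = 1 := by rw [norm_inv, ha, inv_one]
  have h2 : Module.Finite Kᵐᵒᵖ (moved (qrefl w hw.ne a⁻¹ ha').1) := qrefl_mem_Ofr w hw.ne a⁻¹ ha'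
  refine ⟨mul_mem (qrefl_mem_Ofr u hu.ne a ha) (inv_mem (qrefl_mem_Ofr w hw.ne a ha)), ?_⟩
  rw [qrefl_inv]
  change detFr ((qrefl u hu.ne a ha).1 * (qrefl w hw.ne a⁻¹ ha').1) = 1
  rw [detFr_mul, detFr_qrefl, detFr_qrefl, mul_inv_cancel₀ ha0]

/-- The determinant detects the remaining quasi-reflection modulo `pairGroup`. -/
lemma mem_pairGroup_of_mem_SOfr [Infinite I] {g : O K p I} (hg : g ∈ negGroup K p I)
    (hdet : g ∈ SOfr K p I) : g ∈ pairGroup K p I := by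
  obtain ⟨v, hv, -⟩ := exists_neg_unit_of_finite (Set.finite_empty (α := Hilb K p I))
  have hv0 := neg_of_eq_neg_one hv
  obtain ⟨n, hn, a, ha, rfl⟩ := exists_pairGroup_mul_qrefl hv0 hg
  have h1 := mul_mem (inv_mem (pairGroup_le_SOfr hn)) hdet
  rw [inv_mul_cancel_left] at h1
  have h2 : a = 1 := (detFr_qrefl v hv0.ne a ha).symm.trans h1.2
  subst h2
  rw [qrefl_one, mul_one]
  exact hn

end Commutative

section RealCase

variable {p : ℕ} {I : Type u}

/-- The compression of a reflection in a negative vector is a rank one perturbation of the identity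
whose determinant is at least `1`. -/
lemma qrefl_mem_OOrtho {v : Hilb ℝ p I} (hv : Q v < 0) (a : ℝ) (ha : ‖a‖ = 1) :
    qrefl v hv.ne a ha ∈ OOrtho p I := by
  have h : compression (qrefl v hv.ne a ha).1 =
      1 + Matrix.vecMulVec (fun i => v (Sum.inl i))
        (fun j => (a - 1) * (Q v)⁻¹ * v (Sum.inl j)) := by
    ext i j
    have h1 : form v (posVec j) = v (Sum.inl j) := by
      have h2 : form (posVec j) v = v (Sum.inl j) := by
        rw [show posVec j = bvec (Sum.inl j) from rfl, form_bvec]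
        simp [sgn]
      rw [← form_star, h2]
      rfl
    change (qrefl v hv.ne a ha).1 (posVec j) (Sum.inl i) = _
    rw [qrefl_apply, coord_add, posVec_inl, h1]
    change _ + v (Sum.inl i) * ((a - 1) * ((Q v)⁻¹ * v (Sum.inl j))) = _
    rw [Matrix.add_apply, Matrix.one_apply, Matrix.vecMulVec_apply]
    ring
  have hdet : 0 < (compression (qrefl v hv.ne a ha).1).det := by
    rw [h, Matrix.vecMulVec_eq Unit, Matrix.det_one_add_replicateCol_mul_replicateRow]
    have h1 : (fun j => (a - 1) * (Q v)⁻¹ * v (Sum.inl j)) ⬝ᵥ (fun i : Fin p => v (Sum.inl i)) =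
        (1 - a) * (-(Q v)⁻¹) * ∑ i : Fin p, v (Sum.inl i) ^ 2 := by
      rw [dotProduct, Finset.mul_sum]
      refine Finset.sum_congr rfl fun i _ => ?_
      ring
    rw [h1]
    have h2 : 0 ≤ 1 - a := by
      have := le_abs_self a
      rw [Real.norm_eq_abs] at ha
      linarith
    have h3 : 0 < -(Q v)⁻¹ := neg_pos.2 (inv_lt_zero.2 hv)
    positivity
  exact sign_pos hdet

lemma negGroup_le_OOrtho : negGroup ℝ p I ≤ OOrtho p I := by
  rw [negGroup, Subgroup.closure_le]
  rintro _ ⟨v, hv, a, ha, rfl⟩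
  exact qrefl_mem_OOrtho hv a ha

lemma det_compression_pos {g : O ℝ p I} (hg : g ∈ OOrtho p I) : 0 < (compression g.1).det :=
  sign_eq_one_iff.1 hg

/-- Over the reals, the last positive basis vector serves as an intermediate vector for the other
ones; it is itself moved back to its place because the orientation is preserved. -/
lemma exists_negGroup_fix_of_mem_OOrtho [Infinite I] (hp : 1 ≤ p) {g : O ℝ p I}
    (hg : g ∈ OOrtho p I) : ∃ γ ∈ negGroup ℝ p I, ∀ i : Fin p,
      (γ * g).1 (bvec (Sum.inl i)) = bvec (Sum.inl i) := by
  obtain ⟨m, rfl⟩ : ∃ m, p = m + 1 := ⟨p - 1, by omega⟩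
  have horth : ∀ i j : Fin (m + 1), i ≠ j →
      form (bvec (Sum.inl i) : Hilb ℝ (m + 1) I) (bvec (Sum.inl j)) = 0 := by
    intro i j hij
    rw [form_bvec, bvec_ne (by simpa using hij), smul_zero]
  obtain ⟨γ, hγ, h⟩ := exists_negGroup_fix_bvec g m fun j hj => by
    refine ⟨bvec (Sum.inl (Fin.last m)), Q_bvec _, ?_, fun i hi => ?_⟩
    · rw [horth, re_zero]
      rintro rfl
      simp at hj
    · refine horth _ _ ?_
      rintro rfl
      exact absurd (Fin.le_last j) (not_le.2 hi)
  set k := γ * g with hk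
  set e : Hilb ℝ (m + 1) I := bvec (Sum.inl (Fin.last m)) with he
  have hkO : k ∈ OOrtho (m + 1) I := mul_mem (negGroup_le_OOrtho hγ) hg
  have hdet : (compression k.1).det = (k.1 e) (Sum.inl (Fin.last m)) := by
    rw [Matrix.det_of_isUpperTriangular, Finset.prod_eq_single (Fin.last m)]
    · rfl
    · intro i _ hi
      change k.1 (bvec (Sum.inl i)) (Sum.inl i) = 1
      rw [h i (Fin.val_lt_last hi), bvec_self]
    · simp
    · intro i j hij
      change k.1 (bvec (Sum.inl j)) (Sum.inl i) = 0
      rw [h j (lt_of_lt_of_le hij (Nat.lt_succ_iff.1 i.2)), bvec_ne]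
      simpa using hij.ne'
  have hpos := det_compression_pos hkO
  have hform : re (form (k.1 e) e) = (k.1 e) (Sum.inl (Fin.last m)) := by
    rw [re_form_comm, he, form_bvec]
    simp [re, sgn]
  have hQ : Q e = 1 := Q_bvec _
  have hs : (Set.range fun i : Fin (m + 1) => (bvec (Sum.inl i) : Hilb ℝ (m + 1) I)).Finite :=
    Set.finite_range _
  obtain ⟨δ, hδ, hδ1, hδ2⟩ := exists_negGroup_map_pos (x := k.1 e) (y := e)
    (by rw [k.2, hQ]) hQ (by rw [hform, ← hdet]; linarith) hs
  refine ⟨δ * γ, mul_mem hδ hγ, fun i => ?_⟩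
  rw [mul_assoc, mul_apply', ← hk]
  by_cases hi : i = Fin.last m
  · rw [hi]
    exact hδ1
  · have hki := h i (Fin.val_lt_last hi)
    have h0 := horth _ _ (Ne.symm hi)
    rw [hki]
    refine hδ2 _ ⟨i, rfl⟩ ?_ h0
    conv_lhs => rw [← hki]
    rw [form_map, he, h0]

lemma pairGroup_eq_real [Infinite I] (hp : 1 ≤ p) : SOfr ℝ p I ⊓ OOrtho p I = pairGroup ℝ p I := by
  refine le_antisymm (fun g hg => ?_)
    (le_inf pairGroup_le_SOfr (pairGroup_le_negGroup.trans negGroup_le_OOrtho))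
  exact mem_pairGroup_of_mem_SOfr
    (mem_negGroup_of_exists_fix hg.1.1 (exists_negGroup_fix_of_mem_OOrtho hp hg.2)) hg.1

end RealCase

section ComplexQuaternionCase

variable {p : ℕ} {I : Type u}

lemma exists_negGroup_fix_complex [Infinite I] (g : O ℂ p I) :
    ∃ γ ∈ negGroup ℂ p I, ∀ i : Fin p, (γ * g).1 (bvec (Sum.inl i)) = bvec (Sum.inl i) :=
  exists_negGroup_fix_of_imaginary (q := Complex.I) (by simp) (by simp [re]) g

lemma pairGroup_eq_complex [Infinite I] : SOfr ℂ p I = pairGroup ℂ p I :=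
  le_antisymm (fun g hg => mem_pairGroup_of_mem_SOfr
    (mem_negGroup_of_exists_fix hg.1 (exists_negGroup_fix_complex g)) hg) pairGroup_le_SOfr

lemma quaternion_norm_sq (a : ℍ[ℝ]) :
    ‖a‖ ^ 2 = a.re ^ 2 + a.imI ^ 2 + a.imJ ^ 2 + a.imK ^ 2 := by
  rw [pow_two, ← Quaternion.normSq_eq_norm_mul_self, Quaternion.normSq_def']

lemma exists_quaternion (x y z w : ℝ) :
    ∃ q : ℍ[ℝ], q.re = x ∧ q.imI = y ∧ q.imJ = z ∧ q.imK = w :=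
  ⟨⟨x, y, z, w⟩, rfl, rfl, rfl, rfl⟩

lemma exists_negGroup_fix_quaternion [Infinite I] (g : O ℍ[ℝ] p I) :
    ∃ γ ∈ negGroup ℍ[ℝ] p I, ∀ i : Fin p, (γ * g).1 (bvec (Sum.inl i)) = bvec (Sum.inl i) := by
  obtain ⟨q, hr, hi, hj, hk⟩ := exists_quaternion 0 1 0 0
  refine exists_negGroup_fix_of_imaginary (q := q) ?_ ?_ g
  · rw [← sq_eq_sq₀ (norm_nonneg _) zero_le_one, quaternion_norm_sq, hr, hi, hj, hk]
    norm_num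
  · rw [re, Quaternion.inner_def]
    simp [hr]

/-- A unit quaternion has a square root of norm one. -/
lemma exists_unit_quaternion_sq (b : ℍ[ℝ]) (hb : ‖b‖ = 1) : ∃ a : ℍ[ℝ], ‖a‖ = 1 ∧ b = a * a := by
  have hb2 := quaternion_norm_sq b
  rw [hb, one_pow] at hb2
  by_cases h : b.re = -1
  · have h1 : b.imI ^ 2 + b.imJ ^ 2 + b.imK ^ 2 = 0 := by
      rw [h] at hb2
      linarith
    have hI : b.imI = 0 := by nlinarith [sq_nonneg b.imI, sq_nonneg b.imJ, sq_nonneg b.imK]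
    have hJ : b.imJ = 0 := by nlinarith [sq_nonneg b.imI, sq_nonneg b.imJ, sq_nonneg b.imK]
    have hK : b.imK = 0 := by nlinarith [sq_nonneg b.imI, sq_nonneg b.imJ, sq_nonneg b.imK]
    obtain ⟨q, hr, hi, hj, hk⟩ := exists_quaternion 0 1 0 0
    refine ⟨q, ?_, ?_⟩
    · rw [← sq_eq_sq₀ (norm_nonneg _) zero_le_one, quaternion_norm_sq, hr, hi, hj, hk]
      norm_num
    · ext <;> simp [h, hI, hJ, hK, hr, hi, hj, hk]
  · have hre : -1 < b.re := by
      refine lt_of_le_of_ne ?_ (Ne.symm h)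
      nlinarith [sq_nonneg b.imI, sq_nonneg b.imJ, sq_nonneg b.imK]
    have hs : 0 < 2 + 2 * b.re := by linarith
    have hn : ‖1 + b‖ ^ 2 = 2 + 2 * b.re := by
      rw [quaternion_norm_sq]
      simp
      linarith
    have hn0 : ‖1 + b‖ ≠ 0 := fun h0 => by
      rw [h0] at hn
      norm_num at hn
      linarith
    have hsq : (1 + b) * (1 + b) = (2 + 2 * b.re) • b := by
      ext <;> simp <;> linarith
    refine ⟨‖1 + b‖⁻¹ • (1 + b), ?_, ?_⟩
    · rw [norm_smul, norm_inv, norm_norm, inv_mul_cancel₀ hn0]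
    · rw [smul_mul_smul_comm, hsq, smul_smul, ← hn]
      have : ‖1 + b‖⁻¹ * ‖1 + b‖⁻¹ * ‖1 + b‖ ^ 2 = 1 := by field_simp
      rw [this, one_smul]

/-- Every unit quaternion is conjugate to its inverse. -/
lemma exists_unit_quaternion_conj_inv (a : ℍ[ℝ]) (ha : ‖a‖ = 1) :
    ∃ c : ℍ[ℝ], ‖c‖ = 1 ∧ c * a⁻¹ * c⁻¹ = a := by
  have hinv : a⁻¹ = star a := by
    have h := star_mul_self_eq a
    rw [ha, one_pow, one_smul] at h
    exact (eq_inv_of_mul_eq_one_left h).symm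
  -- a non-zero imaginary quaternion orthogonal to the imaginary part of `a`
  obtain ⟨c, hc, h⟩ : ∃ c : ℍ[ℝ], c ≠ 0 ∧ c * star a = a * c := by
    by_cases h0 : a.imI = 0 ∧ a.imJ = 0
    · obtain ⟨q, hr, hi, hj, hk⟩ := exists_quaternion 0 1 0 0
      refine ⟨q, fun h => ?_, ?_⟩
      · rw [h] at hi
        simp at hi
      · ext <;> simp [h0.1, h0.2, hr, hi, hj, hk]
    · obtain ⟨q, hr, hi, hj, hk⟩ := exists_quaternion 0 (-a.imJ) a.imI 0
      refine ⟨q, fun h => h0 ⟨?_, ?_⟩, ?_⟩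
      · rw [h] at hj
        simpa using hj.symm
      · rw [h] at hi
        simpa using hi
      · ext <;> simp [hr, hi, hj, hk] <;> ring
  have hc0 : ‖c‖ ≠ 0 := norm_ne_zero_iff.2 hc
  have hn : ‖‖c‖⁻¹ • c‖ = 1 := by rw [norm_smul, norm_inv, norm_norm, inv_mul_cancel₀ hc0]
  refine ⟨‖c‖⁻¹ • c, hn, ?_⟩
  rw [mul_inv_eq_iff_eq_mul₀ (ne_zero_of_norm_eq_one hn), hinv, smul_mul_assoc, h, mul_smul_comm]

lemma pairGroup_eq_quaternion [Infinite I] : Ofr ℍ[ℝ] p I = pairGroup ℍ[ℝ] p I := by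
  refine le_antisymm (fun g hg => ?_) (pairGroup_le_negGroup.trans negGroup_le_Ofr)
  refine negGroup_le_pairGroup (fun b hb => ?_)
    (mem_negGroup_of_exists_fix hg (exists_negGroup_fix_quaternion g))
  obtain ⟨a, ha, hba⟩ := exists_unit_quaternion_sq b hb
  obtain ⟨c, hc, hca⟩ := exists_unit_quaternion_conj_inv a ha
  exact ⟨a, c, ha, hc, by rw [hca, hba]⟩

end ComplexQuaternionCase

/-! ### The distance of projections and the topological group structure -/

section Projections

variable {K : Type} [NormedDivisionRing K] [StarRing K] [InnerProductSpace ℝ K]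
  [HermitianScalars K] {p : ℕ} {I : Type u}

lemma proj_mem (V : X K p I) (x : Hilb K p I) : proj V x ∈ V.1 :=
  haveI := finiteDimensional_restrictScalars V
  (V.1.restrictScalars ℝ).starProjection_apply_mem x

lemma inner_sub_proj (V : X K p I) (x : Hilb K p I) {v : Hilb K p I} (hv : v ∈ V.1) :
    inner ℝ v (x - proj V x) = 0 :=
  haveI := finiteDimensional_restrictScalars V
  (Submodule.mem_orthogonal _ _).1 ((V.1.restrictScalars ℝ).sub_starProjection_mem_orthogonal x) v hv

lemma proj_eq_self {V : X K p I} {x : Hilb K p I} (hx : x ∈ V.1) : proj V x = x :=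
  haveI := finiteDimensional_restrictScalars V
  (V.1.restrictScalars ℝ).starProjection_eq_self_iff.2 hx

lemma norm_sub_proj_le (V : X K p I) (x : Hilb K p I) {v : Hilb K p I} (hv : v ∈ V.1) :
    ‖x - proj V x‖ ≤ ‖x - v‖ := by
  have h := inner_sub_proj V x (V.1.sub_mem (proj_mem V x) hv)
  have h1 : x - v = (proj V x - v) + (x - proj V x) := by abel
  have h2 := norm_add_sq_eq_norm_sq_add_norm_sq_real h
  rw [← h1] at h2
  nlinarith [norm_nonneg (x - proj V x), norm_nonneg (x - v), norm_nonneg (proj V x - v)]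

lemma norm_sq_eq_proj (V : X K p I) (x : Hilb K p I) :
    ‖x‖ ^ 2 = ‖proj V x‖ ^ 2 + ‖x - proj V x‖ ^ 2 := by
  have h2 := norm_add_sq_eq_norm_sq_add_norm_sq_real (inner_sub_proj V x (proj_mem V x))
  rw [add_sub_cancel] at h2
  linarith

lemma norm_proj_le (V : X K p I) (x : Hilb K p I) : ‖proj V x‖ ≤ ‖x‖ := by
  have := norm_sq_eq_proj V x
  nlinarith [norm_nonneg (proj V x), norm_nonneg x, sq_nonneg ‖x - proj V x‖]

lemma proj_injective : Function.Injective (proj : X K p I → Hilb K p I →L[ℝ] Hilb K p I) := by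
  intro V W h
  refine Subtype.ext (le_antisymm (fun x hx => ?_) (fun x hx => ?_))
  · rw [← proj_eq_self hx, h]
    exact proj_mem W x
  · rw [← proj_eq_self hx, ← h]
    exact proj_mem V x

lemma isInducing_proj :
    Topology.IsInducing (proj : X K p I → Hilb K p I →L[ℝ] Hilb K p I) := ⟨rfl⟩

/-- The distance between two points of the symmetric space: the operator norm distance of the
orthogonal projections. -/
def projDist (V W : X K p I) : ℝ := ‖proj V - proj W‖

lemma projDist_comm (V W : X K p I) : projDist V W = projDist W V :=
  norm_sub_rev (proj V) (proj W)

lemma projDist_nonneg (V W : X K p I) : 0 ≤ projDist V W := norm_nonneg (proj V - proj W)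

lemma projDist_triangle (V W U : X K p I) : projDist V U ≤ projDist V W + projDist W U :=
  norm_sub_le_norm_sub_add_norm_sub (proj V) (proj W) (proj U)

lemma norm_sub_proj_le_projDist {V W : X K p I} {v : Hilb K p I} (hv : v ∈ V.1) :
    ‖v - proj W v‖ ≤ projDist V W * ‖v‖ := by
  conv_lhs => rw [← proj_eq_self hv]
  rw [proj_eq_self hv]
  have h := (proj V - proj W).le_opNorm v
  rwa [sub_apply, proj_eq_self hv] at h

/-- The norm distance of two projections is controlled by how far each subspace is from the other
one: split `x` by the projection to `V` and use that the projections are symmetric. -/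
lemma projDist_le {V W : X K p I} {δ : ℝ} (hδ : 0 ≤ δ)
    (h1 : ∀ x ∈ V.1, ‖x - proj W x‖ ≤ δ * ‖x‖) (h2 : ∀ x ∈ W.1, ‖x - proj V x‖ ≤ δ * ‖x‖) :
    projDist V W ≤ 2 * δ := by
  refine ContinuousLinearMap.opNorm_le_bound _ (by positivity) fun x => ?_
  have he : (proj V - proj W) x = (proj V x - proj W (proj V x)) - proj W (x - proj V x) := by
    rw [sub_apply, map_sub]
    abel
  have h3 : ‖proj V x - proj W (proj V x)‖ ≤ δ * ‖x‖ :=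
    (h1 _ (proj_mem V x)).trans (mul_le_mul_of_nonneg_left (norm_proj_le V x) hδ)
  have h4 : ‖proj W (x - proj V x)‖ ≤ δ * ‖x‖ := by
    set y := proj W (x - proj V x) with hy
    have hyW : y ∈ W.1 := proj_mem W _
    -- `|y|²` is the scalar product of `y` minus its projection to `V` with `x`
    have e1 : ‖y‖ ^ 2 = inner ℝ (y - proj V y) x := by
      have e2 := inner_sub_proj W (x - proj V x) hyW
      rw [← hy, inner_sub_right, real_inner_self_eq_norm_sq, sub_eq_zero] at e2
      have e3 := inner_sub_proj V x (proj_mem V y)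
      have e4 := inner_sub_proj V y (proj_mem V x)
      rw [real_inner_comm] at e4
      rw [← e2, inner_sub_left, inner_sub_right]
      rw [inner_sub_right] at e3
      rw [inner_sub_left] at e4
      linarith
    have e5 : ‖y‖ ^ 2 ≤ δ * ‖y‖ * ‖x‖ := by
      rw [e1]
      exact (real_inner_le_norm _ _).trans
        (mul_le_mul_of_nonneg_right (h2 y hyW) (norm_nonneg x))
    by_cases h0 : ‖y‖ = 0
    · rw [h0]
      positivity
    · have : 0 < ‖y‖ := lt_of_le_of_ne (norm_nonneg y) (Ne.symm h0)
      refine le_of_mul_le_mul_left ?_ this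
      linarith
  rw [he]
  refine (norm_sub_le _ _).trans ?_
  linarith

lemma apply_mem_smul (g : O K p I) {V : X K p I} {x : Hilb K p I} (hx : x ∈ V.1) :
    g.1 x ∈ (g • V).1 := ⟨x, hx, rfl⟩

/-- The bound `C` holds for the norms of `g` and of its inverse. -/
def BddBy (C : ℝ) (g : O K p I) : Prop :=
  ∀ x, ‖g.1 x‖ ≤ C * ‖x‖ ∧ ‖(g⁻¹).1 x‖ ≤ C * ‖x‖

lemma BddBy.inv {C : ℝ} {g : O K p I} (h : BddBy C g) : BddBy C g⁻¹ := fun x =>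
  ⟨(h x).2, by rw [inv_inv]; exact (h x).1⟩

lemma map_real_smul (g : O K p I) (t : ℝ) (x : Hilb K p I) : g.1 (t • x) = t • g.1 x := by
  rw [← op_real_smul, map_smul, op_real_smul]

lemma exists_norm_le (g : O K p I) : ∃ C, 1 ≤ C ∧ ∀ x, ‖g.1 x‖ ≤ C * ‖x‖ := by
  let f : Hilb K p I →L[ℝ] Hilb K p I :=
    { toFun := g.1
      map_add' := map_add g.1
      map_smul' := map_real_smul g
      cont := g.1.continuous }
  refine ⟨max 1 ‖f‖, le_max_left _ _, fun x => (f.le_opNorm x).trans ?_⟩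
  gcongr
  exact le_max_right _ _

lemma exists_bddBy (g : O K p I) : ∃ C, 1 ≤ C ∧ BddBy C g := by
  obtain ⟨C, hC1, hC⟩ := exists_norm_le g
  obtain ⟨D, hD1, hD⟩ := exists_norm_le g⁻¹
  refine ⟨max C D, hC1.trans (le_max_left _ _), fun x => ⟨(hC x).trans ?_, (hD x).trans ?_⟩⟩
  · gcongr
    exact le_max_left _ _
  · gcongr
    exact le_max_right _ _

/-- Elements of the orthogonal group act on the symmetric space by Lipschitz maps, with a constant
that depends only on a bound on their norm. This makes the topology of pointwise convergence a group
topology. -/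
lemma projDist_smul_le {C : ℝ} (hC : 0 ≤ C) {g : O K p I} (hg : BddBy C g) (V W : X K p I) :
    projDist (g • V) (g • W) ≤ 2 * C ^ 2 * projDist V W := by
  have key : ∀ V W : X K p I, ∀ x ∈ (g • V).1,
      ‖x - proj (g • W) x‖ ≤ C ^ 2 * projDist V W * ‖x‖ := by
    rintro V W _ ⟨v, hv, rfl⟩
    change ‖g.1 v - proj (g • W) (g.1 v)‖ ≤ C ^ 2 * projDist V W * ‖g.1 v‖
    calc ‖g.1 v - proj (g • W) (g.1 v)‖ ≤ ‖g.1 v - g.1 (proj W v)‖ :=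
          norm_sub_proj_le _ _ (apply_mem_smul g (proj_mem W v))
      _ = ‖g.1 (v - proj W v)‖ := by rw [map_sub]
      _ ≤ C * ‖v - proj W v‖ := (hg _).1
      _ ≤ C * (projDist V W * ‖v‖) := by
        gcongr
        exact norm_sub_proj_le_projDist hv
      _ ≤ C * (projDist V W * (C * ‖g.1 v‖)) := by
        have := (hg (g.1 v)).2
        rw [inv_apply_self'] at this
        have := projDist_nonneg V W
        gcongr
      _ = C ^ 2 * projDist V W * ‖g.1 v‖ := by ring
  have h := projDist_le (V := g • V) (W := g • W) (δ := C ^ 2 * projDist V W)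
    (mul_nonneg (sq_nonneg C) (projDist_nonneg V W)) (key V W) (by
      rw [projDist_comm]
      exact key W V)
  linarith

end Projections

section BasePoint

variable {K : Type} [NormedDivisionRing K] [StarRing K] [InnerProductSpace ℝ K]
  [HermitianScalars K] {p : ℕ} {I : Type u}

variable (K p I) in
/-- The span of the first `p` basis vectors. -/
def baseSpan : Submodule Kᵐᵒᵖ (Hilb K p I) :=
  Submodule.span Kᵐᵒᵖ (Set.range fun i : Fin p => (bvec (Sum.inl i) : Hilb K p I))

lemma bvec_mem_baseSpan (i : Fin p) : (bvec (Sum.inl i) : Hilb K p I) ∈ baseSpan K p I :=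
  Submodule.subset_span ⟨i, rfl⟩

lemma flip_eq_self_of_mem_baseSpan {x : Hilb K p I} (hx : x ∈ baseSpan K p I) : flip x = x := by
  induction hx using Submodule.span_induction with
  | mem x hx =>
    obtain ⟨i, rfl⟩ := hx
    exact flip_bvec_inl i
  | zero =>
    ext i
    exact smul_zero _
  | add x y _ _ hx hy =>
    ext i
    change sgn i • (x i + y i) = x i + y i
    rw [smul_add]
    exact congrArg₂ (· + ·) (congrArg (fun f : Hilb K p I => f i) hx)
      (congrArg (fun f : Hilb K p I => f i) hy)
  | smul a x _ hx =>
    ext i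
    change sgn i • (a • x i) = a • x i
    rw [smul_comm]
    exact congrArg (fun f : Hilb K p I => a • f i) hx

lemma Q_eq_norm_sq_of_mem_baseSpan {x : Hilb K p I} (hx : x ∈ baseSpan K p I) :
    Q x = ‖x‖ ^ 2 := by
  rw [← re_form_self, re_form_eq_inner, flip_eq_self_of_mem_baseSpan hx, real_inner_self_eq_norm_sq]

lemma linearIndependent_bvec_inl :
    LinearIndependent Kᵐᵒᵖ fun i : Fin p => (bvec (Sum.inl i) : Hilb K p I) := by
  rw [Fintype.linearIndependent_iff]
  intro c hc j
  let φ : Hilb K p I →+ K := AddMonoidHom.mk' (form (bvec (Sum.inl j))) (form_add_right _)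
  have h := congrArg φ hc
  rw [map_sum, map_zero, Finset.sum_eq_single j] at h
  · simp only [φ, AddMonoidHom.mk'_apply] at h
    rw [← MulOpposite.op_unop (c j), form_smul_right, form_bvec, bvec_self] at h
    simpa [sgn] using h
  · intro i _ hi
    simp only [φ, AddMonoidHom.mk'_apply]
    rw [← MulOpposite.op_unop (c i), form_smul_right, form_bvec, bvec_ne (by simpa using hi.symm),
      smul_zero, zero_mul]
  · simp

variable (K p I) in
/-- The base point of the symmetric space. -/
def basePt : X K p I :=
  ⟨baseSpan K p I, FiniteDimensional.span_of_finite Kᵐᵒᵖ (Set.finite_range _),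
    (finrank_span_eq_card linearIndependent_bvec_inl).trans (Fintype.card_fin p), by
    intro x hx h0
    rw [Q_eq_norm_sq_of_mem_baseSpan hx]
    have := norm_pos_iff.2 h0
    positivity⟩

lemma sub_proj_basePt_inl (x : Hilb K p I) (i : Fin p) :
    (x - proj (basePt K p I) x) (Sum.inl i) = 0 := by
  refine form_inl_eq_zero_iff.1 (fun i => ?_) i
  refine form_eq_zero_of_re (baseSpan K p I) _ (fun v hv => ?_) _ (bvec_mem_baseSpan i)
  rw [re_form_eq_inner, flip_eq_self_of_mem_baseSpan hv]
  exact inner_sub_proj (basePt K p I) x hv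

/-- The quadratic form in terms of the projection to the base point. -/
lemma Q_eq_basePt (x : Hilb K p I) : Q x = 2 * ‖proj (basePt K p I) x‖ ^ 2 - ‖x‖ ^ 2 := by
  have hm : proj (basePt K p I) x ∈ baseSpan K p I := proj_mem (basePt K p I) x
  have h : Q (proj (basePt K p I) x + (x - proj (basePt K p I) x)) =
      ‖proj (basePt K p I) x‖ ^ 2 - ‖x - proj (basePt K p I) x‖ ^ 2 := by
    rw [Q_add, Q_eq_norm_sq_of_mem_baseSpan hm, Q_eq_neg_norm_sq (sub_proj_basePt_inl x),
      re_form_eq_inner, flip_eq_self_of_mem_baseSpan hm, inner_sub_proj _ _ (proj_mem _ x)]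
    ring
  rw [add_sub_cancel] at h
  rw [h, norm_sq_eq_proj (basePt K p I) x]
  ring

lemma abs_Q_le (x : Hilb K p I) : |Q x| ≤ ‖x‖ ^ 2 := by
  rw [← re_form_self, pow_two]
  exact (abs_re_le _).trans (norm_form_le x x)

/-- A bound on the first `p` basis vectors controls an element of the orthogonal group and its
inverse: the projection of `h⁻¹ x` to the base point is computed from the form by `h`, and it
determines `‖h⁻¹ x‖` because `Q` is preserved. -/
lemma bddBy_of_baseSpan {h : O K p I} {B : ℝ} (hB : 0 ≤ B)
    (h1 : ∀ e ∈ baseSpan K p I, ‖h.1 e‖ ^ 2 ≤ B * ‖e‖ ^ 2) : BddBy (1 + 2 * B) h := by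
  have h2 : ∀ x, ‖(h⁻¹).1 x‖ ≤ (1 + 2 * B) * ‖x‖ := by
    intro x
    set a := proj (basePt K p I) ((h⁻¹).1 x) with ha
    have ham : a ∈ baseSpan K p I := proj_mem (basePt K p I) _
    have e1 : ‖a‖ ^ 2 = re (form (h.1 a) x) := by
      have := inner_sub_proj (basePt K p I) ((h⁻¹).1 x) ham
      rw [← ha, inner_sub_right, real_inner_self_eq_norm_sq, sub_eq_zero] at this
      rw [← this, form_map_left, re_form_eq_inner, flip_eq_self_of_mem_baseSpan ham]
    have e2 : ‖a‖ ^ 2 ≤ ‖h.1 a‖ * ‖x‖ := by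
      rw [e1]
      exact (le_abs_self _).trans ((abs_re_le _).trans (norm_form_le _ _))
    have e3 := h1 a ham
    have e4 : ‖a‖ ^ 2 ≤ B * ‖x‖ ^ 2 := by
      by_cases h0 : ‖a‖ = 0
      · rw [h0, zero_pow two_ne_zero]
        positivity
      · have h0' : 0 < ‖a‖ ^ 2 := pow_pos (lt_of_le_of_ne (norm_nonneg a) (Ne.symm h0)) 2
        have e5 : ‖a‖ ^ 2 * ‖a‖ ^ 2 ≤ ‖a‖ ^ 2 * (B * ‖x‖ ^ 2) := by
          calc ‖a‖ ^ 2 * ‖a‖ ^ 2 ≤ (‖h.1 a‖ * ‖x‖) * (‖h.1 a‖ * ‖x‖) := by gcongr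
            _ = ‖h.1 a‖ ^ 2 * ‖x‖ ^ 2 := by ring
            _ ≤ B * ‖a‖ ^ 2 * ‖x‖ ^ 2 := by gcongr
            _ = ‖a‖ ^ 2 * (B * ‖x‖ ^ 2) := by ring
        exact le_of_mul_le_mul_left e5 h0'
    have e6 := Q_eq_basePt ((h⁻¹).1 x)
    rw [← ha, (h⁻¹).2] at e6
    have e7 := neg_le_of_abs_le (abs_Q_le x)
    have e8 : 0 ≤ (1 + 2 * B) * ‖x‖ := by positivity
    refine (pow_le_pow_iff_left₀ (norm_nonneg _) e8 two_ne_zero).1 ?_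
    have e9 : (1 + 2 * B) * ‖x‖ ^ 2 ≤ ((1 + 2 * B) * ‖x‖) ^ 2 := by
      rw [mul_pow]
      gcongr
      nlinarith
    linarith
  refine fun x => ⟨?_, h2 x⟩
  have e1 : ‖h.1 x‖ ^ 2 ≤ (1 + 2 * B) * ‖h.1 x‖ * ‖x‖ := by
    rw [← real_inner_self_eq_norm_sq, inner_eq_re_form, re_form_comm, form_map_left]
    refine (le_abs_self _).trans ((abs_re_le _).trans ((norm_form_le _ _).trans ?_))
    have h3 := h2 (flip (h.1 x))
    rw [norm_flip] at h3
    rw [mul_comm]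
    gcongr
  by_cases h0 : ‖h.1 x‖ = 0
  · rw [h0]
    positivity
  · have : 0 < ‖h.1 x‖ := lt_of_le_of_ne (norm_nonneg _) (Ne.symm h0)
    refine le_of_mul_le_mul_left ?_ this
    linarith

/-- An element of the orthogonal group that does not move the base point far has bounded norm. -/
lemma bddBy_five {h : O K p I} (hh : projDist (h • basePt K p I) (basePt K p I) ≤ 1 / 2) :
    BddBy 5 h := by
  have h1 : BddBy (1 + 2 * 2) h := bddBy_of_baseSpan (by norm_num) fun e he => by
    have hmem : h.1 e ∈ (h • basePt K p I).1 := apply_mem_smul h (V := basePt K p I) he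
    have e1 := norm_sub_proj_le_projDist (W := basePt K p I) hmem
    have e2 : ‖h.1 e - proj (basePt K p I) (h.1 e)‖ ≤ 1 / 2 * ‖h.1 e‖ :=
      e1.trans (mul_le_mul_of_nonneg_right hh (norm_nonneg _))
    have e3 := norm_sq_eq_proj (basePt K p I) (h.1 e)
    have e4 := Q_eq_basePt (h.1 e)
    rw [h.2, Q_eq_norm_sq_of_mem_baseSpan he] at e4
    nlinarith [norm_nonneg (h.1 e), norm_nonneg (h.1 e - proj (basePt K p I) (h.1 e))]
  norm_num at h1
  exact h1

lemma bddBy_of_projDist_le {g h : O K p I} {C : ℝ} (hC : 1 ≤ C) (hg : BddBy C g)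
    (hh : projDist (h • basePt K p I) (g • basePt K p I) ≤ 1 / (4 * C ^ 2)) : BddBy (5 * C) h := by
  have hC0 : 0 ≤ C := by linarith
  have h1 := projDist_smul_le hC0 hg.inv (h • basePt K p I) (g • basePt K p I)
  rw [inv_smul_smul, ← mul_smul] at h1
  have h2 : BddBy 5 (g⁻¹ * h) := by
    refine bddBy_five (h1.trans ?_)
    calc 2 * C ^ 2 * projDist (h • basePt K p I) (g • basePt K p I) ≤
          2 * C ^ 2 * (1 / (4 * C ^ 2)) := by gcongr
      _ = 1 / 2 := by field_simp; norm_num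
  intro x
  constructor
  · have h3 : h.1 x = g.1 ((g⁻¹ * h).1 x) := by rw [mul_apply', apply_inv_self']
    rw [h3]
    calc ‖g.1 ((g⁻¹ * h).1 x)‖ ≤ C * ‖(g⁻¹ * h).1 x‖ := (hg _).1
      _ ≤ C * (5 * ‖x‖) := by
        gcongr
        exact (h2 x).1
      _ = 5 * C * ‖x‖ := by ring
  · have h3 : (h⁻¹).1 x = ((g⁻¹ * h)⁻¹).1 ((g⁻¹).1 x) := by
      rw [← mul_apply']
      congr 2
      group
    rw [h3]
    calc ‖((g⁻¹ * h)⁻¹).1 ((g⁻¹).1 x)‖ ≤ 5 * ‖(g⁻¹).1 x‖ := (h2 _).2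
      _ ≤ 5 * (C * ‖x‖) := by
        gcongr
        exact (hg x).2
      _ = 5 * C * ‖x‖ := by ring

end BasePoint

section TopologicalGroup

open Filter Topology

variable {K : Type} [NormedDivisionRing K] [StarRing K] [InnerProductSpace ℝ K]
  [HermitianScalars K] {p : ℕ} {I : Type u}

lemma tendsto_X_iff {ι : Type*} {l : Filter ι} {f : ι → X K p I} {V : X K p I} :
    Tendsto f l (𝓝 V) ↔ Tendsto (fun i => projDist (f i) V) l (𝓝 0) := by
  have h := tendsto_iff_norm_sub_tendsto_zero (E := Hilb K p I →L[ℝ] Hilb K p I)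
    (f := fun i => proj (f i)) (a := l) (b := proj V)
  exact isInducing_proj.tendsto_nhds_iff.trans h

lemma tendsto_PO_iff {ι : Type*} {l : Filter ι} {f : ι → PO K p I} {g : PO K p I} :
    Tendsto f l (𝓝 g) ↔ ∀ V : X K p I, Tendsto (fun i => f i • V) l (𝓝 (g • V)) := by
  have h : IsInducing (fun (g : PO K p I) (V : X K p I) => g • V) := ⟨rfl⟩
  rw [h.tendsto_nhds_iff, tendsto_pi_nhds]
  rfl

lemma toPO_surjective : Function.Surjective (toPO K p I) :=
  QuotientGroup.mk'_surjective _

/-- The norm of an element of the orthogonal group is locally bounded for the topology of pointwise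
convergence on the symmetric space, because it is controlled by the image of the base point. -/
lemma eventually_bddBy (g : PO K p I) :
    ∃ C, 0 ≤ C ∧ ∀ᶠ g' in 𝓝 g, ∀ h, toPO K p I h = g' → BddBy C h := by
  obtain ⟨k, rfl⟩ := toPO_surjective g
  obtain ⟨C, hC, hk⟩ := exists_bddBy k
  have hC0 : 0 < C := by linarith
  refine ⟨5 * C, by positivity, ?_⟩
  have h1 := tendsto_X_iff.1 (tendsto_PO_iff.1 (tendsto_id (x := 𝓝 (toPO K p I k))) (basePt K p I))
  filter_upwards [h1.eventually_le_const (show (0 : ℝ) < 1 / (4 * C ^ 2) by positivity)] with g' hg'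
  rintro h rfl
  exact bddBy_of_projDist_le hC hk hg'

/-- Near a point of `PO_K(p, κ)`, the maps of the symmetric space and their inverses are uniformly
Lipschitz. -/
lemma eventually_lipschitz (g : PO K p I) :
    ∃ C, 0 ≤ C ∧ ∀ᶠ g' in 𝓝 g, ∀ V W : X K p I,
      projDist (g' • V) (g' • W) ≤ C * projDist V W ∧
      projDist (g'⁻¹ • V) (g'⁻¹ • W) ≤ C * projDist V W := by
  obtain ⟨C, hC, h⟩ := eventually_bddBy g
  refine ⟨2 * C ^ 2, by positivity, h.mono fun g' hg' V W => ?_⟩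
  obtain ⟨k, rfl⟩ := toPO_surjective g'
  have := hg' k rfl
  rw [← map_inv]
  exact ⟨projDist_smul_le hC this V W, projDist_smul_le hC this.inv V W⟩

instance : IsTopologicalGroup (PO K p I) where
  continuous_mul := by
    rw [continuous_iff_continuousAt]
    rintro ⟨g, h⟩
    rw [ContinuousAt, tendsto_PO_iff]
    intro V
    rw [tendsto_X_iff]
    obtain ⟨C, hC, hev⟩ := eventually_lipschitz g
    have h1 : Tendsto (fun x : PO K p I × PO K p I => x.1) (𝓝 (g, h)) (𝓝 g) := continuousAt_fst
    have h2 : Tendsto (fun x : PO K p I × PO K p I => x.2) (𝓝 (g, h)) (𝓝 h) := continuousAt_snd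
    have h3 := tendsto_X_iff.1 (tendsto_PO_iff.1 h1 (h • V))
    have h4 := tendsto_X_iff.1 (tendsto_PO_iff.1 h2 V)
    have h5 := (h4.const_mul C).add h3
    rw [mul_zero, add_zero] at h5
    refine squeeze_zero' (Eventually.of_forall fun _ => projDist_nonneg _ _) ?_ h5
    filter_upwards [h1.eventually hev] with x hx
    rw [mul_smul, mul_smul]
    refine (projDist_triangle _ (x.1 • h • V) _).trans ?_
    gcongr
    exact (hx _ _).1
  continuous_inv := by
    rw [continuous_iff_continuousAt]
    intro g
    rw [ContinuousAt, tendsto_PO_iff]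
    intro V
    rw [tendsto_X_iff]
    obtain ⟨C, hC, hev⟩ := eventually_lipschitz g
    have h1 := tendsto_X_iff.1 (tendsto_PO_iff.1 (tendsto_id (x := 𝓝 g)) (g⁻¹ • V))
    have h2 := h1.const_mul C
    rw [mul_zero] at h2
    refine squeeze_zero' (Eventually.of_forall fun _ => projDist_nonneg _ _) ?_ h2
    filter_upwards [hev] with x hx
    have h3 := (hx V (x • g⁻¹ • V)).2
    rw [inv_smul_smul] at h3
    refine h3.trans ?_
    rw [id, projDist_comm, smul_inv_smul]

end TopologicalGroup

/-! ### Faithfulness of the action, and limits of bounded families of operators -/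

section Faithful

open Filter Topology

variable {K : Type} [NormedDivisionRing K] [StarRing K] [InnerProductSpace ℝ K]
  [HermitianScalars K] {p : ℕ} {I : Type u}

/-- The pair group moves the base point: for a positive basis vector `e` and a negative unit vector
`f` orthogonal to the base point, the reflection in `e + 2 f` moves `e` out of the base point. -/
lemma exists_pairGroup_smul_ne [Infinite I] (hp : 1 ≤ p) :
    ∃ n ∈ pairGroup K p I, n • basePt K p I ≠ basePt K p I := by
  let e : Hilb K p I := bvec (Sum.inl ⟨0, hp⟩)
  obtain ⟨f, hf, hfe⟩ := exists_neg_unit_of_finite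
    (Set.finite_range fun i : Fin p => (bvec (Sum.inl i) : Hilb K p I))
  have hef : form e f = 0 := hfe e ⟨_, rfl⟩
  have hQe : Q e = 1 := Q_bvec _
  have hee : form e e = 1 := by rw [form_self, hQe, one_smul]
  have hff : form f f = -1 := by rw [form_self, hf, neg_one_smul]
  have hx : Q (e + (2 : ℝ) • f) = -3 := by
    rw [Q_add, Q_real_smul, form_real_smul_right, hef, hQe, hf, smul_zero, re_zero]
    norm_num
  have hxn : Q (e + (2 : ℝ) • f) < 0 := by rw [hx]; norm_num
  obtain ⟨y, hy, hye⟩ := exists_neg_unit_of_finite (Set.toFinite {e})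
  have hyn : Q y < 0 := neg_of_eq_neg_one hy
  refine ⟨_, nrefl_mul_mem_pairGroup hxn hyn, fun h => ?_⟩
  have hmem : (nrefl _ hxn * nrefl y hyn).1 e ∈ baseSpan K p I := by
    have := apply_mem_smul (nrefl _ hxn * nrefl y hyn) (V := basePt K p I)
      (bvec_mem_baseSpan (⟨0, hp⟩ : Fin p))
    rw [h] at this
    exact this
  have hf0 : ∀ v ∈ baseSpan K p I, form f v = 0 := by
    intro v hv
    induction hv using Submodule.span_induction with
    | mem x hx => exact form_eq_zero_symm (hfe x hx)
    | zero => exact form_zero_right f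
    | add x y _ _ hx hy => rw [form_add_right, hx, hy, add_zero]
    | smul a x _ hx => rw [← MulOpposite.op_unop a, form_smul_right, hx, zero_mul]
  have h1 := hf0 _ hmem
  rw [mul_apply', nrefl_apply_of_form_eq_zero hyn (form_eq_zero_symm (hye e rfl)), nrefl_apply,
    form_sub_right, form_real_smul_right, form_smul_right, form_add_right, form_add_left,
    form_real_smul_left, form_real_smul_right, form_eq_zero_symm hef, hee, hff, hx, smul_zero,
    add_zero, mul_one, zero_add, zero_sub] at h1
  have h2 := congrArg re h1
  rw [re_neg, re_smul, re_smul, re_neg, re_one, re_zero] at h2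
  norm_num at h2

/-- The action on the symmetric space is faithful modulo the centre. -/
lemma mem_center_of_forall_smul_eq [Infinite I] (hp : 1 ≤ p) {g : O K p I}
    (hg : ∀ V : X K p I, g • V = V) : g ∈ Subgroup.center (O K p I) := by
  by_contra hc
  obtain ⟨n, hn, hne⟩ := exists_commutator_ne_one g hc
  let L := (MulAction.toPermHom (O K p I) (X K p I)).ker
  have hL : ∀ {h : O K p I}, h ∈ L ↔ ∀ V : X K p I, h • V = V := fun {h} => by
    rw [MonoidHom.mem_ker, Equiv.ext_iff]
    rfl
  have hmem : g * n * g⁻¹ * n⁻¹ ∈ L := by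
    have h1 := (inferInstance : L.Normal).conj_mem _ (inv_mem (hL.2 hg)) n
    have h2 := mul_mem (hL.2 hg) h1
    rwa [← mul_assoc, ← mul_assoc] at h2
  have hfr : g * n * g⁻¹ * n⁻¹ ∈ Ofr K p I :=
    negGroup_le_Ofr (pairGroup_le_negGroup (mul_mem (conj_mem_pairGroup g hn) (inv_mem hn)))
  obtain ⟨k, hk, hkne⟩ := exists_pairGroup_smul_ne (K := K) (I := I) hp
  exact hkne (hL.1 (pairGroup_le_of_normal hp L
    (fun n _ m hm => (inferInstance : L.Normal).conj_mem m hm n) hmem hfr hne hk) _)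

lemma PO_ext [Infinite I] (hp : 1 ≤ p) {g h : PO K p I} (H : ∀ V : X K p I, g • V = h • V) :
    g = h := by
  rw [← inv_mul_eq_one]
  obtain ⟨k, hk⟩ := toPO_surjective (g⁻¹ * h)
  rw [← hk]
  refine (QuotientGroup.eq_one_iff k).2 (mem_center_of_forall_smul_eq hp fun V => ?_)
  rw [← toPO_smul, hk, mul_smul, ← H, inv_smul_smul]

instance : T2Space (X K p I) := T2Space.of_injective_continuous proj_injective
  isInducing_proj.continuous

lemma t2Space_PO [Infinite I] (hp : 1 ≤ p) : T2Space (PO K p I) :=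
  T2Space.of_injective_continuous (f := fun (g : PO K p I) (V : X K p I) => g • V)
    (fun _ _ h => PO_ext hp fun V => congrFun h V) continuous_induced_dom

end Faithful

section Limits

open Filter Topology

variable {K : Type} [NormedDivisionRing K] [StarRing K] [InnerProductSpace ℝ K]
  [HermitianScalars K] {p : ℕ} {I : Type u} {ι : Type*}

lemma isCompactOperator_proj (V : X K p I) : IsCompactOperator (proj V) := by
  have := finiteDimensional_restrictScalars V
  have : ProperSpace (V.1.restrictScalars ℝ) := FiniteDimensional.proper ℝ _
  exact (isCompactOperator_of_locallyCompactSpace_dom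
    (V.1.restrictScalars ℝ).orthogonalProjectionOnto).clm_comp (V.1.restrictScalars ℝ).subtypeL

lemma eq_proj {V : X K p I} {x y : Hilb K p I} (hy : y ∈ V.1)
    (h : ∀ v ∈ V.1, inner ℝ v (x - y) = 0) : y = proj V x := by
  have h1 : proj V x - y ∈ V.1 := V.1.sub_mem (proj_mem V x) hy
  have h2 := h _ h1
  have h3 := inner_sub_proj V x h1
  have h4 : inner ℝ (proj V x - y) (proj V x - y) = (0 : ℝ) := by
    rw [← sub_eq_zero.2 (h2.trans h3.symm), ← inner_sub_right]
    congr 1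
    abel
  exact (sub_eq_zero.1 (inner_self_eq_zero.1 h4)).symm

/-- The points of the symmetric space span the Hilbert space: images of the base point by
reflections contain suitable negative vectors, and every vector is the difference of two of them. -/
lemma eq_top_of_forall_le [Infinite I] (hp : 1 ≤ p) {S : Submodule Kᵐᵒᵖ (Hilb K p I)}
    (hS : ∀ V : X K p I, V.1 ≤ S) : S = ⊤ := by
  let e : Hilb K p I := bvec (Sum.inl ⟨0, hp⟩)
  have heP : e ∈ (basePt K p I).1 := bvec_mem_baseSpan _
  have hQe : Q e = 1 := Q_bvec _
  have hee : form e e = 1 := by rw [form_self, hQe, one_smul]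
  have key : ∀ u : Hilb K p I, Q u < 0 → form u e ≠ 0 → u ∈ S := by
    intro u hu hue
    have h1 := hS _ (apply_mem_smul (nrefl u hu) heP)
    rw [nrefl_apply, ← op_real_smul, smul_smul, ← MulOpposite.op_mul] at h1
    have h2 := S.sub_mem (hS _ heP) h1
    rw [sub_sub_cancel] at h2
    refine (S.smul_mem_iff ?_).1 h2
    rw [Ne, MulOpposite.op_eq_zero_iff, mul_smul_comm, mul_one, smul_eq_zero, not_or]
    have := inv_ne_zero hu.ne
    exact ⟨mul_ne_zero two_ne_zero this, hue⟩
  refine eq_top_iff.2 fun x _ => ?_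
  obtain ⟨f, hf, hfs⟩ := exists_neg_unit_of_finite (Set.toFinite {x, e})
  have hxf : form x f = 0 := hfs x (by simp)
  have hef : form e f = 0 := hfs e (by simp)
  set s : ℝ := ‖form x e‖ + 1 with hs
  have hs0 : 0 < s := by positivity
  set t : ℝ := |Q x| + s ^ 2 + 2 * s * |re (form x e)| + 1 with ht
  have ht1 : 1 ≤ t := by
    have : 0 ≤ |Q x| + s ^ 2 + 2 * s * |re (form x e)| := by positivity
    linarith
  have ht2 : t ≤ t ^ 2 := by nlinarith
  have h0 : 0 ≤ 2 * s * |re (form x e)| := by positivity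
  have hQu : Q (s • e + t • f) = s ^ 2 - t ^ 2 := by
    rw [Q_add, Q_real_smul, Q_real_smul, form_real_smul_right, form_real_smul_left, hef, hQe, hf,
      smul_zero, smul_zero, re_zero]
    ring
  have hu : s • e + t • f ∈ S := by
    refine key _ ?_ ?_
    · rw [hQu]
      have := abs_nonneg (Q x)
      linarith
    · rw [form_add_left, form_real_smul_left, form_real_smul_left, form_eq_zero_symm hef, hee,
        smul_zero, add_zero]
      exact smul_ne_zero hs0.ne' one_ne_zero
  have hxu : x + (s • e + t • f) ∈ S := by
    refine key _ ?_ ?_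
    · rw [Q_add, hQu, form_add_right, form_real_smul_right, form_real_smul_right, hxf, smul_zero,
        add_zero, re_smul]
      have h3 := le_abs_self (Q x)
      have h4 := mul_le_mul_of_nonneg_left (le_abs_self (re (form x e))) hs0.le
      linarith
    · rw [form_add_left, form_add_left, form_real_smul_left, form_real_smul_left,
        form_eq_zero_symm hef, hee, smul_zero, add_zero]
      intro h
      have h3 := congrArg norm (eq_neg_of_add_eq_zero_left h)
      rw [norm_neg, norm_smul, norm_one, mul_one, Real.norm_of_nonneg hs0.le] at h3
      linarith
  have := S.sub_mem hxu hu
  rwa [add_sub_cancel_right] at this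

/-- If the projections to `f i • V` converge and the `f i` are bounded then the `f i` converge along
an ultrafilter at every vector of `V`, because the limit of the projections is a compact operator. -/
lemma exists_tendsto_of_mem {U : Ultrafilter ι} {f : ι → O K p I} {C : ℝ}
    (hC : ∀ᶠ i in (U : Filter ι), BddBy C (f i)) {V : X K p I}
    {A : Hilb K p I →L[ℝ] Hilb K p I} (hA : Tendsto (fun i => proj (f i • V)) U (𝓝 A))
    {x : Hilb K p I} (hx : x ∈ V.1) : ∃ y, Tendsto (fun i => (f i).1 x) U (𝓝 y) := by
  have hAc : IsCompactOperator (A : Hilb K p I →ₗ[ℝ] Hilb K p I) :=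
    isCompactOperator_of_tendsto hA (Eventually.of_forall fun _ => isCompactOperator_proj _)
  obtain ⟨k, hk, hAk⟩ := hAc.image_closedBall_subset_compact (C * ‖x‖)
  have h1 : (U.map fun i => A ((f i).1 x) : Filter (Hilb K p I)) ≤ 𝓟 k := by
    rw [Ultrafilter.coe_map, le_principal_iff, mem_map]
    filter_upwards [hC] with i hi
    exact hAk ⟨_, by simpa using (hi x).1, rfl⟩
  obtain ⟨y, -, hy⟩ := hk.ultrafilter_le_nhds _ h1
  have hy' : Tendsto (fun i => A ((f i).1 x)) U (𝓝 y) := hy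
  refine ⟨y, ?_⟩
  have h2 : Tendsto (fun i => (proj (f i • V) - A) ((f i).1 x)) U (𝓝 0) := by
    have h3 : Tendsto (fun i => ‖proj (f i • V) - A‖ * (C * ‖x‖)) U (𝓝 0) := by
      have := ((tendsto_iff_norm_sub_tendsto_zero
        (E := Hilb K p I →L[ℝ] Hilb K p I)).1 hA).mul_const (C * ‖x‖)
      rwa [zero_mul] at this
    refine squeeze_zero_norm' ?_ h3
    filter_upwards [hC] with i hi
    exact ((proj (f i • V) - A).le_opNorm _).trans
      (mul_le_mul_of_nonneg_left (hi x).1 (norm_nonneg _))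
  have h4 := hy'.add h2
  rw [add_zero] at h4
  refine h4.congr fun i => ?_
  rw [sub_apply, proj_eq_self (apply_mem_smul (f i) hx), add_sub_cancel]

/-- The vectors at which the `f i` converge form a subspace, and this subspace contains all points of
the symmetric space. -/
lemma exists_tendsto [Infinite I] (hp : 1 ≤ p) {U : Ultrafilter ι} {f : ι → O K p I} {C : ℝ}
    (hC : ∀ᶠ i in (U : Filter ι), BddBy C (f i))
    (hA : ∀ V : X K p I, ∃ A, Tendsto (fun i => proj (f i • V)) U (𝓝 A)) :
    ∃ T : Hilb K p I → Hilb K p I, ∀ x, Tendsto (fun i => (f i).1 x) U (𝓝 (T x)) := by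
  let S : Submodule Kᵐᵒᵖ (Hilb K p I) :=
    { carrier := {x | ∃ y, Tendsto (fun i => (f i).1 x) U (𝓝 y)}
      zero_mem' := ⟨0, by simp⟩
      add_mem' := by
        rintro x x' ⟨y, hy⟩ ⟨y', hy'⟩
        refine ⟨y + y', ?_⟩
        simp only [map_add]
        exact hy.add hy'
      smul_mem' := by
        rintro a x ⟨y, hy⟩
        refine ⟨a • y, ?_⟩
        simp only [map_smul]
        exact hy.const_smul a }
  have hS : S = ⊤ := eq_top_of_forall_le hp fun V x hx => by
    obtain ⟨A, hA⟩ := hA V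
    exact exists_tendsto_of_mem hC hA hx
  have h : ∀ x, ∃ y, Tendsto (fun i => (f i).1 x) U (𝓝 y) := fun x => by
    have : x ∈ S := hS ▸ Submodule.mem_top
    exact this
  choose T hT using h
  exact ⟨T, hT⟩

lemma continuous_Q : Continuous (Q : Hilb K p I → ℝ) := by
  have h : (Q : Hilb K p I → ℝ) = fun x => 2 * ‖proj (basePt K p I) x‖ ^ 2 - ‖x‖ ^ 2 :=
    funext Q_eq_basePt
  rw [h]
  fun_prop

/-- An ultrafilter of uniformly bounded elements of the orthogonal group, for which the projections
to the images of every point of the symmetric space converge, has a limit in the orthogonal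
group. -/
lemma exists_limit [Infinite I] (hp : 1 ≤ p) {U : Ultrafilter ι} {f : ι → O K p I} {C : ℝ}
    (hC : ∀ᶠ i in (U : Filter ι), BddBy C (f i))
    (hA : ∀ V : X K p I, ∃ A, Tendsto (fun i => proj (f i • V)) U (𝓝 A))
    (hB : ∀ V : X K p I, ∃ B, Tendsto (fun i => proj ((f i)⁻¹ • V)) U (𝓝 B)) :
    ∃ T : O K p I, (∀ x, Tendsto (fun i => (f i).1 x) U (𝓝 (T.1 x))) ∧
      Tendsto (fun i => toPO K p I (f i)) U (𝓝 (toPO K p I T)) := by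
  obtain ⟨T, hT⟩ := exists_tendsto hp hC hA
  have hC' : ∀ᶠ i in (U : Filter ι), BddBy C (f i)⁻¹ := hC.mono fun i hi => hi.inv
  obtain ⟨T', hT'⟩ := exists_tendsto hp hC' hB
  -- diagonal limits, by uniform boundedness
  have diag : ∀ {f : ι → O K p I} {T : Hilb K p I → Hilb K p I},
      (∀ᶠ i in (U : Filter ι), BddBy C (f i)) →
      (∀ x, Tendsto (fun i => (f i).1 x) U (𝓝 (T x))) →
      ∀ {z : ι → Hilb K p I} {w}, Tendsto z U (𝓝 w) →
        Tendsto (fun i => (f i).1 (z i)) U (𝓝 (T w)) := by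
    intro f T hC hT z w hz
    have h1 : Tendsto (fun i => (f i).1 (z i - w)) U (𝓝 0) := by
      have h2 := (tendsto_iff_norm_sub_tendsto_zero.1 hz).const_mul C
      rw [mul_zero] at h2
      exact squeeze_zero_norm' (hC.mono fun i hi => (hi _).1) h2
    have h3 := h1.add (hT w)
    rw [zero_add] at h3
    exact h3.congr fun i => by rw [map_sub, sub_add_cancel]
  have hbd : ∀ {f : ι → O K p I} {T : Hilb K p I → Hilb K p I},
      (∀ᶠ i in (U : Filter ι), BddBy C (f i)) →
      (∀ x, Tendsto (fun i => (f i).1 x) U (𝓝 (T x))) → Continuous T := by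
    intro f T hC hT
    let T₀ : Hilb K p I →+ Hilb K p I := AddMonoidHom.mk' T fun x y =>
      tendsto_nhds_unique (hT (x + y)) (by simpa only [map_add] using (hT x).add (hT y))
    exact AddMonoidHomClass.continuous_of_bound T₀ C fun x =>
      le_of_tendsto (hT x).norm (hC.mono fun i hi => (hi x).1)
  -- the pointwise limits of `f i` and of `(f i)⁻¹` are inverse to each other
  have hinv : ∀ x, T' (T x) = x := fun x =>
    tendsto_nhds_unique (diag hC' hT' (hT x)) (tendsto_const_nhds.congr fun i =>
      (inv_apply_self' (f i) x).symm)
  have hinv' : ∀ x, T (T' x) = x := fun x =>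
    tendsto_nhds_unique (diag hC hT (hT' x)) (tendsto_const_nhds.congr fun i =>
      (apply_inv_self' (f i) x).symm)
  let T₁ : Hilb K p I ≃L[Kᵐᵒᵖ] Hilb K p I :=
    { toFun := T
      invFun := T'
      left_inv := hinv
      right_inv := hinv'
      map_add' := fun x y =>
        tendsto_nhds_unique (hT (x + y)) (by simpa only [map_add] using (hT x).add (hT y))
      map_smul' := fun a x =>
        tendsto_nhds_unique (hT (a • x)) (by simpa only [map_smul, RingHom.id_apply] using (hT x).const_smul a)
      continuous_toFun := hbd hC hT
      continuous_invFun := hbd hC' hT' }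
  let T₂ : O K p I := ⟨T₁, fun x => tendsto_nhds_unique
    ((continuous_Q.tendsto _).comp (hT x)) (tendsto_const_nhds.congr fun i => ((f i).2 x).symm)⟩
  refine ⟨T₂, hT, tendsto_PO_iff.2 fun V => isInducing_proj.tendsto_nhds_iff.2 ?_⟩
  obtain ⟨A, hAV⟩ := hA V
  have hlim : ∀ z, Tendsto (fun i => proj (f i • V) z) U (𝓝 (A z)) := fun z =>
    ((ContinuousLinearMap.apply ℝ (Hilb K p I) z).continuous.tendsto A).comp hAV
  have hclosed : IsClosed (V.1 : Set (Hilb K p I)) := by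
    have := finiteDimensional_restrictScalars V
    exact (V.1.restrictScalars ℝ).closed_of_finiteDimensional
  -- `A z` is in `T V` and `z - A z` is orthogonal to it
  have hAeq : A = proj (T₂ • V) := by
    ext1 z
    refine eq_proj ?_ ?_
    · refine ⟨T' (A z), ?_, hinv' _⟩
      refine hclosed.mem_of_tendsto (diag hC' hT' (hlim z)) (Eventually.of_forall fun i => ?_)
      obtain ⟨v, hv, hvz⟩ := proj_mem (f i • V) z
      change (f i)⁻¹.1 (proj (f i • V) z) ∈ V.1
      rw [← hvz]
      change (f i)⁻¹.1 ((f i).1 v) ∈ V.1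
      rwa [inv_apply_self']
    · rintro _ ⟨v, hv, rfl⟩
      refine tendsto_nhds_unique ((hT v).inner (tendsto_const_nhds.sub (hlim z)))
        (tendsto_const_nhds.congr fun i => ?_)
      exact (inner_sub_proj (f i • V) z (apply_mem_smul (f i) hv)).symm
  change Tendsto (fun i => proj (f i • V)) U (𝓝 (proj (T₂ • V)))
  rw [← hAeq]
  exact hAV

end Limits

/-! ### The orthochronous group is closed, and the groups are Polish -/

section Closed

open Filter Topology

variable {p : ℕ} {I : Type u}

/-- A section of a surjective homomorphism that takes the image of a subgroup to this subgroup. -/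
lemma exists_section {G H : Type*} [Group G] [Group H] (φ : G →* H) (hφ : Function.Surjective φ)
    (S : Subgroup G) : ∃ σ : H → G, (∀ h, φ (σ h) = h) ∧ ∀ h ∈ S.map φ, σ h ∈ S := by
  have h : ∀ h : H, ∃ g, φ g = h ∧ (h ∈ S.map φ → g ∈ S) := by
    intro h
    by_cases hh : h ∈ S.map φ
    · obtain ⟨g, hg, rfl⟩ := hh
      exact ⟨g, rfl, fun _ => hg⟩
    · obtain ⟨g, rfl⟩ := hφ h
      exact ⟨g, rfl, fun h' => absurd h' hh⟩
  choose σ hσ using h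
  exact ⟨σ, fun h => (hσ h).1, fun h => (hσ h).2⟩

/-- The orthochronous group is closed: the determinant of the compression passes to limits, and it
never vanishes. -/
lemma isClosed_POOrtho [Infinite I] (hp : 1 ≤ p) : IsClosed (POOrtho p I : Set (PO ℝ p I)) := by
  rw [isClosed_iff_ultrafilter]
  intro g U hU hmem
  obtain ⟨σ, hσ, hσO⟩ := exists_section (toPO ℝ p I) toPO_surjective (OOrtho p I)
  obtain ⟨C, hC0, hC⟩ := eventually_bddBy g
  have hid : Tendsto (fun g : PO ℝ p I => g) U (𝓝 g) := hU
  have h1 : ∀ {f : PO ℝ p I → PO ℝ p I} {g}, Tendsto f U (𝓝 g) → ∀ V : X ℝ p I,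
      Tendsto (fun g => proj (f g • V)) U (𝓝 (proj (g • V))) := fun hf V =>
    (isInducing_proj.continuous.tendsto _).comp (tendsto_PO_iff.1 hf V)
  obtain ⟨T, hT, hTlim⟩ := exists_limit hp (U := U) (f := σ) (C := C)
    ((hC.filter_mono hU).mono fun g' h => h _ (hσ g'))
    (fun V => ⟨_, by simpa only [← toPO_smul, hσ] using h1 hid V⟩)
    (fun V => ⟨_, by simpa only [← toPO_smul, map_inv, hσ] using h1 hid.inv V⟩)
  simp only [hσ] at hTlim
  have := t2Space_PO (K := ℝ) (I := I) hp
  rw [tendsto_nhds_unique hid hTlim]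
  refine ⟨T, ?_, rfl⟩
  have hdet : Tendsto (fun g => (compression (σ g).1).det) U (𝓝 (compression T.1).det) := by
    refine ((Continuous.matrix_det continuous_id).tendsto _).comp ?_
    refine tendsto_pi_nhds.2 fun i => tendsto_pi_nhds.2 fun j => ?_
    have h2 := ((continuous_form_right (bvec (Sum.inl i))).tendsto _).comp (hT (posVec j))
    simpa [form_bvec, sgn, Function.comp_def] using h2
  have h3 : 0 ≤ (compression T.1).det := ge_of_tendsto hdet
    ((show ∀ᶠ g in (U : Filter (PO ℝ p I)), g ∈ POOrtho p I from hmem).mono fun g' hg' =>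
      (det_compression_pos (hσO g' hg')).le)
  exact sign_eq_one_iff.2 (lt_of_le_of_ne h3 (det_compression_ne_zero T).symm)

end Closed

section Separable

open Filter Topology TopologicalSpace

variable {K : Type} [NormedDivisionRing K] [StarRing K] [InnerProductSpace ℝ K]
  [HermitianScalars K] {p : ℕ} {I : Type u}

lemma separableSpace_Hilb [Countable I] : SeparableSpace (Hilb K p I) := by
  classical
  have : ProperSpace K := FiniteDimensional.proper ℝ K
  have h1 : IsSeparable (⋃ i, Set.range fun a : K =>
      (lp.single 2 i a : Hilb K p I)) := by
    refine IsSeparable.iUnion fun i => isSeparable_range ?_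
    exact (lp.singleContinuousLinearMap ℝ (fun _ : Fin p ⊕ I => K) 2 i).continuous
  refine isSeparable_univ_iff.1 ((h1.span (R := ℝ)).closure.mono fun x _ => ?_)
  refine mem_closure_of_tendsto (lp.hasSum_single ENNReal.ofNat_ne_top x)
    (Eventually.of_forall fun s => ?_)
  exact Submodule.sum_mem _ fun i _ => Submodule.subset_span (Set.mem_iUnion.2 ⟨i, _, rfl⟩)

variable (K p I) in
/-- The closed span of the operators of rank one. It contains the projections to the points of the
symmetric space and, as opposed to the space of all operators, is separable when the index set is
countable. -/
def rankOneSpan : Submodule ℝ (Hilb K p I →L[ℝ] Hilb K p I) :=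
  (Submodule.span ℝ (Set.range fun x : Hilb K p I × Hilb K p I =>
    InnerProductSpace.rankOne ℝ x.1 x.2)).topologicalClosure

lemma secondCountableTopology_rankOneSpan [Countable I] :
    SecondCountableTopology (rankOneSpan K p I) := by
  have := separableSpace_Hilb (K := K) (p := p) (I := I)
  have h : IsSeparable (Set.range fun x : Hilb K p I × Hilb K p I =>
      InnerProductSpace.rankOne ℝ x.1 x.2) := 
    isSeparable_range
      (((InnerProductSpace.rankOne ℝ).continuous.comp continuous_fst).clm_apply continuous_snd)
  exact (h.span (R := ℝ)).closure.secondCountableTopology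

instance : IsCompletelyMetrizableSpace (rankOneSpan K p I) :=
  have : IsCompletelyMetrizableSpace (Hilb K p I →L[ℝ] Hilb K p I) :=
    ⟨⟨(inferInstance : MetricSpace (Hilb K p I →L[ℝ] Hilb K p I)), rfl, inferInstance⟩⟩
  (Submodule.isClosed_topologicalClosure _).isCompletelyMetrizableSpace

lemma proj_mem_rankOneSpan (V : X K p I) : proj V ∈ rankOneSpan K p I := by
  have := finiteDimensional_restrictScalars V
  refine Submodule.le_topologicalClosure _ ?_
  rw [proj, (stdOrthonormalBasis ℝ (V.1.restrictScalars ℝ)).starProjection_eq_sum_rankOne]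
  exact Submodule.sum_mem _ fun i _ => Submodule.subset_span ⟨(_, _), rfl⟩

/-- The projection to a point of the symmetric space, in the closed span of the operators of rank
one. -/
def projFr (V : X K p I) : rankOneSpan K p I := ⟨proj V, proj_mem_rankOneSpan V⟩

lemma isInducing_projFr : IsInducing (projFr : X K p I → rankOneSpan K p I) :=
  isInducing_proj.codRestrict proj_mem_rankOneSpan

lemma secondCountableTopology_X [Countable I] : SecondCountableTopology (X K p I) :=
  have := secondCountableTopology_rankOneSpan (K := K) (p := p) (I := I)
  isInducing_projFr.secondCountableTopology

end Separable

section Height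

open Filter Topology

variable {K : Type} [NormedDivisionRing K] [StarRing K] [InnerProductSpace ℝ K]
  [HermitianScalars K] {p : ℕ} {I : Type u}

/-- The square of the sine of the largest angle between the subspace `V` and the base point. It is
less than `1 / 2` when `Q` is positive definite on `V`, and tends to `1 / 2` when `V` goes to
infinity. -/
def sinSq (V : X K p I) : ℝ :=
  ‖(ContinuousLinearMap.id ℝ (Hilb K p I) - proj (basePt K p I)) ∘L proj V‖ ^ 2

lemma continuous_sinSq : Continuous (sinSq : X K p I → ℝ) := by
  have : Continuous (proj : X K p I → _) := isInducing_proj.continuous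
  exact (Continuous.norm (E := Hilb K p I →L[ℝ] Hilb K p I)
    (continuous_const.clm_comp this)).pow 2

lemma le_Q_of_mem {V : X K p I} {x : Hilb K p I} (hx : x ∈ V.1) :
    (1 - 2 * sinSq V) * ‖x‖ ^ 2 ≤ Q x := by
  have h := ((ContinuousLinearMap.id ℝ (Hilb K p I) - proj (basePt K p I)) ∘L proj V).le_opNorm x
  have h1 : ((ContinuousLinearMap.id ℝ (Hilb K p I) - proj (basePt K p I)) ∘L proj V) x =
      x - proj (basePt K p I) x := by
    rw [ContinuousLinearMap.comp_apply, proj_eq_self hx]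
    rfl
  rw [h1] at h
  have h2 := pow_le_pow_left₀ (norm_nonneg _) h 2
  rw [mul_pow] at h2
  change _ ≤ sinSq V * _ at h2
  have h3 := norm_sq_eq_proj (basePt K p I) x
  rw [Q_eq_basePt]
  linarith

lemma two_mul_sinSq_smul_lt (g : O K p I) : 2 * sinSq (g • basePt K p I) < 1 := by
  obtain ⟨C, hC1, hC⟩ := exists_bddBy g
  have hC2 : 1 ≤ C ^ 2 := one_le_pow₀ hC1
  set c : ℝ := (1 - 1 / C ^ 2) / 2 with hc
  have hd : 0 < 1 / C ^ 2 := by positivity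
  have hd1 : 1 / C ^ 2 ≤ 1 := by rw [div_le_one (by positivity)]; exact hC2
  have hc0 : 0 ≤ c := by rw [hc]; linarith
  have h1 : ‖(ContinuousLinearMap.id ℝ (Hilb K p I) - proj (basePt K p I)) ∘L
      proj (g • basePt K p I)‖ ≤ √c := by
    refine ContinuousLinearMap.opNorm_le_bound _ (Real.sqrt_nonneg _) fun x => ?_
    obtain ⟨e, he, hex⟩ := proj_mem (g • basePt K p I) x
    have hex' : g.1 e = proj (g • basePt K p I) x := hex
    set y := proj (g • basePt K p I) x with hy
    change ‖y - proj (basePt K p I) y‖ ≤ _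
    have h2 := norm_sq_eq_proj (basePt K p I) y
    have h3 := Q_eq_basePt y
    have h4 : Q y = ‖e‖ ^ 2 := by rw [← hex', g.2, Q_eq_norm_sq_of_mem_baseSpan he]
    have h5 : 1 / C ^ 2 * ‖y‖ ^ 2 ≤ ‖e‖ ^ 2 := by
      rw [one_div_mul_eq_div, div_le_iff₀ (by positivity), ← hex']
      have := pow_le_pow_left₀ (norm_nonneg _) (hC e).1 2
      linarith
    have h6 : ‖y - proj (basePt K p I) y‖ ^ 2 ≤ c * ‖y‖ ^ 2 := by
      rw [hc]
      linarith
    have h7 : ‖y - proj (basePt K p I) y‖ ≤ √c * ‖y‖ := by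
      refine (pow_le_pow_iff_left₀ (norm_nonneg _) (by positivity) two_ne_zero).1 ?_
      rwa [mul_pow, Real.sq_sqrt hc0]
    refine h7.trans ?_
    gcongr
    exact norm_proj_le _ _
  have h2 : sinSq (g • basePt K p I) ≤ c := by
    have := pow_le_pow_left₀ (ContinuousLinearMap.opNorm_nonneg _) h1 2
    rwa [Real.sq_sqrt hc0] at this
  rw [hc] at h2
  linarith

/-- The image of the base point bounds the norm of an element of the orthogonal group. -/
lemma bddBy_of_sinSq {g : O K p I} {s : ℝ} (hs : (1 - 2 * sinSq (g • basePt K p I))⁻¹ ≤ s) :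
    BddBy (1 + 2 * s) g := by
  have h0 : 0 < 1 - 2 * sinSq (g • basePt K p I) := by linarith [two_mul_sinSq_smul_lt g]
  have hs0 : 0 ≤ s := (inv_pos.2 h0).le.trans hs
  refine bddBy_of_baseSpan hs0 fun e he => ?_
  have h1 := le_Q_of_mem (apply_mem_smul g (V := basePt K p I) he)
  rw [g.2, Q_eq_norm_sq_of_mem_baseSpan he] at h1
  calc ‖g.1 e‖ ^ 2 = (1 - 2 * sinSq (g • basePt K p I))⁻¹ *
        ((1 - 2 * sinSq (g • basePt K p I)) * ‖g.1 e‖ ^ 2) := by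
        rw [inv_mul_cancel_left₀ h0.ne']
    _ ≤ s * ‖e‖ ^ 2 := by gcongr

end Height

section Polish

open Filter Topology TopologicalSpace

variable {K : Type} [NormedDivisionRing K] [StarRing K] [InnerProductSpace ℝ K]
  [HermitianScalars K] {p : ℕ} {I : Type u} {ι : Type*}

/-- For uniformly bounded elements of the orthogonal group, convergence of the projections on a
dense set of the symmetric space implies convergence everywhere. -/
lemma exists_tendsto_proj {U : Ultrafilter ι} {f : ι → O K p I} {C : ℝ} (hC0 : 0 ≤ C)
    (hC : ∀ᶠ i in (U : Filter ι), BddBy C (f i)) {D : Set (X K p I)} (hD : Dense D)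
    (hA : ∀ V ∈ D, ∃ A, Tendsto (fun i => projFr (f i • V)) U (𝓝 A)) (V : X K p I) :
    ∃ A, Tendsto (fun i => proj (f i • V)) U (𝓝 A) := by
  refine cauchy_map_iff_exists_tendsto.1 ((Metric.cauchy_iff (α := Hilb K p I →L[ℝ] Hilb K p I)).2
    ⟨inferInstance, fun ε hε => ?_⟩)
  -- a point of the dense set whose images stay near those of `V`
  obtain ⟨W, hW, hVW⟩ : ∃ W ∈ D, 2 * C ^ 2 * projDist W V < ε / 4 := by
    have h1 : Tendsto (fun W => 2 * C ^ 2 * projDist W V) (𝓝 V) (𝓝 0) := by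
      have := (tendsto_X_iff.1 (tendsto_id (x := 𝓝 V))).const_mul (2 * C ^ 2)
      rwa [mul_zero] at this
    have h2 := h1.eventually_lt_const (show 0 < ε / 4 by positivity)
    obtain ⟨W, hW, hWD⟩ := mem_closure_iff_nhds.1 (hD V) _ h2
    exact ⟨W, hWD, hW⟩
  obtain ⟨A, hAW⟩ := hA W hW
  have h3 := hAW.eventually (Metric.ball_mem_nhds A (show 0 < ε / 4 by positivity))
  refine ⟨_, image_mem_map (h3.and hC), ?_⟩
  have h4 : ∀ i, (projFr (f i • W) ∈ Metric.ball A (ε / 4) ∧ BddBy C (f i)) →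
      dist (proj (f i • V)) A.1 < ε / 2 := by
    rintro i ⟨hi, hCi⟩
    have h5 : dist (proj (f i • V)) (proj (f i • W)) ≤ 2 * C ^ 2 * projDist W V := by
      rw [projDist_comm W V, dist_eq_norm (E := Hilb K p I →L[ℝ] Hilb K p I)]
      exact projDist_smul_le hC0 hCi V W
    have h6 : dist (proj (f i • W)) A.1 < ε / 4 := hi
    have := dist_triangle (proj (f i • V)) (proj (f i • W)) A.1
    linarith
  rintro _ ⟨i, hi, rfl⟩ _ ⟨j, hj, rfl⟩
  have := dist_triangle_right (proj (f i • V)) (proj (f j • V)) A.1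
  linarith [h4 i hi, h4 j hj]

/-- For countable `I`, the group `PO_K(p, κ)` is a closed subspace of a countable product of Polish
spaces. The last coordinate bounds the norm of an element; it is needed because the space of
projections is not complete at the projections to degenerate subspaces. -/
lemma polishSpace_PO [Infinite I] (hp : 1 ≤ p) [Countable I] : PolishSpace (PO K p I) := by
  have := secondCountableTopology_rankOneSpan (K := K) (p := p) (I := I)
  have := secondCountableTopology_X (K := K) (p := p) (I := I)
  have := t2Space_PO (K := K) (I := I) hp
  obtain ⟨D, hDc, hD⟩ := exists_countable_dense (X K p I)
  have : Countable D := hDc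
  let Φ : PO K p I → (D → rankOneSpan K p I × rankOneSpan K p I) × ℝ := fun g =>
    (fun V => (projFr (g • V.1), projFr (g⁻¹ • V.1)), (1 - 2 * sinSq (g • basePt K p I))⁻¹)
  have hsmul : ∀ V : X K p I, Continuous fun g : PO K p I => g • V := fun V =>
    (continuous_apply V).comp continuous_induced_dom
  have hcont : Continuous Φ := by
    refine Continuous.prodMk (continuous_pi fun V => ?_) ?_
    · exact (isInducing_projFr.continuous.comp (hsmul V)).prodMk
        (isInducing_projFr.continuous.comp ((hsmul V).comp continuous_inv))
    · refine Continuous.inv₀ (continuous_const.sub (continuous_const.mul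
        (continuous_sinSq.comp (hsmul _)))) fun g => ?_
      obtain ⟨g, rfl⟩ := toPO_surjective g
      exact (sub_pos.2 (two_mul_sinSq_smul_lt g)).ne'
  have hinj : Function.Injective Φ := by
    intro g h hgh
    have h1 : ∀ {g : PO K p I}, Continuous fun V : X K p I => g • V := by
      intro g
      obtain ⟨C, hC0, hC⟩ := eventually_lipschitz g
      rw [continuous_iff_continuousAt]
      intro V
      refine tendsto_X_iff.2 ?_
      have h2 := (tendsto_X_iff.1 (tendsto_id (x := 𝓝 V))).const_mul C
      rw [mul_zero] at h2
      exact squeeze_zero (fun _ => projDist_nonneg _ _)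
        (fun W => (hC.self_of_nhds W V).1) h2
    have h2 : (fun V : X K p I => g • V) = fun V => h • V := by
      refine Continuous.ext_on hD h1 h1 fun V hV => proj_injective ?_
      exact congrArg (fun y => ((y.1 ⟨V, hV⟩).1 : Hilb K p I →L[ℝ] Hilb K p I)) hgh
    exact PO_ext hp fun V => congrFun h2 V
  have hproper : IsProperMap Φ := by
    refine isProperMap_iff_ultrafilter_of_t2.2 ⟨hcont, fun U y hy => ?_⟩
    obtain ⟨σ, hσ⟩ := (toPO_surjective (K := K) (p := p) (I := I)).hasRightInverse
    have hy1 := (continuous_fst.tendsto y).comp hy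
    have hy2 := (continuous_snd.tendsto y).comp hy
    have hs : 0 ≤ |y.2| + 1 := by positivity
    have hC : ∀ᶠ g in (U : Filter (PO K p I)), BddBy (1 + 2 * (|y.2| + 1)) (σ g) := by
      filter_upwards [hy2.eventually_le_const (show y.2 < |y.2| + 1 by
        linarith [le_abs_self y.2])] with g hg
      refine bddBy_of_sinSq ?_
      rw [← toPO_smul, hσ]
      exact hg
    have hlim : ∀ V (hV : V ∈ D), Tendsto (fun g => (projFr (σ g • V), projFr ((σ g)⁻¹ • V))) U
        (𝓝 (y.1 ⟨V, hV⟩)) := by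
      intro V hV
      refine (tendsto_pi_nhds.1 hy1 ⟨V, hV⟩).congr fun g => ?_
      rw [← toPO_smul, ← toPO_smul, map_inv, hσ]
      rfl
    obtain ⟨T, -, hT⟩ := exists_limit hp hC
      (exists_tendsto_proj (by positivity) hC hD fun V hV =>
        ⟨_, (continuous_fst.tendsto _).comp (hlim V hV)⟩)
      (exists_tendsto_proj (f := fun g => (σ g)⁻¹) (by positivity)
        (hC.mono fun g hg => hg.inv) hD fun V hV =>
        ⟨_, (continuous_snd.tendsto _).comp (hlim V hV)⟩)
    refine ⟨toPO K p I T, ?_⟩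
    have h1 : Tendsto (fun g : PO K p I => g) U (𝓝 (toPO K p I T)) :=
      hT.congr fun g => hσ g
    exact h1
  exact (IsClosedEmbedding.of_continuous_injective_isClosedMap hcont hinj
    hproper.isClosedMap).polishSpace

end Polish

/-! ### Density and simplicity -/

section Simplicity

open Filter Topology

variable {K : Type} [NormedDivisionRing K] [StarRing K] [InnerProductSpace ℝ K]
  [HermitianScalars K] {p : ℕ} {I : Type u}

variable (K p I) in
/-- The image of `pairGroup` in the projective orthogonal group. -/
def projPairGroup : Subgroup (PO K p I) := (pairGroup K p I).map (toPO K p I)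

/-- Elements of the orthogonal group that `negGroup` can make fix the first `p` basis vectors are
limits of elements of the pair group, because these take the same values on any finite set of
vectors and hence on any finite set of points of the symmetric space. -/
lemma map_le_closure_projPairGroup [Infinite I] {S : Subgroup (O K p I)}
    (hS : ∀ g ∈ S, ∃ γ ∈ negGroup K p I, ∀ i : Fin p,
      (γ * g).1 (bvec (Sum.inl i)) = bvec (Sum.inl i)) :
    (S.map (toPO K p I) : Set (PO K p I)) ⊆ closure (projPairGroup K p I) := by
  classical
  rintro _ ⟨g, hg, rfl⟩
  have hspan : ∀ V : X K p I, ∃ s : Finset (Hilb K p I), Submodule.span Kᵐᵒᵖ (s : Set _) = V.1 :=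
    fun V => Module.Finite.iff_fg.1 V.2.1
  choose s hs using hspan
  have h : ∀ F : Finset (X K p I), ∃ n ∈ pairGroup K p I, ∀ V ∈ F, n • V = g • V := by
    intro F
    obtain ⟨n, hn, hng⟩ := exists_pairGroup_eqOn_of_fix (hS g hg) (F.biUnion s)
    refine ⟨n, hn, fun V hV => Subtype.ext ?_⟩
    change V.1.map (n.1 : Hilb K p I →ₗ[Kᵐᵒᵖ] Hilb K p I) =
      V.1.map (g.1 : Hilb K p I →ₗ[Kᵐᵒᵖ] Hilb K p I)
    rw [← hs V, Submodule.map_span, Submodule.map_span]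
    refine congrArg _ (Set.image_congr fun x hx => hng x ?_)
    exact Finset.mem_biUnion.2 ⟨V, hV, hx⟩
  choose n hn hng using h
  have hlim : Tendsto (fun F => toPO K p I (n F)) atTop (𝓝 (toPO K p I g)) := by
    refine tendsto_PO_iff.2 fun V => tendsto_const_nhds.congr' ?_
    filter_upwards [eventually_ge_atTop {V}] with F hF
    exact (hng F V (hF (Finset.mem_singleton_self V))).symm
  exact mem_closure_of_tendsto hlim (Eventually.of_forall fun F => ⟨n F, hn F, rfl⟩)

/-- A non-trivial subgroup of the projective orthogonal group normalised by the pair group contains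
the pair group: a commutator with a pair is a non-trivial finite rank perturbation of the
identity. -/
lemma projPairGroup_le_of_normal [Infinite I] (hp : 1 ≤ p) {L : Subgroup (PO K p I)} (hL : L ≠ ⊥)
    (hn : ∀ n ∈ projPairGroup K p I, ∀ x ∈ L, n * x * n⁻¹ ∈ L) : projPairGroup K p I ≤ L := by
  obtain ⟨x, hx, hx1⟩ := L.bot_or_exists_ne_one.resolve_left hL
  obtain ⟨m, rfl⟩ := toPO_surjective x
  obtain ⟨n, hnp, hne⟩ := exists_commutator_ne_one m
    fun h => hx1 ((QuotientGroup.eq_one_iff m).2 h)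
  have hM : ∀ k ∈ pairGroup K p I, ∀ y ∈ L.comap (toPO K p I), k * y * k⁻¹ ∈ L.comap (toPO K p I) :=
    fun k hk y hy => by
      rw [Subgroup.mem_comap, map_mul, map_mul, map_inv]
      exact hn _ ⟨k, hk, rfl⟩ _ hy
  have hk : m * n * m⁻¹ * n⁻¹ ∈ L.comap (toPO K p I) := by
    have h := mul_mem (show m ∈ L.comap (toPO K p I) from hx) (hM n hnp m⁻¹ (inv_mem hx))
    rwa [← mul_assoc, ← mul_assoc] at h
  exact Subgroup.map_le_iff_le_comap.2 (pairGroup_le_of_normal hp _ hM hk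
    (negGroup_le_Ofr (pairGroup_le_negGroup (mul_mem (conj_mem_pairGroup m hnp) (inv_mem hnp)))) hne)

lemma isSimpleGroup_projPairGroup [Infinite I] (hp : 1 ≤ p) :
    IsSimpleGroup (projPairGroup K p I) where
  exists_pair_ne := by
    obtain ⟨n, hn, hne⟩ := exists_pairGroup_smul_ne (K := K) (I := I) hp
    refine ⟨⟨toPO K p I n, n, hn, rfl⟩, 1, fun h => hne ?_⟩
    have h1 := congrArg (fun g : projPairGroup K p I => g.1 • basePt K p I) h
    exact h1.trans (one_smul _ _)
  eq_bot_or_eq_top_of_normal H hH := by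
    by_cases h : H = ⊥
    · exact Or.inl h
    refine Or.inr (eq_top_iff.2 fun x _ => ?_)
    have h1 := projPairGroup_le_of_normal hp (L := H.map (projPairGroup K p I).subtype)
      (fun h0 => h ((Subgroup.map_eq_bot_iff_of_injective _ (Subgroup.subtype_injective _)).1 h0))
      (by
        rintro n hn _ ⟨y, hy, rfl⟩
        exact ⟨⟨n, hn⟩ * y * ⟨n, hn⟩⁻¹, hH.conj_mem y hy _, rfl⟩)
    obtain ⟨y, hy, hyx⟩ := h1 x.2
    rwa [← Subtype.ext (a1 := y) (a2 := x) hyx]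

/-- A group between the pair group and its closure is topologically simple. -/
lemma isTopologicallySimple_of_le_closure [Infinite I] (hp : 1 ≤ p) {P : Subgroup (PO K p I)}
    (hle : projPairGroup K p I ≤ P) (hcl : (P : Set (PO K p I)) ⊆ closure (projPairGroup K p I)) :
    IsTopologicallySimple P := by
  intro N hN hne
  have h1 := projPairGroup_le_of_normal hp (L := N.map P.subtype)
    (fun h0 => hne ((Subgroup.map_eq_bot_iff_of_injective _ (Subgroup.subtype_injective _)).1 h0))
    (by
      rintro n hn _ ⟨y, hy, rfl⟩
      exact ⟨⟨n, hle hn⟩ * y * ⟨n, hle hn⟩⁻¹, hN.conj_mem y hy _, rfl⟩)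
  exact Subtype.dense_iff.2 (hcl.trans (closure_mono h1))

lemma dense_subgroupOf_of_le_closure {P : Subgroup (PO K p I)}
    (hle : projPairGroup K p I ≤ P) (hcl : (P : Set (PO K p I)) ⊆ closure (projPairGroup K p I)) :
    Dense ((projPairGroup K p I).subgroupOf P : Set P) :=
  Subtype.dense_iff.2 (hcl.trans (closure_mono fun x hx => ⟨⟨x, hle hx⟩, hx, rfl⟩))

variable [Infinite I]

lemma dense_projPairGroup (hfix : ∀ g : O K p I, ∃ γ ∈ negGroup K p I, ∀ i : Fin p,
    (γ * g).1 (bvec (Sum.inl i)) = bvec (Sum.inl i)) :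
    Dense (projPairGroup K p I : Set (PO K p I)) := fun x => by
  obtain ⟨g, rfl⟩ := toPO_surjective x
  exact map_le_closure_projPairGroup (S := ⊤) (fun g _ => hfix g) ⟨g, trivial, rfl⟩

lemma isTopologicallySimple_PO (hp : 1 ≤ p) (hd : Dense (projPairGroup K p I : Set (PO K p I))) :
    IsTopologicallySimple (PO K p I) := fun _ hN hne =>
  hd.mono (projPairGroup_le_of_normal hp hne fun n _ x hx => hN.conj_mem x hx n)

end Simplicity

end

end IndefiniteUnitary

theorem theorem1p4 (p : ℕ) (hp : 1 ≤ p) (I : Type*) [Infinite I] :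
    (IsTopologicalGroup (IndefiniteUnitary.PO ℂ p I) ∧
      (Countable I → PolishSpace (IndefiniteUnitary.PO ℂ p I)) ∧
      IndefiniteUnitary.IsTopologicallySimple (IndefiniteUnitary.PO ℂ p I) ∧
      IsSimpleGroup (IndefiniteUnitary.PSOfrComplex p I) ∧
      Dense (IndefiniteUnitary.PSOfrComplex p I : Set (IndefiniteUnitary.PO ℂ p I))) ∧
    (IsTopologicalGroup (IndefiniteUnitary.PO ℍ[ℝ] p I) ∧
      (Countable I → PolishSpace (IndefiniteUnitary.PO ℍ[ℝ] p I)) ∧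
      IndefiniteUnitary.IsTopologicallySimple (IndefiniteUnitary.PO ℍ[ℝ] p I) ∧
      IsSimpleGroup (IndefiniteUnitary.PSOfrQuaternion p I) ∧
      Dense (IndefiniteUnitary.PSOfrQuaternion p I : Set (IndefiniteUnitary.PO ℍ[ℝ] p I))) ∧
    (IsTopologicalGroup (IndefiniteUnitary.POOrtho p I) ∧
      (Countable I → PolishSpace (IndefiniteUnitary.POOrtho p I)) ∧
      IndefiniteUnitary.IsTopologicallySimple (IndefiniteUnitary.POOrtho p I) ∧
      IsSimpleGroup (IndefiniteUnitary.PSOfrOrtho p I) ∧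
      Dense (IndefiniteUnitary.PSOfrOrtho p I : Set (IndefiniteUnitary.POOrtho p I))) := by
  open IndefiniteUnitary in
  have hC : PSOfrComplex p I = projPairGroup ℂ p I :=
    congrArg (Subgroup.map (toPO ℂ p I)) pairGroup_eq_complex
  have hH : PSOfrQuaternion p I = projPairGroup ℍ[ℝ] p I :=
    congrArg (Subgroup.map (toPO ℍ[ℝ] p I)) pairGroup_eq_quaternion
  have hR : PSOfrOrtho p I = (projPairGroup ℝ p I).subgroupOf (POOrtho p I) := by
    rw [PSOfrOrtho, pairGroup_eq_real hp, projPairGroup]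
  have hdC := dense_projPairGroup (exists_negGroup_fix_complex (p := p) (I := I))
  have hdH := dense_projPairGroup (exists_negGroup_fix_quaternion (p := p) (I := I))
  have hle : projPairGroup ℝ p I ≤ POOrtho p I :=
    Subgroup.map_mono (pairGroup_le_negGroup.trans negGroup_le_OOrtho)
  have hcl := map_le_closure_projPairGroup (S := OOrtho p I)
    fun _ hg => exists_negGroup_fix_of_mem_OOrtho hp hg
  rw [hC, hH, hR]
  refine ⟨⟨inferInstance, fun _ => polishSpace_PO hp, isTopologicallySimple_PO hp hdC,
    isSimpleGroup_projPairGroup hp, hdC⟩, ⟨inferInstance, fun _ => polishSpace_PO hp,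
    isTopologicallySimple_PO hp hdH, isSimpleGroup_projPairGroup hp, hdH⟩, inferInstance,
    fun _ => ?_, isTopologicallySimple_of_le_closure hp hle hcl, ?_,
    dense_subgroupOf_of_le_closure hle hcl⟩
  · have := polishSpace_PO (K := ℝ) (I := I) hp
    exact (isClosed_POOrtho hp).polishSpace
  · have := isSimpleGroup_projPairGroup (K := ℝ) (I := I) hp
    exact (Subgroup.subgroupOfEquivOfLe hle).isSimpleGroup
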